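/- Let $U\subset\mathbb{R}^{m\times n}$ be open and let $W\in C^2(U)$ be an energy density with Piola stress $P(F)=W_F(F)$. Let $\Omega,\omega\subset\mathbb{R}^n$ be bounded domains with $C^1$ boundary, both containing $0$, and for $\varepsilon>0$ let $\Omega_\varepsilon=\Omega\setminus\overline{\varepsilon\omega}$ be the body with a small void; suppose that $\Omega_\varepsilon$ is connected for all small $\varepsilon>0$. Write $\mathbf{n}$ for the outward unit normals of $\Omega$, $\omega$ and $\varepsilon\omega$, and let $t:\partial\Omega\to\mathbb{R}^m$ be the applied (dead) traction. All deformations below are of class $C^2$ up to the boundary of their domains and have gradients in $U$ there. Suppose: (A1) $y$ solves $\nabla\cdot P(\nabla y)=0$ in $\Omega$, $P(\nabla y)\mathbf{n}=t$ on $\partial\Omega$; and for all small $\varepsilon>0$, $y_\varepsilon\in C^2(\overline\Omega\setminus\varepsilon\omega)$ solves $\nabla\cdot P(\nabla y_\varepsilon)=0$ in $\Omega_\varepsilon$, $P(\nabla y_\varepsilon)\mathbf{n}=0$ on $\partial(\varepsilon\omega)$, $P(\nabla y_\varepsilon)\mathbf{n}=t$ on $\partial\Omega$. (Uniqueness of these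 solutions is not needed.) (A2) There is $w\in C^2(\overline\Omega\setminus\{0\})$ such that $\varepsilon^{-n}(y_\varepsilon-y)\to w$ and $\varepsilon^{-n}(\nabla y_\varepsilon-\nabla y)\to\nabla w$ as $\varepsilon\to0^+$, uniformly on compact subsets of $\overline\Omega\setminus\{0\}$. Put $y_{\rm out}=y+\varepsilon^n w$. (A3) $\nabla y_\varepsilon(\varepsilon z)\to\nabla y_{\rm in}(z)$ as $\varepsilon\to0^+$, uniformly on compact subsets of $\mathbb{R}^n\setminus\omega$, where $y_{\rm in}$ solves the exterior traction-free problem $\nabla\cdot P(\nabla y_{\rm in})=0$ in $\mathbb{R}^n\setminus\overline\omega$, $P(\nabla y_{\rm in})\mathbf{n}=0$ on $\partial\omega$, $\nabla y_{\rm in}(z)\to\nabla y(0)$ as $|z|\to\infty$. (A4) There is a constant $m\times n$ matrix $S$ with $y_{\rm in}(z)=\nabla y(0)z+\dfrac{Sz}{|z|^n}+O(|z|^{-n})$ as $|z|\to\infty$. (A5) The outer and inner solutions match: $\nabla y_{\rm out}(\varepsilon z)-\nabla y_{\rm in}(z)\to0$ as $|z|\to\infty$ and $\varepsilon|z|\to0$,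 that is, for every $\delta>0$ there are $R,r>0$ such that $|\nabla y_{\rm out}(\varepsilon z)-\nabla y_{\rm in}(z)|\le\delta$ whenever $\varepsilon>0$, $|z|\ge R$ and $\varepsilon|z|\le r$. Let $$E=\int_\Omega W(\nabla y)\,dx-\int_{\partial\Omega}t\cdot y\,dS,\qquad E_\varepsilon=\int_{\Omega_\varepsilon}W(\nabla y_\varepsilon)\,dx-\int_{\partial\Omega}t\cdot y_\varepsilon\,dS .$$ Then the limit $\Delta E=\lim_{\varepsilon\to0^+}\dfrac{E_\varepsilon-E}{\varepsilon^n}$ exists and $$\Delta E=-\frac1n\int_{\partial\omega}W(\nabla y_{\rm in}(z))\,(\mathbf{n}\cdot z)\,dS(z).$$ -/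

import Mathlib

open Set Filter Topology MeasureTheory
open scoped Pointwise

noncomputable section

namespace VoidNucleation

/-- `ν` is the outward unit normal of the open set `O` at the boundary point `x`, near which
`O` is the sublevel set `{ρ < 0}` of a `C¹` function `ρ` whose gradient at `x` is a positive
multiple of `ν`. -/
def IsOutwardNormal {n : ℕ} (O : Set (EuclideanSpace ℝ (Fin n)))
    (x ν : EuclideanSpace ℝ (Fin n)) : Prop :=
  ‖ν‖ = 1 ∧ ∃ ρ : EuclideanSpace ℝ (Fin n) → ℝ,
    ContDiffAt ℝ 1 ρ x ∧ (∀ᶠ x' in 𝓝 x, x' ∈ O ↔ ρ x' < 0) ∧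
      ∃ c : ℝ, 0 < c ∧ gradient ρ x = c • ν

/-- `O` is a bounded domain with `C¹` boundary (lying locally on one side of its boundary). -/
structure IsC1Domain {n : ℕ} (O : Set (EuclideanSpace ℝ (Fin n))) : Prop where
  isOpen : IsOpen O
  isConnected : IsConnected O
  isBounded : Bornology.IsBounded O
  boundary : ∀ x ∈ frontier O, ∃ ν, IsOutwardNormal O x ν

open Classical in
/-- The outward unit normal field of `O` (it is `0` where there is no normal). -/
def outwardNormal {n : ℕ} (O : Set (EuclideanSpace ℝ (Fin n)))
    (x : EuclideanSpace ℝ (Fin n)) : EuclideanSpace ℝ (Fin n) :=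
  if h : ∃ ν, IsOutwardNormal O x ν then h.choose else 0

/-- Surface measure on hypersurfaces of `ℝⁿ`: the `(n-1)`-dimensional Hausdorff measure,
normalized to agree with Lebesgue measure on hyperplanes. -/
def surfaceMeasure (n : ℕ) : Measure (EuclideanSpace ℝ (Fin n)) :=
  Measure.euclideanHausdorffMeasure (n - 1)

/-- The gradient up to the boundary of a map `y` on the closure of the open set `O`. -/
def bodyGrad {n m : ℕ} (O : Set (EuclideanSpace ℝ (Fin n)))
    (y : EuclideanSpace ℝ (Fin n) → EuclideanSpace ℝ (Fin m))
    (x : EuclideanSpace ℝ (Fin n)) : EuclideanSpace ℝ (Fin n) →L[ℝ] EuclideanSpace ℝ (Fin m) :=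
  fderivWithin ℝ y (closure O) x

/-- The matrix unit `e_i ⊗ e_α`, as a linear map `v ↦ v_α e_i`. -/
def unitTensor {n m : ℕ} (i : Fin m) (α : Fin n) :
    EuclideanSpace ℝ (Fin n) →L[ℝ] EuclideanSpace ℝ (Fin m) :=
  (EuclideanSpace.proj α : EuclideanSpace ℝ (Fin n) →L[ℝ] ℝ).smulRight
    (EuclideanSpace.single i (1 : ℝ))

/-- The Piola stress `P = W_F`, i.e. `P_{iα} = ∂W/∂F_{iα}`. -/
def piola {n m : ℕ} (W : (EuclideanSpace ℝ (Fin n) →L[ℝ] EuclideanSpace ℝ (Fin m)) → ℝ)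
    (F : EuclideanSpace ℝ (Fin n) →L[ℝ] EuclideanSpace ℝ (Fin m)) : Matrix (Fin m) (Fin n) ℝ :=
  Matrix.of fun i α => fderiv ℝ W F (unitTensor i α)

/-- The traction `P(F) ν`. -/
def traction {n m : ℕ} (W : (EuclideanSpace ℝ (Fin n) →L[ℝ] EuclideanSpace ℝ (Fin m)) → ℝ)
    (F : EuclideanSpace ℝ (Fin n) →L[ℝ] EuclideanSpace ℝ (Fin m))
    (ν : EuclideanSpace ℝ (Fin n)) : EuclideanSpace ℝ (Fin m) :=
  WithLp.toLp 2 fun i => ∑ α, piola W F i α * ν α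

/-- `y`, of class `C²` up to the boundary of the body `O`, with gradients in the domain `U` of
the energy density `W`, satisfies the equilibrium equations `∇ · P(∇y) = 0` in `O`. -/
structure IsEquilibrium {n m : ℕ}
    (W : (EuclideanSpace ℝ (Fin n) →L[ℝ] EuclideanSpace ℝ (Fin m)) → ℝ)
    (U : Set (EuclideanSpace ℝ (Fin n) →L[ℝ] EuclideanSpace ℝ (Fin m)))
    (O : Set (EuclideanSpace ℝ (Fin n)))
    (y : EuclideanSpace ℝ (Fin n) → EuclideanSpace ℝ (Fin m)) : Prop where
  contDiffOn : ContDiffOn ℝ 2 y (closure O)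
  grad_mem : ∀ x ∈ closure O, bodyGrad O y x ∈ U
  div_eq_zero : ∀ x ∈ O, ∀ i : Fin m,
    ∑ α : Fin n, fderiv ℝ (fun x' => piola W (bodyGrad O y x') i α) x
      (EuclideanSpace.single α (1 : ℝ)) = 0

/-- The potential energy of the body `O` deformed by `y`, with dead tractions `t` on the loaded
part `Γ` of the boundary. -/
def potentialEnergy {n m : ℕ}
    (W : (EuclideanSpace ℝ (Fin n) →L[ℝ] EuclideanSpace ℝ (Fin m)) → ℝ)
    (O Γ : Set (EuclideanSpace ℝ (Fin n)))
    (t y : EuclideanSpace ℝ (Fin n) → EuclideanSpace ℝ (Fin m)) : ℝ :=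
  (∫ x in O, W (bodyGrad O y x)) - ∫ x in Γ, inner ℝ (t x) (y x) ∂(surfaceMeasure n)

/-- The body `Ω` from which the closed void `ε ω` has been removed. -/
def voided {n : ℕ} (Ω ω : Set (EuclideanSpace ℝ (Fin n))) (ε : ℝ) :
    Set (EuclideanSpace ℝ (Fin n)) :=
  Ω \ closure (ε • ω)

/-- Equilibrium of the intact body under the tractions `t`. -/
structure SolvesIntact {n m : ℕ}
    (W : (EuclideanSpace ℝ (Fin n) →L[ℝ] EuclideanSpace ℝ (Fin m)) → ℝ)
    (U : Set (EuclideanSpace ℝ (Fin n) →L[ℝ] EuclideanSpace ℝ (Fin m)))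
    (Ω : Set (EuclideanSpace ℝ (Fin n)))
    (t y : EuclideanSpace ℝ (Fin n) → EuclideanSpace ℝ (Fin m)) : Prop where
  equilibrium : IsEquilibrium W U Ω y
  loaded : ∀ x ∈ frontier Ω, traction W (bodyGrad Ω y x) (outwardNormal Ω x) = t x

/-- Equilibrium of the body with the traction-free void `ε ω` under the tractions `t`. -/
structure SolvesVoided {n m : ℕ}
    (W : (EuclideanSpace ℝ (Fin n) →L[ℝ] EuclideanSpace ℝ (Fin m)) → ℝ)
    (U : Set (EuclideanSpace ℝ (Fin n) →L[ℝ] EuclideanSpace ℝ (Fin m)))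
    (Ω ω : Set (EuclideanSpace ℝ (Fin n))) (ε : ℝ)
    (t y : EuclideanSpace ℝ (Fin n) → EuclideanSpace ℝ (Fin m)) : Prop where
  equilibrium : IsEquilibrium W U (voided Ω ω ε) y
  free : ∀ x ∈ frontier (ε • ω),
    traction W (bodyGrad (voided Ω ω ε) y x) (outwardNormal (ε • ω) x) = 0
  loaded : ∀ x ∈ frontier Ω,
    traction W (bodyGrad (voided Ω ω ε) y x) (outwardNormal Ω x) = t x

/-- The exterior of the closed unscaled void. -/
def exterior {n : ℕ} (ω : Set (EuclideanSpace ℝ (Fin n))) : Set (EuclideanSpace ℝ (Fin n)) :=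
  (closure ω)ᶜ

/-- The exterior traction-free problem with gradient `F₀` at infinity. -/
structure SolvesExterior {n m : ℕ}
    (W : (EuclideanSpace ℝ (Fin n) →L[ℝ] EuclideanSpace ℝ (Fin m)) → ℝ)
    (U : Set (EuclideanSpace ℝ (Fin n) →L[ℝ] EuclideanSpace ℝ (Fin m)))
    (ω : Set (EuclideanSpace ℝ (Fin n)))
    (F₀ : EuclideanSpace ℝ (Fin n) →L[ℝ] EuclideanSpace ℝ (Fin m))
    (y : EuclideanSpace ℝ (Fin n) → EuclideanSpace ℝ (Fin m)) : Prop where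
  equilibrium : IsEquilibrium W U (exterior ω) y
  free : ∀ z ∈ frontier ω, traction W (bodyGrad (exterior ω) y z) (outwardNormal ω z) = 0
  far_field : Tendsto (bodyGrad (exterior ω) y)
    (Bornology.cobounded (EuclideanSpace ℝ (Fin n))) (𝓝 F₀)

/-- `yε ε = y + εⁿ w + o(εⁿ)` in `C¹` on compact subsets of `closure Ω \ {0}`. -/
structure OuterExpansion {n m : ℕ} (Ω ω : Set (EuclideanSpace ℝ (Fin n)))
    (yε : ℝ → EuclideanSpace ℝ (Fin n) → EuclideanSpace ℝ (Fin m))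
    (y w : EuclideanSpace ℝ (Fin n) → EuclideanSpace ℝ (Fin m)) : Prop where
  contDiffOn : ContDiffOn ℝ 2 w (closure Ω \ {0})
  tendsto : ∀ K : Set (EuclideanSpace ℝ (Fin n)), IsCompact K → K ⊆ closure Ω \ {0} →
    TendstoUniformlyOn (fun (ε : ℝ) x => (ε ^ n)⁻¹ • (yε ε x - y x)) w (𝓝[>] 0) K
  tendsto_grad : ∀ K : Set (EuclideanSpace ℝ (Fin n)), IsCompact K → K ⊆ closure Ω \ {0} →
    TendstoUniformlyOn
      (fun (ε : ℝ) x => (ε ^ n)⁻¹ • (bodyGrad (voided Ω ω ε) (yε ε) x - bodyGrad Ω y x))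
      (bodyGrad Ω w) (𝓝[>] 0) K

/-- `∇yε(ε z) → ∇y_in(z)` uniformly on compact subsets of the complement of `ω`. -/
def InnerExpansion {n m : ℕ} (Ω ω : Set (EuclideanSpace ℝ (Fin n)))
    (yε : ℝ → EuclideanSpace ℝ (Fin n) → EuclideanSpace ℝ (Fin m))
    (yin : EuclideanSpace ℝ (Fin n) → EuclideanSpace ℝ (Fin m)) : Prop :=
  ∀ K : Set (EuclideanSpace ℝ (Fin n)), IsCompact K → K ⊆ ωᶜ →
    TendstoUniformlyOn (fun (ε : ℝ) z => bodyGrad (voided Ω ω ε) (yε ε) (ε • z))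
      (bodyGrad (exterior ω) yin) (𝓝[>] 0) K

/-- `y_in(z) = F₀ z + S z / |z|ⁿ + O(|z|⁻ⁿ)` as `|z| → ∞`, for some constant matrix `S`. -/
def FarFieldAsymptotics {n m : ℕ}
    (F₀ : EuclideanSpace ℝ (Fin n) →L[ℝ] EuclideanSpace ℝ (Fin m))
    (yin : EuclideanSpace ℝ (Fin n) → EuclideanSpace ℝ (Fin m)) : Prop :=
  ∃ S : EuclideanSpace ℝ (Fin n) →L[ℝ] EuclideanSpace ℝ (Fin m),
    (fun z => yin z - (F₀ z + (‖z‖ ^ n)⁻¹ • S z))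
      =O[Bornology.cobounded (EuclideanSpace ℝ (Fin n))] fun z => (‖z‖ ^ n)⁻¹

/-- The outer solution `y_out = y + εⁿ w`. -/
def outerSolution {n m : ℕ} (y w : EuclideanSpace ℝ (Fin n) → EuclideanSpace ℝ (Fin m)) (ε : ℝ) :
    EuclideanSpace ℝ (Fin n) → EuclideanSpace ℝ (Fin m) :=
  fun x => y x + ε ^ n • w x

/-- Matching: `∇y_out(ε z) - ∇y_in(z) → 0` as `|z| → ∞` and `ε |z| → 0`. -/
def Matching {n m : ℕ} (Ω ω : Set (EuclideanSpace ℝ (Fin n)))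
    (y w yin : EuclideanSpace ℝ (Fin n) → EuclideanSpace ℝ (Fin m)) : Prop :=
  ∀ δ : ℝ, 0 < δ → ∃ R : ℝ, 0 < R ∧ ∃ r : ℝ, 0 < r ∧
    ∀ (ε : ℝ) (z : EuclideanSpace ℝ (Fin n)), 0 < ε → R ≤ ‖z‖ → ε * ‖z‖ ≤ r →
      ‖bodyGrad Ω (outerSolution y w ε) (ε • z) - bodyGrad (exterior ω) yin z‖ ≤ δ

end VoidNucleation

end

/-! For an equilibrium `y` the field `V = W(∇y) x - Pᵀ(∇y x - (y - c))` has divergence `n W(∇y)`: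
since `div P = 0` and second derivatives commute, the terms with second derivatives of `y` cancel.
The energy is therefore `1/n` times a boundary flux. On a traction-free void boundary only `W (x ·
n)` survives, and the substitution `x = ε z` turns its integral into `εⁿ` times an integral over
`∂ω`. This is the source of the formula; all the rest must be shown to be `o(εⁿ)`.

Let `χ` be a radial cutoff, `0` on the ball of radius `l` and `1` off the ball of radius `2l`. The
flux of `(1 - χ) V` sees only the void, the flux of `χ Pεᵀ(yε - y)` sees only `∂Ω` and gives the
work of the dead load. Subtracting the intact body yields the exact identity `energy_difference`: up
to the void flux, `n (E_ε - E)` is the integral of `n χ (W(Fε) - W(F) - Pε:(Fε - F)) + ∇χ · (Vε - V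
- n Pεᵀ(yε - y))`, with `F = ∇y` and `Fε = ∇yε`. For fixed `l` the first summand is a Taylor
remainder of `W`, hence `o(εⁿ)`, because `Fε - F = O(εⁿ)` off the small ball.

The second summand lives on the annulus `l ≤ |x| ≤ 2l`. Freezing the stress at `A₀ = P(∇y(0))`
isolates a part linear in `yε - y`. Against a radial `∇χ` this part is the divergence of a compactly
supported tangential field, so it integrates to zero exactly (`integral_fderiv_cutoff_eq_zero`).
What remains is smaller by the oscillation of the stress, of order `l` (`exists_fluxRemainder_le`).
Matching forces `∇w = O(|x|⁻ⁿ)` and hence `w = o(|x|⁻ⁿ)` at the origin, so the remainder contributes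
`εⁿ` times a quantity that tends to `0` with `l`. Hence `l` is fixed first and `ε → 0` afterwards
(`eventually_abs_energy_difference_le`). The inner expansion gives the limit of the void flux
(`tendsto_integral_void_flux`).

The divergence theorem for `C¹` boundaries and Hausdorff surface measure (`integral_divergence`) is
obtained without an area formula. Near a boundary point the set lies below a graph with tiny
Lipschitz constant, over a hyperplane orthogonal to the normal. Fubini and the fundamental theorem
of calculus give an integral over the base. The graph map is bilipschitz with constants near `1`, so
this differs from the surface integral by a relative error `δ`. A partition of unity adds these
errors up to `δ ∫ |V|`, and `δ` is arbitrary. -/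

noncomputable section

namespace VoidNucleation

/-! ### Boundaries of regular sublevel sets as Lipschitz graphs -/

section Graph

variable {E : Type*} [NormedAddCommGroup E] [InnerProductSpace ℝ E] [FiniteDimensional ℝ E]

/-- Near a regular zero `q` of `ρ`, with gradient along `e`, the function `ρ` increases along all
directions in a cone around `u`, where `⟪e, u⟫ = 1`. -/
lemma exists_ball_lt_of_cone {ρ : E → ℝ} {q e : E} (u : E) {c κ : ℝ} (hρ : ContDiffAt ℝ 1 ρ q)
    (hc : 0 < c) (hgrad : gradient ρ q = c • e) (hκ : 0 < κ) :
    ∃ R > 0, ContinuousOn ρ (Metric.ball q R) ∧ ∀ x ∈ Metric.ball q R, ∀ x' ∈ Metric.ball q R,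
      κ * ‖(x - x') - inner ℝ e (x - x') • u‖ < inner ℝ e (x - x') → ρ x' < ρ x := by
  have hs : HasStrictFDerivAt ρ (fderiv ℝ ρ q) q := hρ.hasStrictFDerivAt one_ne_zero
  have hd : ∀ v, fderiv ℝ ρ q v = c * inner ℝ e v := by
    intro v
    have : fderiv ℝ ρ q = (InnerProductSpace.toDual ℝ E) (gradient ρ q) := by
      simp [gradient]
    rw [this, hgrad]
    simp
  set N : ℝ := 1 / κ + ‖u‖ + 1 with hN
  have hNpos : 0 < N := by positivity
  have hη : 0 < c / (2 * N) := by positivity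
  have h1 := hs.isLittleO.def hη
  obtain ⟨R, hR, hball⟩ := Metric.eventually_nhds_iff_ball.1 h1
  have hcont : ∀ᶠ x in 𝓝 q, ContinuousAt ρ x :=
    (hρ.eventually (by simp)).mono fun x hx => hx.continuousAt
  obtain ⟨R', hR', hball'⟩ := Metric.eventually_nhds_iff_ball.1 hcont
  refine ⟨min R R', lt_min hR hR', fun x hx => (hball' x ?_).continuousWithinAt, ?_⟩
  · exact Metric.ball_subset_ball (min_le_right _ _) hx
  intro x hx x' hx' hlt
  have hx2 := Metric.ball_subset_ball (min_le_left R R') hx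
  have hx2' := Metric.ball_subset_ball (min_le_left R R') hx'
  have h2 := hball (x, x') (by
    rw [Metric.mem_ball, Prod.dist_eq]; exact max_lt hx2 hx2')
  simp only [hd] at h2
  set s : ℝ := inner ℝ e (x - x') with hs_def
  have hspos : 0 < s := lt_of_le_of_lt (by positivity) hlt
  have hn : ‖x - x'‖ ≤ N * s := by
    have h3 : ‖x - x'‖ ≤ ‖(x - x') - s • u‖ + ‖s • u‖ := by
      simpa using norm_add_le ((x - x') - s • u) (s • u)
    have h4 : ‖(x - x') - s • u‖ ≤ s / κ := by
      rw [le_div_iff₀ hκ]; linarith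
    rw [norm_smul, Real.norm_of_nonneg hspos.le] at h3
    have : N * s = s / κ + s * ‖u‖ + s := by rw [hN]; ring
    linarith
  have h5 : c / (2 * N) * ‖x - x'‖ ≤ c * s / 2 := by
    calc c / (2 * N) * ‖x - x'‖ ≤ c / (2 * N) * (N * s) := by gcongr
      _ = c * s / 2 := by field_simp
  have h6 := (abs_le.1 (h2.trans h5)).1
  have : 0 < c * s := by positivity
  linarith

/-- An open set which is a sublevel set near `q` of a regular function is, in a cylinder with
axis `u`, the region below the graph of a function with small Lipschitz constant. -/
lemma exists_lipschitz_graph {O : Set E} {ρ : E → ℝ} {q e u : E} {c κ : ℝ}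
    (hρ : ContDiffAt ℝ 1 ρ q) (hO : ∀ᶠ x in 𝓝 q, x ∈ O ↔ ρ x < 0) (hq : ρ q = 0)
    (hc : 0 < c) (hgrad : gradient ρ q = c • e) (hu : inner ℝ e u = 1)
    (hκ : 0 < κ) (hκ1 : κ < 1) {R₀ : ℝ} (hR₀ : 0 < R₀) :
    ∃ r > 0, ∃ g : (ℝ ∙ e)ᗮ → ℝ, LipschitzWith (Real.toNNReal κ) g ∧
      (∀ (h : (ℝ ∙ e)ᗮ) (s : ℝ), ‖h‖ < r → |s| < r → q + h + s • u ∈ Metric.ball q R₀) ∧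
      (∀ h : (ℝ ∙ e)ᗮ, ‖h‖ < r → |g h| < r) ∧
      ∀ (h : (ℝ ∙ e)ᗮ) (s : ℝ), ‖h‖ < r → |s| < r →
        (q + h + s • u ∈ O ↔ s < g h) ∧ (q + h + s • u ∈ frontier O ↔ s = g h) := by
  obtain ⟨R, hR, hcont, hmono⟩ := exists_ball_lt_of_cone u hρ hc hgrad hκ
  obtain ⟨R', hR', hO'⟩ := Metric.eventually_nhds_iff_ball.1 hO
  set M := min R₀ (min R R') with hM
  have hMpos : 0 < M := by positivity
  set r := M / (1 + ‖u‖) with hr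
  have hrpos : 0 < r := by positivity
  have hmem : ∀ (h : (ℝ ∙ e)ᗮ) (s : ℝ), ‖h‖ < r → |s| < r → q + h + s • u ∈ Metric.ball q M := by
    intro h s hh hs
    rw [Metric.mem_ball, dist_eq_norm]
    calc ‖q + h + s • u - q‖ = ‖(h : E) + s • u‖ := by congr 1; abel
      _ ≤ ‖(h : E)‖ + ‖s • u‖ := norm_add_le _ _
      _ = ‖h‖ + |s| * ‖u‖ := by rw [norm_smul]; rfl
      _ < r + r * ‖u‖ := by
        have : |s| * ‖u‖ ≤ r * ‖u‖ := by gcongr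
        linarith
      _ = M := by rw [hr]; field_simp
  have hperp : ∀ h : (ℝ ∙ e)ᗮ, inner ℝ e (h : E) = 0 := fun h =>
    (Submodule.mem_orthogonal_singleton_iff_inner_right).1 h.2
  have hlt : ∀ (h : (ℝ ∙ e)ᗮ) (s : ℝ) (h' : (ℝ ∙ e)ᗮ) (s' : ℝ), ‖h‖ < r → |s| < r → ‖h'‖ < r →
      |s'| < r → κ * ‖h - h'‖ < s - s' → ρ (q + h' + s' • u) < ρ (q + h + s • u) := by
    intro h s h' s' hh hs hh' hs' hlt
    have e1 : (q + h + s • u) - (q + h' + s' • u) = ((h : E) - h') + (s - s') • u := by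
      rw [sub_smul]; abel
    have e2 : inner ℝ e ((q + h + s • u) - (q + h' + s' • u)) = s - s' := by
      rw [e1, inner_add_right, inner_sub_right, hperp, hperp, inner_smul_right, hu]; ring
    refine hmono _ (Metric.ball_subset_ball ((min_le_right _ _).trans (min_le_left _ _))
      (hmem h s hh hs)) _ (Metric.ball_subset_ball ((min_le_right _ _).trans (min_le_left _ _))
      (hmem h' s' hh' hs')) ?_
    rw [e2, e1, add_sub_cancel_right]
    exact hlt
  have hcl : ∀ (h : (ℝ ∙ e)ᗮ), ‖h‖ < r →
      ContinuousOn (fun s : ℝ => ρ (q + h + s • u)) (Icc (-(κ * r)) (κ * r)) := by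
    intro h hh
    refine hcont.comp (by fun_prop) fun s hs => ?_
    refine Metric.ball_subset_ball ((min_le_right _ _).trans (min_le_left _ _)) (hmem h s hh ?_)
    exact lt_of_le_of_lt (abs_le.2 hs) (by nlinarith)
  have hκr : κ * r < r := by nlinarith
  have hκr0 : 0 < κ * r := by positivity
  -- Comparison with `q` itself, where `ρ = 0`: the points at heights `κ r` and `-κ r` over `h` lie
  -- in the two cones at `q`, so `ρ` changes sign between them.
  have hzero : ∀ h : (ℝ ∙ e)ᗮ, ‖h‖ < r → ∃ s, |s| < r ∧ ρ (q + h + s • u) = 0 := by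
    intro h hh
    have hc' := hcl h hh
    have hp : ρ (q + h + (κ * r) • u) > 0 := by
      have := hlt h (κ * r) 0 0 hh (by rwa [abs_of_pos hκr0]) (by simpa) (by simpa)
        (by simp; gcongr; exact hh)
      simpa [hq] using this
    have hm : ρ (q + h + (-(κ * r)) • u) < 0 := by
      have := hlt 0 0 h (-(κ * r)) (by simpa) (by simpa) hh (by rwa [abs_neg, abs_of_pos hκr0])
        (by simp; gcongr; exact hh)
      simpa [hq] using this
    obtain ⟨s, hs, hs0⟩ := intermediate_value_Icc (by linarith) hc' ⟨hm.le, hp.le⟩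
    exact ⟨s, lt_of_le_of_lt (abs_le.2 hs) hκr, hs0⟩
  choose! g₀ hg₀ hg₀0 using hzero
  -- If two zeros violated the Lipschitz bound, one would lie in the cone over the other, and `ρ`
  -- would differ there.
  have hlip : LipschitzOnWith (Real.toNNReal κ) g₀ {h | ‖h‖ < r} := by
    refine LipschitzOnWith.of_le_add_mul _ fun h hh h' hh' => ?_
    rw [Real.coe_toNNReal _ hκ.le]
    by_contra hcon
    push Not at hcon
    have := hlt h (g₀ h) h' (g₀ h') hh (hg₀ h hh) hh' (hg₀ h' hh') (by
      rw [← dist_eq_norm]; linarith)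
    rw [hg₀0 h hh, hg₀0 h' hh'] at this
    exact lt_irrefl _ this
  obtain ⟨g, hg, hgeq⟩ := hlip.extend_real
  have hOmem : ∀ (h : (ℝ ∙ e)ᗮ) (s : ℝ), ‖h‖ < r → |s| < r →
      ((q + h + s • u ∈ O ↔ s < g h) ∧ (ρ (q + h + s • u) < 0 ↔ s < g h) ∧
        (0 < ρ (q + h + s • u) ↔ g h < s)) := by
    intro h s hh hs
    have hgh : g h = g₀ h := (hgeq hh).symm
    have hg0 : ρ (q + h + g h • u) = 0 := by rw [hgh]; exact hg₀0 h hh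
    have hgr : |g h| < r := by rw [hgh]; exact hg₀ h hh
    have h1 : s < g h → ρ (q + h + s • u) < 0 := fun hlt' => by
      rw [← hg0]; exact hlt _ _ _ _ hh hgr hh hs (by simpa using hlt')
    have h2 : g h < s → 0 < ρ (q + h + s • u) := fun hlt' => by
      rw [← hg0]; exact hlt _ _ _ _ hh hs hh hgr (by simpa using hlt')
    have h3 : s = g h → ρ (q + h + s • u) = 0 := fun heq => by rw [heq, hg0]
    have h4 : ρ (q + h + s • u) < 0 ↔ s < g h := by
      refine ⟨fun hh => ?_, h1⟩
      rcases lt_trichotomy s (g h) with h | h | h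
      · exact h
      · linarith [h3 h]
      · linarith [h2 h]
    refine ⟨?_, h4, ?_⟩
    · rw [hO' _ (Metric.ball_subset_ball ((min_le_right _ _).trans (min_le_right _ _))
        (hmem h s hh hs))]
      exact h4
    · refine ⟨fun hh => ?_, h2⟩
      rcases lt_trichotomy s (g h) with h | h | h
      · linarith [h1 h]
      · linarith [h3 h]
      · exact h
  refine ⟨r, hrpos, g, hg, fun h s hh hs => Metric.ball_subset_ball (min_le_left _ _)
    (hmem h s hh hs), fun h hh => by rw [← hgeq hh]; exact hg₀ h hh, fun h s hh hs =>
      ⟨(hOmem h s hh hs).1, ?_⟩⟩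
  have hinball := hmem h s hh hs
  have hR'nhds : Metric.ball q R' ∈ 𝓝 (q + h + s • u) := Metric.isOpen_ball.mem_nhds
    (Metric.ball_subset_ball ((min_le_right _ _).trans (min_le_right _ _)) hinball)
  have hcat : ContinuousAt ρ (q + h + s • u) := hcont.continuousAt (Metric.isOpen_ball.mem_nhds
    (Metric.ball_subset_ball ((min_le_right _ _).trans (min_le_left _ _)) hinball))
  constructor
  · intro hfr
    by_contra hne
    rcases lt_or_gt_of_ne hne with hlt' | hgt
    · have h1 : ρ (q + h + s • u) < 0 := ((hOmem h s hh hs).2.1).2 hlt'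
      have : O ∈ 𝓝 (q + h + s • u) := by
        filter_upwards [hcat.eventually_lt_const h1, hR'nhds] with x hx hx'
        exact (hO' x hx').2 hx
      exact hfr.2 (mem_interior_iff_mem_nhds.2 this)
    · have h1 : 0 < ρ (q + h + s • u) := ((hOmem h s hh hs).2.2).2 hgt
      have : Oᶜ ∈ 𝓝 (q + h + s • u) := by
        filter_upwards [hcat.eventually_const_lt h1, hR'nhds] with x hx hx'
        exact fun hxO => lt_asymm hx ((hO' x hx').1 hxO)
      have h2 := hfr.1
      rw [mem_closure_iff_nhds] at h2
      obtain ⟨x, hx, hx'⟩ := h2 _ this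
      exact hx hx'
  · intro heq
    refine ⟨?_, fun hint => ?_⟩
    · have ht : Tendsto (fun τ : ℝ => q + h + τ • u) (𝓝[<] s) (𝓝 (q + h + s • u)) := by
        have : Continuous fun τ : ℝ => q + h + τ • u := by fun_prop
        exact (this.tendsto s).mono_left nhdsWithin_le_nhds
      refine mem_closure_of_tendsto ht ?_
      have h1 : ∀ᶠ τ : ℝ in 𝓝[<] s, |τ| < r := by
        have : ∀ᶠ τ : ℝ in 𝓝 s, |τ| < r := continuous_abs.continuousAt.eventually_lt_const hs
        exact this.filter_mono nhdsWithin_le_nhds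
      filter_upwards [h1, self_mem_nhdsWithin] with τ hτ hτ'
      exact ((hOmem h τ hh hτ).1).2 (heq ▸ hτ')
    · exact absurd (((hOmem h s hh hs).1).1 (interior_subset hint)) (by rw [heq]; exact lt_irrefl _)

end Graph

/-! ### Oblique coordinates and integration up to a graph -/

section Graph

variable {E : Type*} [NormedAddCommGroup E] [InnerProductSpace ℝ E]

/-- Oblique coordinates on `E`: base hyperplane `q + (ℝ ∙ e)ᗮ`, axis `u`. -/
def oblique (q e u : E) (p : (ℝ ∙ e)ᗮ × ℝ) : E := q + p.1 + p.2 • u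

lemma continuous_oblique (q e u : E) : Continuous (oblique q e u) := by
  unfold oblique; fun_prop

lemma inner_coe_orthogonal (e : E) (h : (ℝ ∙ e)ᗮ) : inner ℝ e (h : E) = 0 :=
  (Submodule.mem_orthogonal_singleton_iff_inner_right).1 h.2

lemma oblique_injective (q : E) {e u : E} (hu : inner ℝ e u = 1) :
    Function.Injective (oblique q e u) := by
  rintro ⟨h, s⟩ ⟨h', s'⟩ heq
  simp only [oblique] at heq
  have h1 : (h : E) + s • u = h' + s' • u := by
    rw [add_assoc, add_assoc] at heq; exact add_left_cancel heq
  have h2 := congrArg (fun x => inner ℝ e x) h1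
  simp only [inner_add_right, inner_coe_orthogonal, inner_smul_right, hu] at h2
  have h3 : s = s' := by linarith
  subst h3
  simpa using h1

lemma exists_oblique_eq (q : E) {e u : E} (hu : inner ℝ e u = 1) (x : E) :
    ∃ p, oblique q e u p = x := by
  refine ⟨⟨⟨(x - q) - inner ℝ e (x - q) • u, ?_⟩, inner ℝ e (x - q)⟩, ?_⟩
  · rw [Submodule.mem_orthogonal_singleton_iff_inner_right, inner_sub_right, inner_smul_right, hu]
    ring
  · simp only [oblique]; abel

variable [FiniteDimensional ℝ E] [MeasurableSpace E] [BorelSpace E]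

/-- Since `u = e + k` with `k` orthogonal to `e`, the chart is the orthogonal splitting of the space
composed with the shear `(s, h) ↦ (s, s k + h)`. The shear preserves the product measure because it
translates each slice. -/
lemma measurePreserving_oblique (q : E) {e u : E} (he : ‖e‖ = 1) (hu : inner ℝ e u = 1) :
    MeasurePreserving (oblique q e u) (volume.prod volume) volume := by
  have hk : u - e ∈ (ℝ ∙ e)ᗮ := by
    rw [Submodule.mem_orthogonal_singleton_iff_inner_right, inner_sub_right, hu,
      real_inner_self_eq_norm_sq, he]
    norm_num
  set k : (ℝ ∙ e)ᗮ := ⟨u - e, hk⟩ with hkdef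
  have h1 : MeasurePreserving (fun p : ℝ × (ℝ ∙ e)ᗮ => (LinearIsometryEquiv.toSpanUnitSingleton e he p.1,
      p.1 • k + p.2)) (volume.prod volume) (volume.prod volume) := by
    refine MeasurePreserving.skew_product
      (g := fun (s : ℝ) (h : (ℝ ∙ e)ᗮ) => s • k + h)
      (LinearIsometryEquiv.measurePreserving (LinearIsometryEquiv.toSpanUnitSingleton e he)) ?_ ?_
    · have : Continuous (Function.uncurry fun (s : ℝ) (h : (ℝ ∙ e)ᗮ) => s • k + h) := by
        simp only [Function.uncurry_def]; fun_prop
      exact this.measurable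
    · exact Eventually.of_forall fun s => map_add_left_eq_self _ _
  have h2 := ((ℝ ∙ e).measurePreserving_measurableEquivProd q).symm
  rw [InnerProductSpace.euclideanHausdorffMeasure_eq_volume] at h2
  have h3 := h2.comp (h1.comp Measure.measurePreserving_swap)
  have heq : oblique q e u = (⇑((ℝ ∙ e).measurableEquivProd q).symm ∘
      (fun p : ℝ × (ℝ ∙ e)ᗮ => (LinearIsometryEquiv.toSpanUnitSingleton e he p.1,
        p.1 • k + p.2)) ∘ Prod.swap) := by
    funext p
    simp [oblique, hkdef, LinearIsometryEquiv.toSpanUnitSingleton_apply, smul_sub]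
    abel
  rw [heq]
  exact h3

lemma measurableEmbedding_oblique (q : E) {e u : E} (hu : inner ℝ e u = 1) :
    MeasurableEmbedding (oblique q e u) :=
  (continuous_oblique q e u).measurableEmbedding (oblique_injective q hu)

/-- In a cylinder in which the open set `O` lies below a graph, the integral over `O` of the
derivative along the axis of a function supported in the cylinder is the integral of the function
over the graph, with respect to Lebesgue measure of the base. -/
lemma integral_fderiv_eq_integral_graph {O : Set E} (hO : IsOpen O) {q e u : E} (he : ‖e‖ = 1)
    (hu : inner ℝ e u = 1) {r : ℝ} {g : (ℝ ∙ e)ᗮ → ℝ} 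
    (hgr : ∀ h : (ℝ ∙ e)ᗮ, ‖h‖ < r → |g h| < r)
    (hOg : ∀ (h : (ℝ ∙ e)ᗮ) (s : ℝ), ‖h‖ < r → |s| < r →
        (q + h + s • u ∈ O ↔ s < g h) ∧ (q + h + s • u ∈ frontier O ↔ s = g h))
    {f : E → ℝ} (hsupp : ∀ (h : (ℝ ∙ e)ᗮ) (s : ℝ), q + h + s • u ∈ tsupport f → ‖h‖ < r ∧ |s| < r)
    (hfc : ContinuousOn f (closure O)) (hfd : DifferentiableOn ℝ f O)
    (hint : IntegrableOn (fun x => fderiv ℝ f x u) O) :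
    ∫ x in O, fderiv ℝ f x u = ∫ h in {h : (ℝ ∙ e)ᗮ | ‖h‖ < r}, f (q + h + g h • u) := by
  classical
  have hmp := measurePreserving_oblique q he hu
  have hme := measurableEmbedding_oblique q hu
  have hzero : ∀ x, x ∉ tsupport f → f =ᶠ[𝓝 x] 0 := fun x hx =>
    notMem_tsupport_iff_eventuallyEq.1 hx
  have hzero' : ∀ x, x ∉ tsupport f → fderiv ℝ f x u = 0 := fun x hx => by
    rw [(hzero x hx).fderiv_eq]; simp
  set F : E → ℝ := O.indicator fun x => fderiv ℝ f x u with hF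
  have hFint : Integrable F := (integrable_indicator_iff hO.measurableSet).2 hint
  have hFint' : Integrable (F ∘ oblique q e u) (volume.prod volume) :=
    (hmp.integrable_comp_emb hme).2 hFint
  rw [← integral_indicator hO.measurableSet, ← hmp.integral_comp hme,
    ← integral_indicator (measurableSet_lt (by fun_prop) (by fun_prop))]
  change ∫ p, (F ∘ oblique q e u) p ∂(volume.prod volume) = _
  rw [integral_prod _ hFint']
  refine integral_congr_ae ?_
  filter_upwards [hFint'.prod_right_ae] with h hh
  by_cases hr : ‖h‖ < r
  · rw [indicator_of_mem (by exact hr)]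
    have hgh := abs_lt.1 (hgr h hr)
    set D : ℝ → ℝ := fun s => fderiv ℝ f (q + h + s • u) u with hD
    -- On a line parallel to the axis, `O` is the part below the graph as long as `|s| < r`; beyond
    -- that the derivative vanishes with `f`.
    have hslice : (fun s => (F ∘ oblique q e u) (h, s)) = (Ioo (-r) (g h)).indicator D := by
      funext s
      simp only [Function.comp, oblique, hF, hD]
      rw [indicator_apply, indicator_apply]
      simp only [mem_Ioo]
      by_cases hs : |s| < r
      · rw [(hOg h s hr hs).1]
        simp [(abs_lt.1 hs).1]
      · have h0 : fderiv ℝ f (q + h + s • u) u = 0 := hzero' _ fun hx => hs (hsupp h s hx).2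
        simp [h0]
    have hDint : IntegrableOn D (Ioo (-r) (g h)) := by
      rw [← integrable_indicator_iff measurableSet_Ioo, ← hslice]; exact hh
    change ∫ s, (F ∘ oblique q e u) (h, s) = _
    rw [hslice, integral_indicator measurableSet_Ioo, ← integral_Ioc_eq_integral_Ioo,
      ← intervalIntegral.integral_of_le hgh.1.le]
    have hpath : Continuous fun s : ℝ => q + h + s • u := by fun_prop
    have hcl : ∀ s ∈ Ioc (-r) (g h), q + h + s • u ∈ closure O := by
      rintro s ⟨hs1, hs2⟩
      have hs : |s| < r := abs_lt.2 ⟨hs1, hs2.trans_lt hgh.2⟩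
      rcases hs2.lt_or_eq with hlt | heq
      · exact subset_closure (((hOg h s hr hs).1).2 hlt)
      · exact frontier_subset_closure (((hOg h s hr hs).2).2 heq)
    rw [intervalIntegral.integral_eq_sub_of_hasDerivAt_of_le (f := fun s => f (q + h + s • u))
      hgh.1.le]
    · have : q + h + (-r) • u ∉ tsupport f := fun hx => by
        have h1 := (hsupp h _ hx).2
        rw [abs_neg, abs_of_pos ((norm_nonneg _).trans_lt hr)] at h1
        exact lt_irrefl _ h1
      rw [image_eq_zero_of_notMem_tsupport this, sub_zero]
    · intro s hs
      -- The bottom end point need not belong to `closure O`, but it is outside the support of `f`,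
      -- which is therefore continuous there.
      rcases hs.1.eq_or_lt with heq | hlt
      · have : q + h + s • u ∉ tsupport f := fun hx => by
          have h1 := (hsupp h _ hx).2
          rw [← heq, abs_neg, abs_of_pos ((norm_nonneg _).trans_lt hr)] at h1
          exact lt_irrefl _ h1
        have hca : ContinuousAt f (q + h + s • u) :=
          continuousAt_const.congr (hzero _ this).symm
        exact (ContinuousAt.comp (f := fun s : ℝ => q + h + s • u) hca
          hpath.continuousAt).continuousWithinAt
      · have h1 : ContinuousWithinAt (fun s => f (q + h + s • u)) (Ioc (-r) (g h)) s :=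
          (hfc _ (hcl s ⟨hlt, hs.2⟩)).comp (f := fun s : ℝ => q + h + s • u) hpath.continuousWithinAt hcl
        refine h1.mono_of_mem_nhdsWithin ?_
        filter_upwards [self_mem_nhdsWithin, mem_nhdsWithin_of_mem_nhds (Ioi_mem_nhds hlt)]
          with τ hτ hτ'
        exact ⟨hτ', hτ.2⟩
    · intro s hs
      have hxO : q + h + s • u ∈ O :=
        ((hOg h s hr (abs_lt.2 ⟨hs.1, hs.2.trans hgh.2⟩)).1).2 hs.2
      have hd : HasFDerivAt f (fderiv ℝ f (q + h + s • u)) (q + h + s • u) :=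
        (hfd.differentiableAt (hO.mem_nhds hxO)).hasFDerivAt
      have hp : HasDerivAt (fun s : ℝ => q + h + s • u) u s := by
        simpa using ((hasDerivAt_id s).smul_const u).const_add (q + (h : E))
      exact hd.comp_hasDerivAt s hp
    · rw [intervalIntegrable_iff_integrableOn_Ioo_of_le hgh.1.le]
      exact hDint
  · rw [indicator_of_notMem (by exact hr)]
    have : ∀ s, (F ∘ oblique q e u) (h, s) = 0 := by
      intro s
      simp only [Function.comp, hF, oblique]
      rw [indicator_apply, hzero' _ fun hx => hr (hsupp h s hx).1]
      simp
    change ∫ s, (F ∘ oblique q e u) (h, s) = _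
    simp only [this, integral_zero]

end Graph

/-! ### Surface measure on nearly flat graphs -/

section Comparison

open scoped NNReal ENNReal

/-- For nonnegative functions this is monotonicity of the integral in the measure, used in both
directions. The positive and negative parts of `f` are treated separately and the two errors add up
to the integral of `|f|`. -/
lemma abs_integral_sub_integral_le {α : Type*} [MeasurableSpace α] {μ ν : Measure α} {c : ℝ≥0}
    (hμν : μ ≤ c • ν) (hνμ : ν ≤ c • μ) {f : α → ℝ} (hf : Integrable f μ) :
    |∫ x, f x ∂ν - ∫ x, f x ∂μ| ≤ (c - 1) * ∫ x, |f x| ∂μ := by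
  have key : ∀ g : α → ℝ, Integrable g μ → (∀ x, 0 ≤ g x) →
      |∫ x, g x ∂ν - ∫ x, g x ∂μ| ≤ (c - 1) * ∫ x, g x ∂μ := by
    intro g hg hg0
    have hgν : Integrable g ν := (hg.smul_measure_nnreal (c := c)).mono_measure hνμ
    have h1 : ∫ x, g x ∂ν ≤ c * ∫ x, g x ∂μ := by
      have := integral_mono_measure hνμ (Eventually.of_forall hg0) hg.smul_measure_nnreal
      rwa [integral_smul_nnreal_measure] at this
    have h2 : ∫ x, g x ∂μ ≤ c * ∫ x, g x ∂ν := by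
      have := integral_mono_measure hμν (Eventually.of_forall hg0) hgν.smul_measure_nnreal
      rwa [integral_smul_nnreal_measure] at this
    have h3 : 0 ≤ ∫ x, g x ∂ν := integral_nonneg hg0
    have h4 : 0 ≤ ∫ x, g x ∂μ := integral_nonneg hg0
    have h5 : (0 : ℝ) ≤ c := c.2
    rw [abs_le]
    refine ⟨?_, by linarith⟩
    rcases le_total (c : ℝ) 1 with hc | hc
    · nlinarith
    · nlinarith [mul_nonneg (sub_nonneg.2 hc) h3, mul_nonneg (sub_nonneg.2 hc) h4]
  have hfν : Integrable f ν := (hf.smul_measure_nnreal (c := c)).mono_measure hνμ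
  have hp := key (fun x => max (f x) 0) hf.pos_part fun x => le_max_right _ _
  have hn := key (fun x => max (-f x) 0) hf.neg_part fun x => le_max_right _ _
  have hsplit : ∀ x, f x = max (f x) 0 - max (-f x) 0 := fun x => by
    rcases le_total (f x) 0 with h | h <;> simp [h]
  have habs : ∀ x, |f x| = max (f x) 0 + max (-f x) 0 := fun x => by
    rcases le_total (f x) 0 with h | h <;> simp [h, abs_of_nonneg, abs_of_nonpos]
  have e1 : ∫ x, f x ∂ν = ∫ x, max (f x) 0 ∂ν - ∫ x, max (-f x) 0 ∂ν := by
    rw [← integral_sub hfν.pos_part hfν.neg_part]; exact integral_congr_ae (.of_forall hsplit)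
  have e2 : ∫ x, f x ∂μ = ∫ x, max (f x) 0 ∂μ - ∫ x, max (-f x) 0 ∂μ := by
    rw [← integral_sub hf.pos_part hf.neg_part]; exact integral_congr_ae (.of_forall hsplit)
  have e3 : ∫ x, |f x| ∂μ = ∫ x, max (f x) 0 ∂μ + ∫ x, max (-f x) 0 ∂μ := by
    rw [← integral_add hf.pos_part hf.neg_part]; exact integral_congr_ae (.of_forall habs)
  rw [e1, e2, e3]
  rw [abs_le] at *
  constructor <;> linarith [hp.1, hp.2, hn.1, hn.2]

open Measure

lemma _root_.LipschitzWith.euclideanHausdorffMeasure_image_le {X Y : Type*} [MetricSpace X]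
    [MeasurableSpace X] [BorelSpace X] [MetricSpace Y] [MeasurableSpace Y] [BorelSpace Y]
    {K : ℝ≥0} {f : X → Y} (hf : LipschitzWith K f) (d : ℕ) (s : Set X) :
    μHE[d] (f '' s) ≤ (K : ℝ≥0∞) ^ d * μHE[d] s := by
  have := hf.hausdorffMeasure_image_le (d := (d : ℝ)) (by positivity) s
  rw [ENNReal.rpow_natCast] at this
  simp only [euclideanHausdorffMeasure_def, Measure.smul_apply, ENNReal.smul_def, smul_eq_mul]
  exact (mul_le_mul_right this _).trans_eq (by ring)

lemma _root_.AntilipschitzWith.le_euclideanHausdorffMeasure_image {X Y : Type*} [MetricSpace X]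
    [MeasurableSpace X] [BorelSpace X] [MetricSpace Y] [MeasurableSpace Y] [BorelSpace Y]
    {K : ℝ≥0} {f : X → Y} (hf : AntilipschitzWith K f) (d : ℕ) (s : Set X) :
    μHE[d] s ≤ (K : ℝ≥0∞) ^ d * μHE[d] (f '' s) := by
  have := hf.le_hausdorffMeasure_image (d := (d : ℝ)) (by positivity) s
  rw [ENNReal.rpow_natCast] at this
  simp only [euclideanHausdorffMeasure_def, Measure.smul_apply, ENNReal.smul_def, smul_eq_mul]
  exact (mul_le_mul_right this _).trans_eq (by ring)

/-- With slope `κ` and axis of length `b`, the graph map has Lipschitz constant `1 + κ b` and its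
inverse `(1 - κ b)⁻¹`. Their `d`-th powers bound the distortion of `d`-dimensional measure and tend
to `1` as `κ → 0`. -/
lemma exists_bilipschitz_const (b : ℝ) (d : ℕ) {δ : ℝ} (hδ : 0 < δ) :
    ∃ κ : ℝ, 0 < κ ∧ κ < 1 ∧ κ * b < 1 ∧ (1 + κ * b) ^ d ≤ 1 + δ ∧
      ((1 - κ * b)⁻¹) ^ d ≤ 1 + δ := by
  have h1 : ∀ᶠ κ : ℝ in 𝓝 0, κ < 1 := eventually_lt_nhds one_pos
  have h2 : ∀ᶠ κ : ℝ in 𝓝 0, κ * b < 1 := by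
    have : ContinuousAt (fun κ : ℝ => κ * b) 0 := by fun_prop
    exact this.eventually_lt_const (by simp)
  have h3 : ∀ᶠ κ : ℝ in 𝓝 0, (1 + κ * b) ^ d < 1 + δ := by
    have : ContinuousAt (fun κ : ℝ => (1 + κ * b) ^ d) 0 := by fun_prop
    exact this.eventually_lt_const (by simpa)
  have h4 : ∀ᶠ κ : ℝ in 𝓝 0, ((1 - κ * b)⁻¹) ^ d < 1 + δ := by
    have : ContinuousAt (fun κ : ℝ => ((1 - κ * b)⁻¹) ^ d) 0 := by
      refine ContinuousAt.pow (ContinuousAt.inv₀ (by fun_prop) (by simp)) d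
    exact this.eventually_lt_const (by simpa)
  have h5 := ((h1.and (h2.and (h3.and h4))).filter_mono (nhdsWithin_le_nhds (s := Ioi 0))).and
    self_mem_nhdsWithin
  obtain ⟨κ, ⟨hk1, hk2, hk3, hk4⟩, hk⟩ := h5.exists
  exact ⟨κ, hk, hk1, hk2, hk3.le, hk4.le⟩

variable {E : Type*} [NormedAddCommGroup E] [InnerProductSpace ℝ E] [FiniteDimensional ℝ E]

lemma finrank_orthogonal_singleton {e : E} (he : ‖e‖ = 1) :
    Module.finrank ℝ (ℝ ∙ e)ᗮ = Module.finrank ℝ E - 1 := by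
  have h1 := (ℝ ∙ e).finrank_add_finrank_orthogonal
  rw [finrank_span_singleton (fun h => by simp [h] at he)] at h1
  omega

variable [MeasurableSpace E] [BorelSpace E]

/-- Near a boundary point at which the boundary has normal `e`, the flux of a field in the
direction `u`, normalized by `⟪e, u⟫ = 1`, is nearly the integral over the boundary. -/
lemma exists_nhds_flux_estimate {O : Set E} (hOo : IsOpen O) {ρ : E → ℝ} {q e u : E} {c : ℝ}
    (hρ : ContDiffAt ℝ 1 ρ q) (hO : ∀ᶠ x in 𝓝 q, x ∈ O ↔ ρ x < 0) (hq : ρ q = 0)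
    (hc : 0 < c) (hgrad : gradient ρ q = c • e) (he : ‖e‖ = 1) (hu : inner ℝ e u = 1)
    {δ : ℝ} (hδ : 0 < δ) :
    ∃ N : Set E, IsOpen N ∧ q ∈ N ∧ μHE[Module.finrank ℝ E - 1] (frontier O ∩ N) < ∞ ∧
      ∀ f : E → ℝ, HasCompactSupport f → tsupport f ⊆ N → ContinuousOn f (closure O) →
        DifferentiableOn ℝ f O → IntegrableOn (fun x => fderiv ℝ f x u) O →
        |(∫ x in O, fderiv ℝ f x u) - ∫ x in frontier O, f x ∂μHE[Module.finrank ℝ E - 1]| ≤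
          δ * ∫ x in frontier O, |f x| ∂μHE[Module.finrank ℝ E - 1] := by
  set d := Module.finrank ℝ E - 1 with hd
  obtain ⟨κ, hκ, hκ1, hκu, hK1, hK2⟩ := exists_bilipschitz_const ‖u‖ d hδ
  obtain ⟨r, hr, g, hg, -, hgr, hOg⟩ := exists_lipschitz_graph hρ hO hq hc hgrad hu hκ hκ1 one_pos
  set G : (ℝ ∙ e)ᗮ → E := fun h => q + h + g h • u with hG
  set B : Set (ℝ ∙ e)ᗮ := {h | ‖h‖ < r} with hB
  -- The open cylinder written without coordinates: `⟪e, x - q⟫` is the height along `u`, and what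
  -- remains is the base point.
  set C : Set E := {x | ‖(x - q) - inner ℝ e (x - q) • u‖ < r ∧ |inner ℝ e (x - q)| < r} with hC
  have hCo : IsOpen C := by
    refine IsOpen.and (isOpen_lt (by fun_prop) (by fun_prop)) (isOpen_lt (by fun_prop) (by fun_prop))
  have hCmem : ∀ (h : (ℝ ∙ e)ᗮ) (s : ℝ), q + h + s • u ∈ C ↔ ‖h‖ < r ∧ |s| < r := by
    intro h s
    have e1 : q + h + s • u - q = h + s • u := by abel
    have e2 : inner ℝ e (h + s • u) = s := by
      rw [inner_add_right, inner_coe_orthogonal, inner_smul_right, hu]; ring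
    simp only [hC, mem_ofPred_eq, e1, e2, add_sub_cancel_right, Submodule.coe_norm]
  have hdiff : ∀ h h', G h - G h' = ((h : E) - h') + (g h - g h') • u := by
    intro h h'; simp only [hG, sub_smul]; abel
  have hgd : ∀ h h', |g h - g h'| ≤ κ * ‖(h : E) - h'‖ := by
    intro h h'
    have := hg.dist_le_mul h h'
    rwa [Real.coe_toNNReal _ hκ.le, Real.dist_eq, dist_eq_norm] at this
  have hκu0 : 0 ≤ κ * ‖u‖ := by positivity
  have hsm : ∀ h h', ‖(g h - g h') • u‖ ≤ κ * ‖u‖ * ‖(h : E) - h'‖ := by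
    intro h h'
    rw [norm_smul, Real.norm_eq_abs]
    calc _ ≤ κ * ‖(h : E) - h'‖ * ‖u‖ := by gcongr; exact hgd h h'
      _ = _ := by ring
  set K₁ : ℝ≥0 := ⟨1 + κ * ‖u‖, by positivity⟩ with hK₁
  set K₂ : ℝ≥0 := ⟨(1 - κ * ‖u‖)⁻¹, inv_nonneg.2 (by linarith)⟩ with hK₂
  have hGL : LipschitzWith K₁ G := by
    refine LipschitzWith.of_dist_le_mul fun h h' => ?_
    rw [dist_eq_norm, hdiff, dist_eq_norm]
    change _ ≤ (1 + κ * ‖u‖) * ‖(h : E) - h'‖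
    linarith [norm_add_le ((h : E) - h') ((g h - g h') • u), hsm h h']
  have hGA : AntilipschitzWith K₂ G := by
    refine AntilipschitzWith.of_le_mul_dist fun h h' => ?_
    rw [dist_eq_norm, dist_eq_norm, hdiff]
    change ‖(h : E) - h'‖ ≤ (1 - κ * ‖u‖)⁻¹ * _
    rw [inv_mul_eq_div, le_div_iff₀ (by linarith)]
    have := norm_sub_le (((h : E) - h') + (g h - g h') • u) ((g h - g h') • u)
    rw [add_sub_cancel_right] at this
    linarith [hsm h h']
  set cδ : ℝ≥0 := ⟨1 + δ, by linarith⟩ with hcδ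
  have hK1' : (K₁ : ℝ≥0∞) ^ d ≤ cδ := by
    rw [← ENNReal.coe_pow, ENNReal.coe_le_coe]; exact_mod_cast hK1
  have hK2' : (K₂ : ℝ≥0∞) ^ d ≤ cδ := by
    rw [← ENNReal.coe_pow, ENNReal.coe_le_coe]; exact_mod_cast hK2
  have hBm : MeasurableSet B := measurableSet_lt (by fun_prop) (by fun_prop)
  have hGm : Measurable G := hGL.continuous.measurable
  -- The base hyperplane has dimension `d`, so its Lebesgue measure is `μHE[d]`. This is where the
  -- normalization of surface measure enters.
  have hvol : (volume : Measure (ℝ ∙ e)ᗮ) = μHE[d] := by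
    rw [hd, ← finrank_orthogonal_singleton he, InnerProductSpace.euclideanHausdorffMeasure_eq_volume]
  have hset : ∀ A : Set E, A ∩ (frontier O ∩ C) = G '' (G ⁻¹' A ∩ B) := by
    intro A
    ext x
    constructor
    · rintro ⟨hxA, hxf, hxC⟩
      obtain ⟨⟨h, s⟩, rfl⟩ := exists_oblique_eq q hu x
      have hm := (hCmem h s).1 hxC
      have hs : s = g h := ((hOg h s hm.1 hm.2).2).1 hxf
      refine ⟨h, ⟨?_, hm.1⟩, ?_⟩
      · change G h ∈ A
        simp only [hG, ← hs]; exact hxA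
      · simp only [hG, ← hs]; rfl
    · rintro ⟨h, ⟨hA, hh⟩, rfl⟩
      exact ⟨hA, ((hOg h (g h) hh (hgr h hh)).2).2 rfl, (hCmem h (g h)).2 ⟨hh, hgr h hh⟩⟩
  -- `ν` is base measure carried to the graph, `μ` is surface measure on the same piece. The
  -- bilipschitz bounds for `G` make each at most `1 + δ` times the other.
  set ν : Measure E := (volume.restrict B).map G with hν
  set μ : Measure E := μHE[d].restrict (frontier O ∩ C) with hμ
  have hfrm : MeasurableSet (frontier O) := isClosed_frontier.measurableSet
  have hμν : μ ≤ cδ • ν := by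
    refine Measure.le_iff.2 fun A hA => ?_
    rw [hμ, Measure.restrict_apply hA, hset, Measure.smul_apply, hν, Measure.map_apply hGm hA,
      Measure.restrict_apply (hGm hA), hvol, ENNReal.smul_def, smul_eq_mul]
    refine (hGL.euclideanHausdorffMeasure_image_le d _).trans ?_
    gcongr
  have hνμ : ν ≤ cδ • μ := by
    refine Measure.le_iff.2 fun A hA => ?_
    rw [Measure.smul_apply, hμ, Measure.restrict_apply hA, hset, hν, Measure.map_apply hGm hA,
      Measure.restrict_apply (hGm hA), hvol, ENNReal.smul_def, smul_eq_mul]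
    refine (hGA.le_euclideanHausdorffMeasure_image d _).trans ?_
    gcongr
  have hfin : μHE[d] (frontier O ∩ C) < ∞ := by
    have h1 := hμν univ
    rw [hμ, Measure.restrict_apply_univ, Measure.smul_apply, hν,
      Measure.map_apply hGm MeasurableSet.univ, preimage_univ, Measure.restrict_apply_univ,
      ENNReal.smul_def, smul_eq_mul] at h1
    refine h1.trans_lt (ENNReal.mul_lt_top ENNReal.coe_lt_top ?_)
    have : B = Metric.ball 0 r := by ext; simp [hB]
    rw [this]; exact measure_ball_lt_top
  refine ⟨C, hCo, ?_, hfin, ?_⟩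
  · simp [hC, hr]
  intro f hfs hfC hfc hfd hfint
  have hfl := integral_fderiv_eq_integral_graph hOo he hu hgr hOg
    (fun h s hx => (hCmem h s).1 (hfC hx)) hfc hfd hfint
  have hres : ∀ F : E → ℝ, (∀ x, x ∉ C → F x = 0) →
      ∫ x in frontier O, F x ∂μHE[d] = ∫ x, F x ∂μ := by
    intro F hF
    rw [hμ]
    refine setIntegral_eq_of_subset_of_forall_sdiff_eq_zero (s := frontier O ∩ C) (t := frontier O)
      hfrm inter_subset_left ?_
    intro x hx
    exact hF x fun hxC => hx.2 ⟨hx.1, hxC⟩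
  have hf0 : ∀ x, x ∉ C → f x = 0 := fun x hx => image_eq_zero_of_notMem_tsupport fun h => hx (hfC h)
  have hfr : ContinuousOn f (frontier O) := hfc.mono frontier_subset_closure
  have : IsFiniteMeasure μ := ⟨by rw [hμ, Measure.restrict_apply_univ]; exact hfin⟩
  have hfi : Integrable f μ := by
    have hmeas : AEStronglyMeasurable f μ :=
      (hfr.mono inter_subset_left).aestronglyMeasurable (hfrm.inter hCo.measurableSet)
    obtain ⟨b, hb⟩ := (hfs.isCompact.inter_left (isClosed_frontier (s := O))).exists_bound_of_continuousOn
      (hfr.mono inter_subset_left)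
    refine Integrable.of_bound hmeas (max b 0) ?_
    rw [hμ]
    refine (ae_restrict_iff' (hfrm.inter hCo.measurableSet)).2 (.of_forall fun x hx => ?_)
    by_cases hxs : x ∈ tsupport f
    · exact (hb x ⟨hx.1, hxs⟩).trans (le_max_left _ _)
    · rw [image_eq_zero_of_notMem_tsupport hxs, norm_zero]; exact le_max_right _ _
  have hfν : Integrable f ν := (hfi.smul_measure_nnreal (c := cδ)).mono_measure hνμ
  have e1 : ∫ x in O, fderiv ℝ f x u = ∫ x, f x ∂ν := by
    rw [hfl, hν, integral_map hGm.aemeasurable hfν.aestronglyMeasurable]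
  rw [e1, hres f hf0, hres (fun x => |f x|) fun x hx => by simp [hf0 x hx]]
  have := abs_integral_sub_integral_le hμν hνμ hfi
  have h1 : (cδ : ℝ) - 1 = δ := by
    change (1 + δ) - 1 = δ
    ring
  rwa [h1] at this

end Comparison

/-! ### Uniqueness and continuity of the normal, unique derivatives up to the boundary -/

section Normal

variable {n : ℕ} {O : Set (EuclideanSpace ℝ (Fin n))} {x ν ν' : EuclideanSpace ℝ (Fin n)}

lemma eq_zero_of_mem_frontier {X : Type*} [TopologicalSpace X] {O : Set X} {x : X} (hO : IsOpen O)
    (hx : x ∈ frontier O) {ρ : X → ℝ}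
    (hc : ContinuousAt ρ x) (hρ : ∀ᶠ x' in 𝓝 x, x' ∈ O ↔ ρ x' < 0) : ρ x = 0 := by
  have h1 : ¬ ρ x < 0 := fun h => by
    rw [← hρ.self_of_nhds] at h
    exact hx.2 (hO.interior_eq.symm ▸ h)
  have h2 : ¬ 0 < ρ x := fun h => by
    obtain ⟨y, hy, hyO⟩ := mem_closure_iff_nhds.1 hx.1 _ ((hc.eventually_const_lt h).and hρ)
    exact lt_asymm hy.1 (hy.2.1 hyO)
  exact le_antisymm (not_lt.1 h2) (not_lt.1 h1)

lemma fderiv_apply_of_gradient {E : Type*} [NormedAddCommGroup E] [InnerProductSpace ℝ E]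
    [CompleteSpace E] {ρ : E → ℝ} {x g : E} (h : gradient ρ x = g) (v : E) :
    fderiv ℝ ρ x v = inner ℝ g v := by
  have : fderiv ℝ ρ x = (InnerProductSpace.toDual ℝ E) (gradient ρ x) := by simp [gradient]
  rw [this, h]; simp

/-- Moving from a zero of `ρ` in a direction of decrease leads to negative values. -/
lemma eventually_neg_of_inner_neg {E : Type*} [NormedAddCommGroup E] [InnerProductSpace ℝ E]
    [CompleteSpace E] {ρ : E → ℝ} {x g v : E} (hd : DifferentiableAt ℝ ρ x)
    (h : gradient ρ x = g) (h0 : ρ x = 0) (hv : inner ℝ g v < 0) :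
    ∀ᶠ s : ℝ in 𝓝[>] 0, ρ (x + s • v) < 0 := by
  have hp : HasDerivAt (fun s : ℝ => x + s • v) v 0 := by
    simpa using ((hasDerivAt_id (0 : ℝ)).smul_const v).const_add x
  have hd' : HasFDerivAt ρ (fderiv ℝ ρ x) (x + (0 : ℝ) • v) := by simpa using hd.hasFDerivAt
  have hc := hd'.comp_hasDerivAt (0 : ℝ) hp
  rw [fderiv_apply_of_gradient h] at hc
  have := hc.tendsto_slope_zero_right
  filter_upwards [this.eventually_lt_const hv, self_mem_nhdsWithin] with s hs hs'
  have hs'' : (0 : ℝ) < s := hs'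
  simp only [Function.comp, zero_add, zero_smul, add_zero, h0, sub_zero, smul_eq_mul] at hs
  by_contra hcon
  exact absurd hs (not_lt.2 (mul_nonneg (inv_nonneg.2 hs''.le) (not_lt.1 hcon)))

/-- A short move along `v` enters `O` according to the first defining function, so the second one
cannot increase along `v`. -/
lemma IsOutwardNormal.inner_nonpos (hO : IsOpen O) (hx : x ∈ frontier O)
    (hν : IsOutwardNormal O x ν) (hν' : IsOutwardNormal O x ν') {v : EuclideanSpace ℝ (Fin n)}
    (hv : inner ℝ ν v < 0) : inner ℝ ν' v ≤ 0 := by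
  obtain ⟨-, ρ, hρ, hOρ, c, hc, hg⟩ := hν
  obtain ⟨-, ρ', hρ', hOρ', c', hc', hg'⟩ := hν'
  have h0 := eq_zero_of_mem_frontier hO hx hρ.continuousAt hOρ
  have h0' := eq_zero_of_mem_frontier hO hx hρ'.continuousAt hOρ'
  by_contra hcon
  push Not at hcon
  have ht : Tendsto (fun s : ℝ => x + s • v) (𝓝[>] 0) (𝓝 x) := by
    have : Continuous fun s : ℝ => x + s • v := by fun_prop
    simpa using (this.tendsto 0).mono_left nhdsWithin_le_nhds
  have h1 := eventually_neg_of_inner_neg (v := v) (hρ.differentiableAt one_ne_zero) hg h0 (by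
    rw [real_inner_smul_left]; exact mul_neg_of_pos_of_neg hc hv)
  have hg'' : gradient (fun x => -ρ' x) x = -(c' • ν') := by
    rw [← hg']; simp [gradient]
  have h2 := eventually_neg_of_inner_neg (v := v)
    (hρ'.differentiableAt one_ne_zero).neg hg'' (by simp [h0']) (by
      rw [inner_neg_left, real_inner_smul_left]
      exact neg_neg_of_pos (mul_pos hc' hcon))
  obtain ⟨s, hs1, hs2, hs3, hs4⟩ :=
    (h1.and (h2.and ((ht.eventually hOρ).and (ht.eventually hOρ')))).exists
  have h3 := hs4.1 (hs3.2 hs1)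
  have h4 : -ρ' (x + s • v) < 0 := hs2
  linarith

lemma IsOutwardNormal.unique (hO : IsOpen O) (hx : x ∈ frontier O)
    (hν : IsOutwardNormal O x ν) (hν' : IsOutwardNormal O x ν') : ν = ν' := by
  by_contra hne
  have h1 : ‖ν‖ = 1 := hν.1
  have h2 : ‖ν'‖ = 1 := hν'.1
  have hlt : inner ℝ ν ν' < (1 : ℝ) := by
    rw [inner_lt_one_iff_real_of_norm_eq_one h1 h2]; exact hne
  -- For distinct unit vectors, `ν' - ν` makes an obtuse angle with `ν` and an acute one with `ν'`.
  have h3 := hν.inner_nonpos hO hx hν' (v := ν' - ν) (by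
    rw [inner_sub_right, real_inner_self_eq_norm_sq, h1]; linarith)
  rw [inner_sub_right, real_inner_self_eq_norm_sq, h2, real_inner_comm] at h3
  linarith

lemma outwardNormal_spec (h : ∃ ν, IsOutwardNormal O x ν) :
    IsOutwardNormal O x (outwardNormal O x) := by
  rw [outwardNormal, dif_pos h]; exact h.choose_spec

lemma IsOutwardNormal.outwardNormal_eq (hO : IsOpen O) (hx : x ∈ frontier O)
    (hν : IsOutwardNormal O x ν) : outwardNormal O x = ν :=
  (outwardNormal_spec ⟨ν, hν⟩).unique hO hx hν

/-- One defining function serves all boundary points near `x`. By uniqueness the chosen normal there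
is its normalized gradient, which is continuous. -/
lemma continuousOn_outwardNormal (hO : IsOpen O) (hb : ∀ x ∈ frontier O, ∃ ν, IsOutwardNormal O x ν) :
    ContinuousOn (outwardNormal O) (frontier O) := by
  intro x hx
  obtain ⟨ν, hν⟩ := hb x hx
  obtain ⟨h1, ρ, hρ, hOρ, c, hc, hg⟩ := hν
  have hgc : ContinuousAt (gradient ρ) x := by
    have : ContinuousAt (fderiv ℝ ρ) x :=
      (hρ.fderiv_right (m := 0) (by norm_num)).continuousAt
    exact (InnerProductSpace.toDual ℝ _).symm.continuous.continuousAt.comp this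
  have hne : gradient ρ x ≠ 0 := by
    rw [hg]; refine smul_ne_zero hc.ne' fun h => ?_
    simp [h] at h1
  have hev : ∀ᶠ x' in 𝓝[frontier O] x,
      outwardNormal O x' = ‖gradient ρ x'‖⁻¹ • gradient ρ x' := by
    filter_upwards [self_mem_nhdsWithin,
      mem_nhdsWithin_of_mem_nhds (hgc.eventually_ne hne),
      mem_nhdsWithin_of_mem_nhds (hρ.eventually (by simp)),
      mem_nhdsWithin_of_mem_nhds hOρ.eventually_nhds] with x' h2 h3 h4 h5
    refine IsOutwardNormal.outwardNormal_eq hO h2 ⟨?_, ρ, h4, h5, ‖gradient ρ x'‖,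
      norm_pos_iff.2 h3, ?_⟩
    · rw [norm_smul, norm_inv, norm_norm, inv_mul_cancel₀ (norm_ne_zero_iff.2 h3)]
    · rw [smul_smul, mul_inv_cancel₀ (norm_ne_zero_iff.2 h3), one_smul]
  have hc' : ContinuousWithinAt (fun x' => ‖gradient ρ x'‖⁻¹ • gradient ρ x') (frontier O) x :=
    ((hgc.norm.inv₀ (norm_ne_zero_iff.2 hne)).smul hgc).continuousWithinAt
  exact hc'.congr_of_eventuallyEq hev (hev.self_of_nhdsWithin hx)

/-- A set containing a truncated open cone with vertex `x` has unique derivatives at `x`. -/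
lemma uniqueDiffWithinAt_of_cone {E : Type*} [NormedAddCommGroup E] [InnerProductSpace ℝ E]
    {s : Set E} {x e : E} {R : ℝ} (he : ‖e‖ = 1) (hR : 0 < R)
    (hs : ∀ x' ∈ Metric.ball x R, 1 * ‖(x - x') - inner ℝ e (x - x') • e‖ < inner ℝ e (x - x') →
      x' ∈ s) : UniqueDiffWithinAt ℝ s x := by
  set S : Set E := Metric.ball x R ∩
    {x' | ‖(x - x') - inner ℝ e (x - x') • e‖ - inner ℝ e (x - x') < 0} with hS
  have hSo : IsOpen S := Metric.isOpen_ball.inter (isOpen_lt (by fun_prop) (by fun_prop))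
  -- The cone is a sublevel set of a norm minus a linear form, hence convex. Convex sets with
  -- interior points have unique derivatives at points of their closure.
  have hconv : Convex ℝ S := by
    refine (convex_ball x R).inter fun y hy z hz a b ha hb hab => ?_
    simp only [mem_ofPred_eq] at hy hz ⊢
    have e1 : x - (a • y + b • z) = a • (x - y) + b • (x - z) := by
      have : x = a • x + b • x := by rw [← add_smul, hab, one_smul]
      nth_rewrite 1 [this]
      simp only [smul_sub]; abel
    have e2 : inner ℝ e (x - (a • y + b • z)) = a * inner ℝ e (x - y) + b * inner ℝ e (x - z) := by
      rw [e1, inner_add_right, inner_smul_right, inner_smul_right]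
    have e3 : (x - (a • y + b • z)) - inner ℝ e (x - (a • y + b • z)) • e =
        a • ((x - y) - inner ℝ e (x - y) • e) + b • ((x - z) - inner ℝ e (x - z) • e) := by
      rw [e2, e1]; simp only [smul_sub, add_smul, mul_smul]; abel
    rw [e3, e2]
    have h1 := norm_add_le (a • ((x - y) - inner ℝ e (x - y) • e))
      (b • ((x - z) - inner ℝ e (x - z) • e))
    rw [norm_smul, norm_smul, Real.norm_of_nonneg ha, Real.norm_of_nonneg hb] at h1
    rcases ha.eq_or_lt with rfl | ha'
    · have : b = 1 := by linarith
      subst this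
      linarith
    · nlinarith [mul_nonneg hb (sub_nonneg.2 hz.le)]
  have hmem : ∀ᶠ τ : ℝ in 𝓝[>] 0, x - τ • e ∈ S := by
    have : ∀ᶠ τ : ℝ in 𝓝[>] 0, τ < R := (eventually_lt_nhds hR).filter_mono nhdsWithin_le_nhds
    filter_upwards [this, self_mem_nhdsWithin] with τ hτ hτ'
    have hτ0 : (0 : ℝ) < τ := hτ'
    refine ⟨?_, ?_⟩
    · rw [Metric.mem_ball, dist_eq_norm]
      simpa [norm_smul, he, abs_of_pos hτ0] using hτ
    · simp [inner_smul_right, he, hτ0]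
  have hcl : x ∈ closure S := by
    have ht : Tendsto (fun τ : ℝ => x - τ • e) (𝓝[>] 0) (𝓝 x) := by
      have : Continuous fun τ : ℝ => x - τ • e := by fun_prop
      simpa using (this.tendsto 0).mono_left nhdsWithin_le_nhds
    exact mem_closure_of_tendsto ht hmem
  have hne : (interior S).Nonempty := by
    rw [hSo.interior_eq]
    obtain ⟨τ, hτ⟩ := hmem.exists
    exact ⟨_, hτ⟩
  refine (uniqueDiffWithinAt_convex hconv hne hcl).mono fun x' hx' => hs x' hx'.1 ?_
  have := hx'.2
  simp only [mem_ofPred_eq] at this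
  linarith

lemma IsOutwardNormal.uniqueDiffWithinAt (hO : IsOpen O) (hx : x ∈ frontier O)
    (hν : IsOutwardNormal O x ν) : UniqueDiffWithinAt ℝ O x := by
  obtain ⟨h1, ρ, hρ, hOρ, c, hc, hg⟩ := hν
  have h0 := eq_zero_of_mem_frontier hO hx hρ.continuousAt hOρ
  obtain ⟨R, hR, -, hcone⟩ := exists_ball_lt_of_cone ν hρ hc hg one_pos
  obtain ⟨R', hR', hO'⟩ := Metric.eventually_nhds_iff_ball.1 hOρ
  refine uniqueDiffWithinAt_of_cone h1 (lt_min hR hR') fun x' hx' hlt => ?_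
  rw [hO' x' (Metric.ball_subset_ball (min_le_right _ _) hx'), ← h0]
  exact hcone x (Metric.mem_ball_self hR) x' (Metric.ball_subset_ball (min_le_left _ _) hx') hlt

lemma uniqueDiffOn_closure (hO : IsOpen O) (hb : ∀ x ∈ frontier O, ∃ ν, IsOutwardNormal O x ν) :
    UniqueDiffOn ℝ (closure O) := by
  intro x hx
  by_cases hxO : x ∈ O
  · exact (hO.uniqueDiffWithinAt hxO).mono subset_closure
  · obtain ⟨ν, hν⟩ := hb x ⟨hx, fun h => hxO (interior_subset h)⟩
    exact (hν.uniqueDiffWithinAt hO ⟨hx, fun h => hxO (interior_subset h)⟩).mono subset_closure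

end Normal

/-! ### Local form of the divergence theorem with small relative error -/

section Divergence

open scoped ENNReal

variable {n : ℕ} {O K : Set (EuclideanSpace ℝ (Fin n))}

/-- The divergence of a vector field. -/
def divergence (V : EuclideanSpace ℝ (Fin n) → EuclideanSpace ℝ (Fin n))
    (x : EuclideanSpace ℝ (Fin n)) : ℝ :=
  ∑ α, fderiv ℝ V x (EuclideanSpace.single α 1) α

lemma fderiv_eq_zero_of_eqOn_compl {E F : Type*} [NormedAddCommGroup E] [NormedSpace ℝ E]
    [NormedAddCommGroup F] [NormedSpace ℝ F] {f : E → F} {K : Set E} (hK : IsClosed K)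
    (hf : ∀ x, x ∉ K → f x = 0) {x : E} (hx : x ∉ K) : fderiv ℝ f x = 0 := by
  have : f =ᶠ[𝓝 x] fun _ => 0 := by
    filter_upwards [hK.isOpen_compl.mem_nhds hx] with y hy using hf y hy
  rw [this.fderiv_eq]; simp

/-- Inside `O` the derivative agrees with the one within `closure O`, which is continuous up to the
boundary and so integrable on the compact set `closure O ∩ K`. -/
lemma integrableOn_fderiv {E F : Type*} [NormedAddCommGroup E] [NormedSpace ℝ E]
    [FiniteDimensional ℝ E] [MeasurableSpace E] [BorelSpace E] {μ : Measure E}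
    [IsFiniteMeasureOnCompacts μ]
    [NormedAddCommGroup F] [NormedSpace ℝ F] {O K : Set E} (hO : IsOpen O)
    (hu : UniqueDiffOn ℝ (closure O)) (hK : IsCompact K) {f : E → F}
    (hf0 : ∀ x, x ∉ K → f x = 0) (hf : ContDiffOn ℝ 1 f (closure O)) :
    IntegrableOn (fderiv ℝ f) O μ := by
  have h1 : ContinuousOn (fderivWithin ℝ f (closure O)) (closure O) :=
    hf.continuousOn_fderivWithin hu le_rfl
  have h2 : IntegrableOn (fderivWithin ℝ f (closure O)) (closure O ∩ K) μ :=
    (h1.mono inter_subset_left).integrableOn_compact (hK.inter_left isClosed_closure)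
  have h3 : IntegrableOn (fderiv ℝ f) (O ∩ K) μ := by
    refine (h2.mono_set (inter_subset_inter_left K subset_closure)).congr_fun ?_
      (hO.measurableSet.inter hK.measurableSet)
    intro x hx
    exact fderivWithin_of_mem_nhds (mem_of_superset (hO.mem_nhds hx.1) subset_closure)
  have h4 : IntegrableOn (fderiv ℝ f) (O \ K) μ := by
    refine (integrableOn_zero (ε' := E →L[ℝ] F)).congr_fun (fun x hx => ?_)
      (hO.measurableSet.diff hK.measurableSet)
    exact (fderiv_eq_zero_of_eqOn_compl hK.isClosed hf0 hx.2).symm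
  have := h3.union h4
  rwa [inter_union_sdiff] at this

/-- A function with compact support away from the boundary has derivatives of mean zero. -/
lemma integral_fderiv_eq_zero {E : Type*} [NormedAddCommGroup E] [NormedSpace ℝ E]
    [FiniteDimensional ℝ E] [MeasurableSpace E] [BorelSpace E] {μ : Measure E}
    [μ.IsAddHaarMeasure] {O : Set E} (hO : IsOpen O) {f : E → ℝ} (hf : ContDiffOn ℝ 1 f O)
    (hfs : HasCompactSupport f) (hfO : Disjoint (tsupport f) (frontier O)) (v : E) :
    ∫ x in O, fderiv ℝ f x v ∂μ = 0 := by
  classical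
  -- As `f` vanishes near the frontier, its extension by zero is `C¹` on the whole space.
  set F : E → ℝ := O.indicator f with hF
  have hFO : ∀ x ∈ O, F =ᶠ[𝓝 x] f := fun x hx => by
    filter_upwards [hO.mem_nhds hx] with y hy using indicator_of_mem hy f
  have hFn : ∀ x, x ∉ O → F =ᶠ[𝓝 x] fun _ => 0 := by
    intro x hx
    by_cases hxc : x ∈ closure O
    · have hxf : x ∈ frontier O := ⟨hxc, fun h => hx (interior_subset h)⟩
      have hxs : x ∉ tsupport f := fun h => hfO.le_bot ⟨h, hxf⟩
      filter_upwards [notMem_tsupport_iff_eventuallyEq.1 hxs] with y hy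
      simp only [hF, indicator_apply]; split_ifs
      · exact hy
      · rfl
    · filter_upwards [isClosed_closure.isOpen_compl.mem_nhds hxc] with y hy
      exact indicator_of_notMem (fun h => hy (subset_closure h)) f
  have hFc : ContDiff ℝ 1 F := by
    rw [contDiff_iff_contDiffAt]
    intro x
    by_cases hx : x ∈ O
    · exact (hf.contDiffAt (hO.mem_nhds hx)).congr_of_eventuallyEq (hFO x hx)
    · exact contDiffAt_const.congr_of_eventuallyEq (hFn x hx)
  have hFs : HasCompactSupport F := hfs.mono fun x hx h0 => hx (by
    simp only [hF, indicator_apply, h0, ite_self])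
  have e1 : ∫ x in O, fderiv ℝ f x v ∂μ = ∫ x, fderiv ℝ F x v ∂μ := by
    rw [← integral_indicator hO.measurableSet]
    congr 1
    funext x
    by_cases hx : x ∈ O
    · rw [indicator_of_mem hx, (hFO x hx).fderiv_eq]
    · rw [indicator_of_notMem hx, (hFn x hx).fderiv_eq]; simp
  have hFi : Integrable F μ := hFc.continuous.integrable_of_hasCompactSupport hFs
  have hFi' : Integrable (fun x => fderiv ℝ F x v) μ := by
    refine Continuous.integrable_of_hasCompactSupport ?_ ?_
    · exact (hFc.continuous_fderiv one_ne_zero).clm_apply continuous_const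
    · exact (hFs.fderiv (𝕜 := ℝ)).comp_left (g := fun L : E →L[ℝ] ℝ => L v) (by simp)
  rw [e1]
  -- Integration by parts against the constant `1`.
  have := integral_mul_fderiv_eq_neg_fderiv_mul_of_integrable (μ := μ) (f := fun _ : E => (1 : ℝ))
    (g := F) (v := v) (by simp) (by simpa using hFi') (by simpa using hFi)
    (fun x _ => by fun_prop) (fun x _ => hFc.differentiable one_ne_zero x)
  simpa using this

/-- The graph estimate needs a direction with inner product `1` with `e`. Both `e` and `v - (a - 1)
e`, where `a = ⟪e, v⟫`, qualify, and `v` is a linear combination of them. This avoids a separate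
treatment of tangential directions. -/
lemma IsOutwardNormal.flux_estimate (hO : IsOpen O) (hu : UniqueDiffOn ℝ (closure O))
    {q e : EuclideanSpace ℝ (Fin n)}
    (hq : q ∈ frontier O) (he : IsOutwardNormal O q e) (v : EuclideanSpace ℝ (Fin n))
    {δ : ℝ} (hδ : 0 < δ) :
    ∃ N : Set (EuclideanSpace ℝ (Fin n)), IsOpen N ∧ q ∈ N ∧
      surfaceMeasure n (frontier O ∩ N) < ∞ ∧
      ∀ f : EuclideanSpace ℝ (Fin n) → ℝ, HasCompactSupport f → tsupport f ⊆ N →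
        ContDiffOn ℝ 1 f (closure O) →
        |(∫ x in O, fderiv ℝ f x v) - inner ℝ e v * ∫ x in frontier O, f x ∂surfaceMeasure n| ≤
          δ * ∫ x in frontier O, |f x| ∂surfaceMeasure n := by
  obtain ⟨h1, ρ, hρ, hOρ, c, hc, hg⟩ := id he
  have h0 := eq_zero_of_mem_frontier hO hq hρ.continuousAt hOρ
  have hee : inner ℝ e e = (1 : ℝ) := by rw [real_inner_self_eq_norm_sq, h1]; norm_num
  set a : ℝ := inner ℝ e v with ha
  have hu1 : inner ℝ e (v - (a - 1) • e) = (1 : ℝ) := by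
    rw [inner_sub_right, inner_smul_right, hee, ← ha]; ring
  -- The two estimates are combined with weights `1` and `|a - 1|`.
  have hδ' : 0 < δ / (1 + |a - 1|) := by positivity
  have hn : Module.finrank ℝ (EuclideanSpace ℝ (Fin n)) = n := finrank_euclideanSpace_fin
  obtain ⟨N₁, hN₁, hq₁, hfin, hest₁⟩ := exists_nhds_flux_estimate hO hρ hOρ h0 hc hg h1 hee hδ'
  obtain ⟨N₂, hN₂, hq₂, -, hest₂⟩ := exists_nhds_flux_estimate hO hρ hOρ h0 hc hg h1 hu1 hδ'
  rw [hn] at hfin hest₁ hest₂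
  refine ⟨N₁ ∩ N₂, hN₁.inter hN₂, ⟨hq₁, hq₂⟩,
    (measure_mono (inter_subset_inter_right _ inter_subset_left)).trans_lt hfin, ?_⟩
  intro f hfs hfN hf
  have hint : IntegrableOn (fderiv ℝ f) O := integrableOn_fderiv hO hu hfs.isCompact
    (fun x hx => image_eq_zero_of_notMem_tsupport hx) hf
  have hintv : ∀ w, IntegrableOn (fun x => fderiv ℝ f x w) O := fun w => hint.apply_continuousLinearMap w
  have hfd : DifferentiableOn ℝ f O := (hf.mono subset_closure).differentiableOn one_ne_zero
  have e1 := hest₁ f hfs (hfN.trans inter_subset_left) hf.continuousOn hfd (hintv _)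
  have e2 := hest₂ f hfs (hfN.trans inter_subset_right) hf.continuousOn hfd (hintv _)
  have e3 : ∫ x in O, fderiv ℝ f x (v - (a - 1) • e) =
      (∫ x in O, fderiv ℝ f x v) - (a - 1) * ∫ x in O, fderiv ℝ f x e := by
    rw [← integral_const_mul, ← integral_sub (hintv v) ((hintv e).const_mul _)]
    simp
  rw [e3] at e2
  change |_ - ∫ x in frontier O, f x ∂surfaceMeasure n| ≤
    _ * ∫ x in frontier O, |f x| ∂surfaceMeasure n at e1 e2
  set D := ∫ x in O, fderiv ℝ f x v
  set De := ∫ x in O, fderiv ℝ f x e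
  set I := ∫ x in frontier O, f x ∂surfaceMeasure n
  set J := ∫ x in frontier O, |f x| ∂surfaceMeasure n
  calc |D - a * I| = |(D - (a - 1) * De - I) + (a - 1) * (De - I)| := by congr 1; ring
    _ ≤ |D - (a - 1) * De - I| + |a - 1| * |De - I| := by
      rw [← abs_mul]; exact abs_add_le _ _
    _ ≤ δ / (1 + |a - 1|) * J + |a - 1| * (δ / (1 + |a - 1|) * J) := by gcongr
    _ = δ * J := by field_simp

lemma integrableOn_frontier_of_compact {F : Type*} [NormedAddCommGroup F]
    (hK : IsCompact K) (hfin : surfaceMeasure n (frontier O ∩ K) < ∞)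
    {f : EuclideanSpace ℝ (Fin n) → F} (hf : ContinuousOn f (frontier O))
    (hf0 : ∀ x ∈ frontier O, x ∉ K → f x = 0) :
    IntegrableOn f (frontier O) (surfaceMeasure n) := by
  have hm : MeasurableSet (frontier O) := isClosed_frontier.measurableSet
  have h1 : IntegrableOn f (frontier O ∩ K) (surfaceMeasure n) := by
    obtain ⟨b, hb⟩ := (hK.inter_left (isClosed_frontier (s := O))).exists_bound_of_continuousOn
      (hf.mono inter_subset_left)
    refine IntegrableOn.of_bound hfin ?_ b ?_
    · exact (hf.mono inter_subset_left).aestronglyMeasurable_of_isCompact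
        (hK.inter_left isClosed_frontier) (hm.inter hK.measurableSet)
    · exact (ae_restrict_iff' (hm.inter hK.measurableSet)).2 (.of_forall hb)
  have h2 : IntegrableOn f (frontier O \ K) (surfaceMeasure n) :=
    integrableOn_zero.congr_fun (fun x hx => (hf0 x hx.1 hx.2).symm) (hm.diff hK.measurableSet)
  have := h1.union h2
  rwa [inter_union_sdiff] at this

lemma divergence_eq_sum {V : EuclideanSpace ℝ (Fin n) → EuclideanSpace ℝ (Fin n)}
    {x : EuclideanSpace ℝ (Fin n)} (hV : DifferentiableAt ℝ V x) :
    divergence V x = ∑ α, fderiv ℝ (fun x => V x α) x (EuclideanSpace.single α 1) := by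
  refine Finset.sum_congr rfl fun α _ => ?_
  have h := (EuclideanSpace.proj α : EuclideanSpace ℝ (Fin n) →L[ℝ] ℝ).hasFDerivAt.comp x
    hV.hasFDerivAt
  have h2 : fderiv ℝ (fun x => V x α) x =
      (EuclideanSpace.proj α : EuclideanSpace ℝ (Fin n) →L[ℝ] ℝ).comp (fderiv ℝ V x) := h.fderiv
  rw [h2]; rfl

lemma contDiffOn_coord {m : ℕ} {E : Type*} [NormedAddCommGroup E] [NormedSpace ℝ E] {s : Set E}
    {k : WithTop ℕ∞} {V : E → EuclideanSpace ℝ (Fin m)} (hV : ContDiffOn ℝ k V s) (i : Fin m) :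
    ContDiffOn ℝ k (fun x => V x i) s :=
  (EuclideanSpace.proj i : EuclideanSpace ℝ (Fin m) →L[ℝ] ℝ).contDiff.comp_contDiffOn hV

/-- The normal is frozen at `q`: each coordinate costs one flux error, and replacing the frozen
normal by the true one costs one more, by continuity of the normal. -/
lemma IsOutwardNormal.divergence_estimate (hO : IsOpen O)
    (hb : ∀ x ∈ frontier O, ∃ ν, IsOutwardNormal O x ν)
    {q : EuclideanSpace ℝ (Fin n)} (hq : q ∈ frontier O) {δ : ℝ} (hδ : 0 < δ) :
    ∃ N : Set (EuclideanSpace ℝ (Fin n)), IsOpen N ∧ q ∈ N ∧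
      surfaceMeasure n (frontier O ∩ N) < ∞ ∧
      ∀ V : EuclideanSpace ℝ (Fin n) → EuclideanSpace ℝ (Fin n), HasCompactSupport V →
        tsupport V ⊆ N → ContDiffOn ℝ 1 V (closure O) →
        |(∫ x in O, divergence V x) -
            ∫ x in frontier O, inner ℝ (V x) (outwardNormal O x) ∂surfaceMeasure n| ≤
          δ * ∫ x in frontier O, ‖V x‖ ∂surfaceMeasure n := by
  have hu := uniqueDiffOn_closure hO hb
  set e := outwardNormal O q with he_def
  have he : IsOutwardNormal O q e := outwardNormal_spec (hb q hq)
  -- One share for each of the `n` coordinates and one for the oscillation of the normal.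
  set δ' := δ / (n + 1) with hδ'def
  have hδ' : 0 < δ' := by positivity
  choose N hNo hqN hNfin hNest using fun α : Fin n =>
    he.flux_estimate hO hu hq (EuclideanSpace.single α (1 : ℝ)) hδ'
  obtain ⟨N', hN'o, hqN', hN'fin, -⟩ := he.flux_estimate hO hu hq 0 hδ'
  have hνc := continuousOn_outwardNormal hO hb q hq
  have hnear : ∀ᶠ x in 𝓝 q, x ∈ frontier O → ‖outwardNormal O x - e‖ < δ' := by
    rw [← eventually_nhdsWithin_iff]
    have : ContinuousWithinAt (fun x => ‖outwardNormal O x - e‖) (frontier O) q :=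
      (hνc.sub continuousWithinAt_const).norm
    exact this.eventually_lt_const (by simpa [he_def] using hδ')
  obtain ⟨N'', hN''sub, hN''o, hqN''⟩ := eventually_nhds_iff.1 hnear
  refine ⟨(⋂ α, N α) ∩ (N' ∩ N''), (isOpen_iInter_of_finite hNo).inter (hN'o.inter hN''o),
    ⟨mem_iInter.2 hqN, hqN', hqN''⟩, (measure_mono (inter_subset_inter_right _
      (inter_subset_right.trans inter_subset_left))).trans_lt hN'fin, ?_⟩
  intro V hVs hVN hV
  have hVfin : surfaceMeasure n (frontier O ∩ tsupport V) < ∞ :=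
    (measure_mono (inter_subset_inter_right _
      (hVN.trans (inter_subset_right.trans inter_subset_left)))).trans_lt hN'fin
  have hVc : ContinuousOn V (frontier O) := hV.continuousOn.mono frontier_subset_closure
  have hV0 : ∀ x, x ∉ tsupport V → V x = 0 := fun x hx => image_eq_zero_of_notMem_tsupport hx
  have hInt : ∀ {F : Type} [NormedAddCommGroup F] (f : EuclideanSpace ℝ (Fin n) → F),
      ContinuousOn f (frontier O) → (∀ x, V x = 0 → f x = 0) →
      IntegrableOn f (frontier O) (surfaceMeasure n) := fun f hf hf0 =>
    integrableOn_frontier_of_compact hVs.isCompact hVfin hf fun x _ hx => hf0 x (hV0 x hx)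
  set J := ∫ x in frontier O, ‖V x‖ ∂surfaceMeasure n with hJ
  have hJi := hInt (fun x => ‖V x‖) hVc.norm (by simp +contextual)
  have hsupp : ∀ α : Fin n, tsupport (fun x => V x α) ⊆ tsupport V := fun α =>
    closure_mono fun x hx h0 => hx (by simp [h0])
  have hcomp : ∀ α : Fin n, |(∫ x in O, fderiv ℝ (fun x => V x α) x (EuclideanSpace.single α 1)) -
      ∫ x in frontier O, V x α * e α ∂surfaceMeasure n| ≤ δ' * J := by
    intro α
    have hcs : HasCompactSupport fun x => V x α :=
      hVs.of_isClosed_subset (isClosed_tsupport _) (hsupp α)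
    have h1 := hNest α (fun x => V x α) hcs
      ((hsupp α).trans (hVN.trans (inter_subset_left.trans (iInter_subset N α))))
      (contDiffOn_coord hV α)
    have h2 : inner ℝ e (EuclideanSpace.single α (1 : ℝ)) = e α := by
      simp [EuclideanSpace.inner_single_right]
    rw [h2, ← integral_const_mul] at h1
    have h3 : ∫ x in frontier O, |V x α| ∂surfaceMeasure n ≤ J := by
      refine integral_mono (hInt (fun x => |V x α|) ?_ (by simp +contextual)) hJi fun x => ?_
      · exact ((contDiffOn_coord hV α).continuousOn.mono frontier_subset_closure).abs
      · exact PiLp.norm_apply_le (V x) α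
    calc _ ≤ δ' * ∫ x in frontier O, |V x α| ∂surfaceMeasure n := by
          simpa only [mul_comm (e α)] using h1
      _ ≤ δ' * J := by gcongr
  have hVint : IntegrableOn (fderiv ℝ V) O := integrableOn_fderiv hO hu hVs.isCompact hV0 hV
  have hVd : ∀ x ∈ O, DifferentiableAt ℝ V x := fun x hx =>
    (hV.contDiffAt (mem_of_superset (hO.mem_nhds hx) subset_closure)).differentiableAt one_ne_zero
  have hsum1 : ∫ x in O, divergence V x =
      ∑ α, ∫ x in O, fderiv ℝ (fun x => V x α) x (EuclideanSpace.single α 1) := by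
    rw [← integral_finsetSum]
    · exact setIntegral_congr_fun hO.measurableSet fun x hx => divergence_eq_sum (hVd x hx)
    · intro α _
      exact (integrableOn_fderiv hO hu hVs.isCompact (fun x hx => by simp [hV0 x hx])
        (contDiffOn_coord hV α)).apply_continuousLinearMap _
  have hsum2 : ∫ x in frontier O, inner ℝ (V x) e ∂surfaceMeasure n =
      ∑ α, ∫ x in frontier O, V x α * e α ∂surfaceMeasure n := by
    rw [← integral_finsetSum]
    · refine integral_congr_ae (.of_forall fun x => ?_)
      simp [PiLp.inner_apply, mul_comm]
    · intro α _
      refine hInt (fun x => V x α * e α) ?_ (by simp +contextual)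
      exact ((contDiffOn_coord hV α).continuousOn.mono frontier_subset_closure).mul
        continuousOn_const
  have hνco : ContinuousOn (outwardNormal O) (frontier O) := continuousOn_outwardNormal hO hb
  have hI1 : IntegrableOn (fun x => inner ℝ (V x) e) (frontier O) (surfaceMeasure n) :=
    hInt _ (hVc.inner continuousOn_const) (by simp +contextual)
  have hI2 : IntegrableOn (fun x => inner ℝ (V x) (outwardNormal O x)) (frontier O)
      (surfaceMeasure n) := hInt _ (hVc.inner hνco) (by simp +contextual)
  have hest2 : |(∫ x in frontier O, inner ℝ (V x) e ∂surfaceMeasure n) -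
      ∫ x in frontier O, inner ℝ (V x) (outwardNormal O x) ∂surfaceMeasure n| ≤ δ' * J := by
    rw [← integral_sub hI1 hI2, hJ, ← integral_const_mul, ← Real.norm_eq_abs]
    refine norm_integral_le_of_norm_le (hJi.const_mul δ') ?_
    refine (ae_restrict_iff' isClosed_frontier.measurableSet).2 (.of_forall fun x hx => ?_)
    by_cases hxs : x ∈ tsupport V
    · have h1 := hN''sub x (hVN hxs).2.2 hx
      rw [← inner_sub_right]
      calc _ ≤ ‖V x‖ * ‖e - outwardNormal O x‖ := norm_inner_le_norm _ _
        _ ≤ ‖V x‖ * δ' := by rw [norm_sub_rev]; gcongr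
        _ = _ := mul_comm _ _
    · simp [hV0 x hxs]
  have hest1 : |(∫ x in O, divergence V x) -
      ∫ x in frontier O, inner ℝ (V x) e ∂surfaceMeasure n| ≤ n * (δ' * J) := by
    rw [hsum1, hsum2, ← Finset.sum_sub_distrib]
    refine (Finset.abs_sum_le_sum_abs _ _).trans ?_
    refine (Finset.sum_le_sum fun α _ => hcomp α).trans ?_
    simp
  calc _ ≤ _ := abs_sub_le _ (∫ x in frontier O, inner ℝ (V x) e ∂surfaceMeasure n) _
    _ ≤ n * (δ' * J) + δ' * J := add_le_add hest1 hest2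
    _ = δ * J := by rw [hδ'def]; field_simp

lemma surfaceMeasure_frontier_inter_lt_top (hO : IsOpen O)
    (hb : ∀ x ∈ frontier O, ∃ ν, IsOutwardNormal O x ν) (hK : IsCompact K) :
    surfaceMeasure n (frontier O ∩ K) < ∞ := by
  refine (hK.inter_left isClosed_frontier).measure_lt_top_of_nhdsWithin fun x hx => ?_
  obtain ⟨N, hNo, hxN, hfin, -⟩ := IsOutwardNormal.divergence_estimate hO hb hx.1 one_pos
  exact ⟨frontier O ∩ N, mem_of_superset (inter_mem self_mem_nhdsWithin
    (mem_nhdsWithin_of_mem_nhds (hNo.mem_nhds hxN))) fun y hy => ⟨hy.1.1, hy.2⟩, hfin⟩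

end Divergence

/-! ### The global divergence theorem -/

section Divergence

open scoped ENNReal Manifold ContDiff

variable {n : ℕ} {O K : Set (EuclideanSpace ℝ (Fin n))}

/-- Finite smooth partitions of unity on compact subsets of Euclidean space. -/
lemma exists_finset_partition {E : Type*} [NormedAddCommGroup E] [NormedSpace ℝ E]
    [FiniteDimensional ℝ E] {ι : Type*} {K : Set E}
    (hK : IsCompact K) {U : ι → Set E}
    (hUo : ∀ i, IsOpen (U i)) (hU : K ⊆ ⋃ i, U i) :
    ∃ (t : Finset ι) (φ : ι → E → ℝ), (∀ i, ContDiff ℝ 1 (φ i)) ∧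
      (∀ i x, 0 ≤ φ i x) ∧ (∀ i, tsupport (φ i) ⊆ U i) ∧ ∀ x ∈ K, ∑ i ∈ t, φ i x = 1 := by
  obtain ⟨φ, hφ⟩ := SmoothPartitionOfUnity.exists_isSubordinate
    (modelWithCornersSelf ℝ E) hK.isClosed U hUo hU
  refine ⟨(φ.locallyFinite.finite_nonempty_inter_compact hK).toFinset, fun i => φ i,
    fun i => (φ i).contMDiff.contDiff.of_le (by exact_mod_cast le_top), fun i x => φ.nonneg i x,
    hφ, fun x hx => ?_⟩
  rw [← φ.sum_eq_one hx]
  refine (finsum_eq_sum_of_support_subset _ fun i hi => ?_).symm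
  rw [Finite.coe_toFinset]
  exact ⟨x, hi, hx⟩

/-- The **divergence theorem** on an open set with `C¹` boundary, for `C¹` vector fields with
compact support. -/
theorem integral_divergence (hO : IsOpen O) (hb : ∀ x ∈ frontier O, ∃ ν, IsOutwardNormal O x ν)
    (hK : IsCompact K) {V : EuclideanSpace ℝ (Fin n) → EuclideanSpace ℝ (Fin n)}
    (hV0 : ∀ x, x ∉ K → V x = 0) (hV : ContDiffOn ℝ 1 V (closure O)) :
    ∫ x in O, divergence V x =
      ∫ x in frontier O, inner ℝ (V x) (outwardNormal O x) ∂surfaceMeasure n := by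
  have hu := uniqueDiffOn_closure hO hb
  set A := ∫ x in O, divergence V x with hA
  set B := ∫ x in frontier O, inner ℝ (V x) (outwardNormal O x) ∂surfaceMeasure n with hB
  set J := ∫ x in frontier O, ‖V x‖ ∂surfaceMeasure n with hJ
  have hJ0 : 0 ≤ J := integral_nonneg fun x => norm_nonneg _
  suffices h : ∀ δ > 0, |A - B| ≤ δ * J by
    have h1 : |A - B| ≤ 0 := by
      refine le_of_forall_pos_le_add fun ε hε => ?_
      have h2 := h (ε / (J + 1)) (by positivity)
      have h3 : ε / (J + 1) * J ≤ ε := by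
        rw [div_mul_eq_mul_div, div_le_iff₀ (by positivity)]; nlinarith
      linarith
    exact sub_eq_zero.1 (abs_eq_zero.1 (le_antisymm h1 (abs_nonneg _)))
  intro δ hδ
  choose N hNo hqN hNfin hNest using fun q : frontier O =>
    IsOutwardNormal.divergence_estimate hO hb q.2 hδ
  -- The index `none` carries the complement of the frontier, so that one family covers both
  -- interior and boundary.
  obtain ⟨U, hUn, hUs⟩ : ∃ U : Option (frontier O) → Set (EuclideanSpace ℝ (Fin n)),
      U none = (frontier O)ᶜ ∧ ∀ q, U (some q) = N q :=
    ⟨fun i => i.elim (frontier O)ᶜ N, rfl, fun _ => rfl⟩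
  have hUo : ∀ i, IsOpen (U i) := by
    rintro (_ | q)
    · rw [hUn]; exact isClosed_frontier.isOpen_compl
    · rw [hUs]; exact hNo q
  have hUcov : K ⊆ ⋃ i, U i := by
    intro x _
    by_cases hx : x ∈ frontier O
    · exact mem_iUnion.2 ⟨some ⟨x, hx⟩, hUs ⟨x, hx⟩ ▸ hqN ⟨x, hx⟩⟩
    · exact mem_iUnion.2 ⟨none, hUn ▸ hx⟩
  obtain ⟨t, φ, hφc, hφ0, hφ, hsum⟩ := exists_finset_partition hK hUo hUcov
  set Vi : Option (frontier O) → EuclideanSpace ℝ (Fin n) → EuclideanSpace ℝ (Fin n) :=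
    fun i x => φ i x • V x with hVi
  have hVs : HasCompactSupport V := HasCompactSupport.intro hK fun x hx => hV0 x hx
  have hVsum : ∀ x, V x = ∑ i ∈ t, Vi i x := by
    intro x
    by_cases hx : x ∈ K
    · simp only [hVi, ← Finset.sum_smul, hsum x hx, one_smul]
    · simp [hVi, hV0 x hx]
  have hVic : ∀ i, ContDiffOn ℝ 1 (Vi i) (closure O) := fun i => (hφc i).contDiffOn.smul hV
  have hVis : ∀ i, HasCompactSupport (Vi i) := fun i =>
    HasCompactSupport.intro hK fun x hx => by simp [hVi, hV0 x hx]
  have hViU : ∀ i, tsupport (Vi i) ⊆ U i := fun i =>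
    (tsupport_smul_subset_left (φ i) V).trans (hφ i)
  have hVi0 : ∀ i x, x ∉ K → Vi i x = 0 := fun i x hx => by simp [hVi, hV0 x hx]
  have hdiff : ∀ i, ∀ x ∈ O, DifferentiableAt ℝ (Vi i) x := fun i x hx =>
    ((hVic i).contDiffAt (mem_of_superset (hO.mem_nhds hx) subset_closure)).differentiableAt
      one_ne_zero
  have hdint : ∀ i, ∀ α : Fin n, IntegrableOn
      (fun x => fderiv ℝ (fun x => Vi i x α) x (EuclideanSpace.single α 1)) O := fun i α =>
    (integrableOn_fderiv hO hu hK (fun x hx => by simp [hVi0 i x hx])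
      (contDiffOn_coord (hVic i) α)).apply_continuousLinearMap _
  have hint : ∀ i, IntegrableOn (divergence (Vi i)) O := by
    intro i
    refine IntegrableOn.congr_fun (integrable_finsetSum Finset.univ fun α _ => hdint i α)
      (fun x hx => (divergence_eq_sum (hdiff i x hx)).symm) hO.measurableSet
  have hfin := surfaceMeasure_frontier_inter_lt_top hO hb hK
  have hVco : ContinuousOn V (frontier O) := hV.continuousOn.mono frontier_subset_closure
  have hφco : ∀ i, ContinuousOn (φ i) (frontier O) := fun i => (hφc i).continuous.continuousOn
  have hνco := continuousOn_outwardNormal hO hb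
  have hA' : A = ∑ i ∈ t, ∫ x in O, divergence (Vi i) x := by
    rw [← integral_finsetSum _ fun i _ => hint i]
    refine setIntegral_congr_fun hO.measurableSet fun x hx => ?_
    have h1 : HasFDerivAt V (∑ i ∈ t, fderiv ℝ (Vi i) x) x := by
      have : V = fun x => ∑ i ∈ t, Vi i x := funext hVsum
      rw [this]
      exact HasFDerivAt.fun_sum fun i _ => (hdiff i x hx).hasFDerivAt
    simp only [divergence, h1.fderiv]
    rw [Finset.sum_comm]
    refine Finset.sum_congr rfl fun α _ => ?_
    simp
  have hB' : B = ∑ i ∈ t, ∫ x in frontier O, inner ℝ (Vi i x) (outwardNormal O x) ∂surfaceMeasure n := by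
    rw [← integral_finsetSum]
    · refine integral_congr_ae (.of_forall fun x => ?_)
      change inner ℝ (V x) _ = _
      rw [hVsum x, sum_inner]
    · intro i _
      exact integrableOn_frontier_of_compact hK hfin (((hφco i).smul hVco).inner hνco)
        fun x _ hx => by simp [hVi0 i x hx]
  have hJi : ∀ i, IntegrableOn (fun x => ‖Vi i x‖) (frontier O) (surfaceMeasure n) := fun i =>
    integrableOn_frontier_of_compact hK hfin ((hφco i).smul hVco).norm
      fun x _ hx => by simp [hVi0 i x hx]
  -- Because the partition functions are nonnegative with sum `1`, the norms of the pieces add up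
  -- exactly to that of `V`. The total error is `δ J`, however many pieces there are.
  have hJ' : J = ∑ i ∈ t, ∫ x in frontier O, ‖Vi i x‖ ∂surfaceMeasure n := by
    rw [← integral_finsetSum _ fun i _ => hJi i]
    refine integral_congr_ae (.of_forall fun x => ?_)
    by_cases hx : x ∈ K
    · simp only [hVi, norm_smul, Real.norm_of_nonneg (hφ0 _ x), ← Finset.sum_mul, hsum x hx,
        one_mul]
    · simp [hVi0 _ x hx, hV0 x hx]
  rw [hA', hB', hJ', ← Finset.sum_sub_distrib, Finset.mul_sum]
  refine (Finset.abs_sum_le_sum_abs _ _).trans (Finset.sum_le_sum fun i _ => ?_)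
  rcases i with _ | q
  · have hdisj : Disjoint (tsupport (Vi none)) (frontier O) :=
      disjoint_left.2 fun x hx => by
        have := hViU none hx
        rwa [hUn] at this
    have h1 : ∫ x in O, divergence (Vi none) x = 0 := by
      rw [setIntegral_congr_fun hO.measurableSet fun x hx => divergence_eq_sum (hdiff none x hx),
        integral_finsetSum _ fun α _ => hdint none α]
      refine Finset.sum_eq_zero fun α _ => ?_
      have hsupp : tsupport (fun x => Vi none x α) ⊆ tsupport (Vi none) :=
        closure_mono fun x hx h0 => hx (by simp [h0])
      exact integral_fderiv_eq_zero hO ((contDiffOn_coord (hVic none) α).mono subset_closure)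
        ((hVis none).of_isClosed_subset (isClosed_tsupport _) hsupp) (hdisj.mono_left hsupp) _
    have h2 : ∫ x in frontier O, inner ℝ (Vi none x) (outwardNormal O x) ∂surfaceMeasure n = 0 := by
      refine setIntegral_eq_zero_of_forall_eq_zero fun x hx => ?_
      rw [image_eq_zero_of_notMem_tsupport fun h => disjoint_left.1 hdisj h hx, inner_zero_left]
    rw [h1, h2, sub_zero, abs_zero]
    exact mul_nonneg hδ.le (integral_nonneg fun x => norm_nonneg _)
  · exact hNest q (Vi (some q)) (hVis _) (hUs q ▸ hViU (some q)) (hVic _)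

end Divergence

/-! ### Exteriors, dilations and the voided body -/

section Geometry

variable {n : ℕ} {O O' Ω ω : Set (EuclideanSpace ℝ (Fin n))} {x ν : EuclideanSpace ℝ (Fin n)}

lemma IsOutwardNormal.congr (h : IsOutwardNormal O x ν) (hO : ∀ᶠ x' in 𝓝 x, x' ∈ O' ↔ x' ∈ O) :
    IsOutwardNormal O' x ν := by
  obtain ⟨h1, ρ, hρ, hOρ, hc⟩ := h
  exact ⟨h1, ρ, hρ, by filter_upwards [hO, hOρ] with x' h2 h3 using h2.trans h3, hc⟩

/-- Zeros of `ρ` near `x` have nonzero gradient, and moving against it leads into `O`; so they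
belong to `closure O` and only `0 < ρ` is left for the exterior. -/
lemma eventually_mem_exterior_iff {ρ : EuclideanSpace ℝ (Fin n) → ℝ} (hρ : ContDiffAt ℝ 1 ρ x)
    (hOρ : ∀ᶠ x' in 𝓝 x, x' ∈ O ↔ ρ x' < 0) (hne : gradient ρ x ≠ 0) :
    ∀ᶠ x' in 𝓝 x, x' ∈ exterior O ↔ 0 < ρ x' := by
  have hgc : ContinuousAt (gradient ρ) x := by
    have : ContinuousAt (fderiv ℝ ρ) x :=
      (hρ.fderiv_right (m := 0) (by norm_num)).continuousAt
    exact (InnerProductSpace.toDual ℝ _).symm.continuous.continuousAt.comp this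
  filter_upwards [hgc.eventually_ne hne, hρ.eventually (by simp), hOρ.eventually_nhds]
    with x' h3 h4 h5
  constructor
  · intro hx'
    have h6 : 0 ≤ ρ x' := by
      by_contra hcon
      exact hx' (subset_closure (h5.self_of_nhds.2 (not_le.1 hcon)))
    refine lt_of_le_of_ne h6 fun h0 => hx' ?_
    have h7 := eventually_neg_of_inner_neg (v := -gradient ρ x')
      (h4.differentiableAt one_ne_zero) rfl h0.symm (by
        rw [inner_neg_right, real_inner_self_eq_norm_sq]
        have := norm_pos_iff.2 h3
        simp only [Left.neg_neg_iff]; positivity)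
    have ht : Tendsto (fun s : ℝ => x' + s • -gradient ρ x') (𝓝[>] 0) (𝓝 x') := by
      have : Continuous fun s : ℝ => x' + s • -gradient ρ x' := by fun_prop
      simpa using (this.tendsto 0).mono_left nhdsWithin_le_nhds
    refine mem_closure_of_tendsto ht ?_
    filter_upwards [h7, ht.eventually h5] with s hs hs'
    exact hs'.2 hs
  · intro hpos hcl
    obtain ⟨y, hy, hyO⟩ := mem_closure_iff_nhds.1 hcl _
      ((h4.continuousAt.eventually_const_lt hpos).and h5)
    exact lt_asymm hy.1 (hy.2.1 hyO)

lemma smul_ne_zero_of_norm_eq_one {E : Type*} [NormedAddCommGroup E] [NormedSpace ℝ E] {ν : E}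
    (h : ‖ν‖ = 1) {c : ℝ} (hc : 0 < c) : c • ν ≠ 0 :=
  smul_ne_zero hc.ne' fun h0 => by simp [h0] at h

lemma IsOutwardNormal.neg_exterior (h : IsOutwardNormal O x ν) :
    IsOutwardNormal (exterior O) x (-ν) := by
  obtain ⟨h1, ρ, hρ, hOρ, c, hc, hg⟩ := h
  refine ⟨by rwa [norm_neg], fun x => -ρ x, hρ.neg, ?_, c, hc, ?_⟩
  · filter_upwards [eventually_mem_exterior_iff hρ hOρ (hg ▸ smul_ne_zero_of_norm_eq_one h1 hc)]
      with x' hx'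
    rw [hx', neg_lt_zero]
  · rw [smul_neg, ← hg]; simp [gradient]

lemma isOpen_exterior (O : Set (EuclideanSpace ℝ (Fin n))) : IsOpen (exterior O) :=
  isClosed_closure.isOpen_compl

lemma IsOutwardNormal.mem_closure_exterior (hO : IsOpen O) (hx : x ∈ frontier O)
    (h : IsOutwardNormal O x ν) : x ∈ closure (exterior O) := by
  obtain ⟨h1, ρ, hρ, hOρ, c, hc, hg⟩ := h
  have h0 := eq_zero_of_mem_frontier hO hx hρ.continuousAt hOρ
  have h2 := eventually_mem_exterior_iff hρ hOρ (hg ▸ smul_ne_zero_of_norm_eq_one h1 hc)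
  have hg' : gradient (fun x => -ρ x) x = -(c • ν) := by rw [← hg]; simp [gradient]
  have h3 := eventually_neg_of_inner_neg (v := ν) (hρ.differentiableAt one_ne_zero).neg hg'
    (by simp [h0]) (by
      rw [inner_neg_left, real_inner_smul_left, real_inner_self_eq_norm_sq, h1]
      linarith)
  have ht : Tendsto (fun s : ℝ => x + s • ν) (𝓝[>] 0) (𝓝 x) := by
    have : Continuous fun s : ℝ => x + s • ν := by fun_prop
    simpa using (this.tendsto 0).mono_left nhdsWithin_le_nhds
  refine mem_closure_of_tendsto ht ?_
  filter_upwards [h3, ht.eventually h2] with s hs hs'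
  exact hs'.2 (neg_lt_zero.1 hs)

lemma frontier_exterior (hO : IsOpen O) (hb : ∀ x ∈ frontier O, ∃ ν, IsOutwardNormal O x ν) :
    frontier (exterior O) = frontier O := by
  apply subset_antisymm
  · rw [exterior, frontier_compl]; exact frontier_closure_subset
  · intro x hx
    obtain ⟨ν, hν⟩ := hb x hx
    refine ⟨hν.mem_closure_exterior hO hx, fun h => ?_⟩
    exact (interior_subset h) hx.1

/-- A boundary point is reached from outside along its normal. Thus regularity up to the boundary of
the exterior means regularity on all of `Oᶜ`. -/
lemma closure_exterior (hO : IsOpen O) (hb : ∀ x ∈ frontier O, ∃ ν, IsOutwardNormal O x ν) :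
    closure (exterior O) = Oᶜ := by
  apply subset_antisymm
  · exact closure_minimal (compl_subset_compl.2 subset_closure) hO.isClosed_compl
  · intro x hx
    by_cases hxc : x ∈ closure O
    · obtain ⟨ν, hν⟩ := hb x ⟨hxc, fun h => hx (interior_subset h)⟩
      exact hν.mem_closure_exterior hO ⟨hxc, fun h => hx (interior_subset h)⟩
    · exact subset_closure hxc

lemma exists_isOutwardNormal_exterior (hO : IsOpen O)
    (hb : ∀ x ∈ frontier O, ∃ ν, IsOutwardNormal O x ν) :
    ∀ x ∈ frontier (exterior O), ∃ ν, IsOutwardNormal (exterior O) x ν := by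
  intro x hx
  rw [frontier_exterior hO hb] at hx
  obtain ⟨ν, hν⟩ := hb x hx
  exact ⟨-ν, hν.neg_exterior⟩

lemma outwardNormal_exterior (hO : IsOpen O) (hb : ∀ x ∈ frontier O, ∃ ν, IsOutwardNormal O x ν)
    (hx : x ∈ frontier O) : outwardNormal (exterior O) x = -outwardNormal O x :=
  (outwardNormal_spec (hb x hx)).neg_exterior.outwardNormal_eq (isOpen_exterior O)
    (by rwa [frontier_exterior hO hb])

lemma IsOutwardNormal.smul (h : IsOutwardNormal O x ν) {ε : ℝ} (hε : 0 < ε) :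
    IsOutwardNormal (ε • O) (ε • x) ν := by
  obtain ⟨h1, ρ, hρ, hOρ, c, hc, hg⟩ := h
  have hx : ε⁻¹ • ε • x = x := inv_smul_smul₀ hε.ne' x
  have hρ' : ContDiffAt ℝ 1 ρ (ε⁻¹ • ε • x) := by rwa [hx]
  have hlin : HasFDerivAt (fun y : EuclideanSpace ℝ (Fin n) => ε⁻¹ • y)
      (ε⁻¹ • ContinuousLinearMap.id ℝ _) (ε • x) := (hasFDerivAt_id _).const_smul ε⁻¹
  refine ⟨h1, fun y => ρ (ε⁻¹ • y), ?_, ?_, ε⁻¹ * c, by positivity, ?_⟩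
  · exact ContDiffAt.comp (ε • x) hρ' (contDiffAt_id.const_smul ε⁻¹)
  · have ht : Tendsto (fun y : EuclideanSpace ℝ (Fin n) => ε⁻¹ • y) (𝓝 (ε • x)) (𝓝 x) := by
      have : Continuous fun y : EuclideanSpace ℝ (Fin n) => ε⁻¹ • y := by fun_prop
      simpa [hx] using this.tendsto (ε • x)
    filter_upwards [ht.eventually hOρ] with y hy
    rw [mem_smul_set_iff_inv_smul_mem₀ hε.ne']; exact hy
  · have hd : HasFDerivAt (fun y => ρ (ε⁻¹ • y)) ((fderiv ℝ ρ x).comp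
        (ε⁻¹ • ContinuousLinearMap.id ℝ _)) (ε • x) := by
      refine HasFDerivAt.comp (ε • x) ?_ hlin
      rw [hx]; exact (hρ.differentiableAt one_ne_zero).hasFDerivAt
    rw [gradient, hd.fderiv, mul_smul, ← hg, gradient]
    simp

lemma frontier_smul_set (O : Set (EuclideanSpace ℝ (Fin n))) {ε : ℝ} (hε : 0 < ε) :
    frontier (ε • O) = ε • frontier O := by
  rw [frontier, frontier, closure_smul₀' hε.ne', interior_smul₀ hε.ne', smul_set_sdiff₀ hε.ne']

lemma exists_isOutwardNormal_smul
    (hb : ∀ x ∈ frontier O, ∃ ν, IsOutwardNormal O x ν) {ε : ℝ} (hε : 0 < ε) :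
    ∀ x ∈ frontier (ε • O), ∃ ν, IsOutwardNormal (ε • O) x ν := by
  intro x hx
  rw [frontier_smul_set O hε] at hx
  obtain ⟨z, hz, rfl⟩ := hx
  obtain ⟨ν, hν⟩ := hb z hz
  exact ⟨ν, hν.smul hε⟩

lemma outwardNormal_smul (hO : IsOpen O) (hb : ∀ x ∈ frontier O, ∃ ν, IsOutwardNormal O x ν)
    (hx : x ∈ frontier O) {ε : ℝ} (hε : 0 < ε) :
    outwardNormal (ε • O) (ε • x) = outwardNormal O x :=
  ((outwardNormal_spec (hb x hx)).smul hε).outwardNormal_eq (hO.smul₀ hε.ne')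
    (by rw [frontier_smul_set O hε]; exact smul_mem_smul_set hx)

section Voided

variable {ε : ℝ}

lemma isOpen_voided (hΩ : IsOpen Ω) : IsOpen (voided Ω ω ε) := hΩ.sdiff isClosed_closure

lemma _root_.Filter.EventuallyEq.closure_set {X : Type*} [TopologicalSpace X] {s t : Set X} {x : X}
    (h : s =ᶠ[𝓝 x] t) : closure s =ᶠ[𝓝 x] closure t := by
  filter_upwards [h.eventuallyEq_nhds] with y hy
  apply propext
  change y ∈ closure s ↔ y ∈ closure t
  rw [mem_closure_iff_frequently, mem_closure_iff_frequently]
  exact frequently_congr (hy.mono fun z hz => iff_of_eq hz)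

/-- When the closed void lies in `Ω`, every point is covered by this lemma or the next one. Closures
and normals are local, so those of the voided body are read off from `Ω` and from the exterior of
the void. -/
lemma voided_eventuallyEq_of_notMem (hx : x ∉ closure (ε • ω)) :
    voided Ω ω ε =ᶠ[𝓝 x] Ω := by
  filter_upwards [isClosed_closure.isOpen_compl.mem_nhds hx] with y hy
  exact propext ⟨fun h => h.1, fun h => ⟨h, hy⟩⟩

lemma voided_eventuallyEq_of_mem (hΩ : IsOpen Ω) (hx : x ∈ Ω) :
    voided Ω ω ε =ᶠ[𝓝 x] exterior (ε • ω) := by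
  filter_upwards [hΩ.mem_nhds hx] with y hy
  exact propext ⟨fun h => h.2, fun h => ⟨hy, h⟩⟩

lemma closure_exterior_smul (hω : IsOpen ω) (hb : ∀ x ∈ frontier ω, ∃ ν, IsOutwardNormal ω x ν)
    (hε : 0 < ε) : closure (exterior (ε • ω)) = (ε • ω)ᶜ :=
  closure_exterior (hω.smul₀ hε.ne') (exists_isOutwardNormal_smul hb hε)

lemma closure_voided_eventuallyEq_of_mem (hΩ : IsOpen Ω) (hω : IsOpen ω)
    (hb : ∀ x ∈ frontier ω, ∃ ν, IsOutwardNormal ω x ν) (hε : 0 < ε) (hx : x ∈ Ω) :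
    closure (voided Ω ω ε) =ᶠ[𝓝 x] ((ε • ω)ᶜ : Set _) := by
  have := (voided_eventuallyEq_of_mem (ω := ω) (ε := ε) hΩ hx).closure_set
  rwa [closure_exterior_smul hω hb hε] at this

lemma mem_closure_voided (hΩ : IsOpen Ω) (hω : IsOpen ω)
    (hb : ∀ x ∈ frontier ω, ∃ ν, IsOutwardNormal ω x ν) (hε : 0 < ε) (hsub : closure (ε • ω) ⊆ Ω) :
    x ∈ closure (voided Ω ω ε) ↔ x ∈ closure Ω ∧ x ∉ ε • ω := by
  by_cases hx : x ∈ Ω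
  · have h1 : (x ∈ closure (voided Ω ω ε)) = (x ∈ ((ε • ω)ᶜ : Set _)) :=
      (closure_voided_eventuallyEq_of_mem hΩ hω hb hε hx).self_of_nhds
    rw [h1, mem_compl_iff]
    exact ⟨fun h => ⟨subset_closure hx, h⟩, fun h => h.2⟩
  · have hx' : x ∉ closure (ε • ω) := fun h => hx (hsub h)
    have h1 : (x ∈ closure (voided Ω ω ε)) = (x ∈ closure Ω) :=
      (voided_eventuallyEq_of_notMem hx').closure_set.self_of_nhds
    rw [h1]
    exact ⟨fun h => ⟨h, fun h' => hx' (subset_closure h')⟩, fun h => h.1⟩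

lemma exists_isOutwardNormal_voided (hΩ : IsOpen Ω)
    (hbΩ : ∀ x ∈ frontier Ω, ∃ ν, IsOutwardNormal Ω x ν) (hω : IsOpen ω)
    (hb : ∀ x ∈ frontier ω, ∃ ν, IsOutwardNormal ω x ν) (hε : 0 < ε) (hsub : closure (ε • ω) ⊆ Ω) :
    ∀ x ∈ frontier (voided Ω ω ε), ∃ ν, IsOutwardNormal (voided Ω ω ε) x ν := by
  intro x hx
  have h1 := (mem_closure_voided hΩ hω hb hε hsub).1 hx.1
  have h2 : x ∉ voided Ω ω ε := fun h => hx.2 ((isOpen_voided hΩ).interior_eq.symm ▸ h)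
  by_cases hxc : x ∈ closure (ε • ω)
  · have hxf : x ∈ frontier (ε • ω) := ⟨hxc, fun h => h1.2 (interior_subset h)⟩
    obtain ⟨ν, hν⟩ := exists_isOutwardNormal_smul hb hε x hxf
    exact ⟨-ν, hν.neg_exterior.congr
      ((voided_eventuallyEq_of_mem hΩ (hsub hxc)).mono fun y hy => iff_of_eq hy)⟩
  · have hxf : x ∈ frontier Ω := ⟨h1.1, fun h => h2 ⟨interior_subset h, hxc⟩⟩
    obtain ⟨ν, hν⟩ := hbΩ x hxf
    exact ⟨ν, hν.congr ((voided_eventuallyEq_of_notMem hxc).mono fun y hy => iff_of_eq hy)⟩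

/-- For small `ε` the void `ε • ω` lies in a given ball around the origin. -/
lemma eventually_closure_smul_subset_ball (hω : Bornology.IsBounded ω) {a : ℝ} (ha : 0 < a) :
    ∀ᶠ ε : ℝ in 𝓝[>] 0, closure (ε • ω) ⊆ Metric.ball 0 a := by
  obtain ⟨C, hC⟩ := hω.subset_closedBall 0
  have h1 : ∀ᶠ ε : ℝ in 𝓝[>] 0, ε * C < a := by
    have : ContinuousAt (fun ε : ℝ => ε * C) 0 := by fun_prop
    exact (this.eventually_lt_const (by simpa)).filter_mono nhdsWithin_le_nhds
  filter_upwards [h1, self_mem_nhdsWithin] with ε hε hε0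
  have hε0' : (0 : ℝ) < ε := hε0
  have h2 : closure (ε • ω) ⊆ Metric.closedBall 0 (ε * C) := by
    refine closure_minimal ?_ Metric.isClosed_closedBall
    rintro _ ⟨z, hz, rfl⟩
    have := hC hz
    rw [mem_closedBall_zero_iff] at this ⊢
    simp only [norm_smul, Real.norm_of_nonneg hε0'.le]
    gcongr
  exact h2.trans (Metric.closedBall_subset_ball hε)

end Voided

end Geometry

/-! ### Divergence calculus for transposed stresses -/

section Calculus

variable {n m : ℕ}

/-- `Pᵀ a`, where the matrix `P` represents the linear form `A` on matrices. -/
def transposeApply (A : (EuclideanSpace ℝ (Fin n) →L[ℝ] EuclideanSpace ℝ (Fin m)) →L[ℝ] ℝ)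
    (a : EuclideanSpace ℝ (Fin m)) : EuclideanSpace ℝ (Fin n) :=
  WithLp.toLp 2 fun α =>
    A ((EuclideanSpace.proj α : EuclideanSpace ℝ (Fin n) →L[ℝ] ℝ).smulRight a)

variable (A B : (EuclideanSpace ℝ (Fin n) →L[ℝ] EuclideanSpace ℝ (Fin m)) →L[ℝ] ℝ)
  (a b : EuclideanSpace ℝ (Fin m))

lemma transposeApply_apply (α : Fin n) : transposeApply A a α =
    A ((EuclideanSpace.proj α : EuclideanSpace ℝ (Fin n) →L[ℝ] ℝ).smulRight a) := rfl

lemma smulRight_eq_sum (f : EuclideanSpace ℝ (Fin n) →L[ℝ] ℝ) :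
    f.smulRight a = ∑ i, a i • f.smulRight (EuclideanSpace.single i (1 : ℝ)) := by
  ext v j
  simp [Finset.sum_apply, Pi.single_apply, mul_comm]

lemma transposeApply_sub_left : transposeApply (A - B) a = transposeApply A a - transposeApply B a := by
  ext α; simp [transposeApply_apply]

lemma transposeApply_sub_right : transposeApply A (a - b) = transposeApply A a - transposeApply A b := by
  ext α
  have : ∀ f : EuclideanSpace ℝ (Fin n) →L[ℝ] ℝ, f.smulRight (a - b) = f.smulRight a - f.smulRight b := by
    intro f; ext v; simp [smul_sub]
  simp [transposeApply_apply, this]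

lemma transposeApply_smul_right (c : ℝ) : transposeApply A (c • a) = c • transposeApply A a := by
  ext α
  have : ∀ f : EuclideanSpace ℝ (Fin n) →L[ℝ] ℝ, f.smulRight (c • a) = c • f.smulRight a := by
    intro f; ext v; simp [mul_left_comm]
  simp [transposeApply_apply, this]

lemma transposeApply_add_right : transposeApply A (a + b) = transposeApply A a + transposeApply A b := by
  have := transposeApply_sub_right A (a + b) b
  rw [add_sub_cancel_right] at this
  rw [this]; abel

lemma inner_transposeApply (v : EuclideanSpace ℝ (Fin n)) :
    inner ℝ (transposeApply A a) v = A ((innerSL ℝ v).smulRight a) := by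
  have : (innerSL ℝ v).smulRight a =
      ∑ α, v α • (EuclideanSpace.proj α : EuclideanSpace ℝ (Fin n) →L[ℝ] ℝ).smulRight a := by
    ext u j
    simp [PiLp.inner_apply, Finset.sum_mul, mul_left_comm, mul_assoc]
  rw [this, map_sum]
  simp [PiLp.inner_apply, transposeApply_apply]

/-- Pair the vector with itself; the operator bound is then applied to a rank-one matrix, whose norm
is the product of the two norms. -/
lemma norm_transposeApply_le : ‖transposeApply A a‖ ≤ ‖A‖ * ‖a‖ := by
  set u := transposeApply A a with hu
  have h1 : ‖u‖ ^ 2 ≤ ‖A‖ * ‖a‖ * ‖u‖ := by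
    rw [← real_inner_self_eq_norm_sq]
    conv_lhs => rw [hu, inner_transposeApply, ← hu]
    calc A ((innerSL ℝ u).smulRight a) ≤ ‖A ((innerSL ℝ u).smulRight a)‖ := Real.le_norm_self _
      _ ≤ ‖A‖ * ‖(innerSL ℝ u).smulRight a‖ := A.le_opNorm _
      _ = ‖A‖ * ‖a‖ * ‖u‖ := by
        rw [ContinuousLinearMap.norm_smulRight_apply, innerSL_apply_norm]; ring
  rcases (norm_nonneg u).eq_or_lt with h | h
  · rw [← h]; positivity
  · nlinarith

/-- The bridge between the stress in indices and the stress as a linear form: `P ν · a = Pᵀ a · ν`.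
-/
lemma inner_traction (W : (EuclideanSpace ℝ (Fin n) →L[ℝ] EuclideanSpace ℝ (Fin m)) → ℝ)
    (F : EuclideanSpace ℝ (Fin n) →L[ℝ] EuclideanSpace ℝ (Fin m)) (ν : EuclideanSpace ℝ (Fin n)) :
    inner ℝ (traction W F ν) a = inner ℝ (transposeApply (fderiv ℝ W F) a) ν := by
  simp only [PiLp.inner_apply, transposeApply_apply, traction, piola, Matrix.of_apply, unitTensor]
  simp_rw [smulRight_eq_sum a, map_sum, map_smul]
  simp only [RCLike.inner_apply, conj_trivial, smul_eq_mul, Finset.mul_sum]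
  rw [Finset.sum_comm]
  refine Finset.sum_congr rfl fun α _ => Finset.sum_congr rfl fun i _ => by ring

variable {E : Type*} [NormedAddCommGroup E] [NormedSpace ℝ E]

lemma contDiffOn_transposeApply {k : WithTop ℕ∞} {s : Set E}
    {A : E → (EuclideanSpace ℝ (Fin n) →L[ℝ] EuclideanSpace ℝ (Fin m)) →L[ℝ] ℝ}
    {a : E → EuclideanSpace ℝ (Fin m)} (hA : ContDiffOn ℝ k A s) (ha : ContDiffOn ℝ k a s) :
    ContDiffOn ℝ k (fun x => transposeApply (A x) (a x)) s := by
  rw [contDiffOn_piLp]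
  intro α
  simp only [transposeApply_apply]
  have h1 : ContDiffOn ℝ k (fun x =>
      (EuclideanSpace.proj α : EuclideanSpace ℝ (Fin n) →L[ℝ] ℝ).smulRight (a x)) s :=
    (ContinuousLinearMap.smulRightL ℝ (EuclideanSpace ℝ (Fin n)) (EuclideanSpace ℝ (Fin m))
      (EuclideanSpace.proj α)).contDiff.comp_contDiffOn ha
  exact hA.clm_apply h1

variable {x : EuclideanSpace ℝ (Fin n)}

lemma divergence_smul {φ : EuclideanSpace ℝ (Fin n) → ℝ}
    {V : EuclideanSpace ℝ (Fin n) → EuclideanSpace ℝ (Fin n)} (hφ : DifferentiableAt ℝ φ x)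
    (hV : DifferentiableAt ℝ V x) :
    divergence (fun x => φ x • V x) x = fderiv ℝ φ x (V x) + φ x * divergence V x := by
  simp only [divergence, fderiv_fun_smul hφ hV]
  have h2 : V x = ∑ α, V x α • EuclideanSpace.single α (1 : ℝ) := by
    ext j; simp [Finset.sum_apply, Pi.single_apply]
  conv_rhs => rw [h2, map_sum]
  rw [Finset.mul_sum, ← Finset.sum_add_distrib]
  refine Finset.sum_congr rfl fun α _ => ?_
  simp
  ring

lemma divergence_id : divergence (fun x : EuclideanSpace ℝ (Fin n) => x) x = n := by
  simp [divergence]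

lemma divergence_sub {V V' : EuclideanSpace ℝ (Fin n) → EuclideanSpace ℝ (Fin n)}
    (hV : DifferentiableAt ℝ V x) (hV' : DifferentiableAt ℝ V' x) :
    divergence (fun x => V x - V' x) x = divergence V x - divergence V' x := by
  simp [divergence, fderiv_fun_sub hV hV', Finset.sum_sub_distrib]

/-- The divergence of `Pᵀ a` for a divergence-free `P`. -/
lemma divergence_transposeApply
    {A : EuclideanSpace ℝ (Fin n) → (EuclideanSpace ℝ (Fin n) →L[ℝ] EuclideanSpace ℝ (Fin m)) →L[ℝ] ℝ}
    {a : EuclideanSpace ℝ (Fin n) → EuclideanSpace ℝ (Fin m)}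
    (hA : DifferentiableAt ℝ A x) (ha : DifferentiableAt ℝ a x)
    (hdiv : ∀ i : Fin m, ∑ α : Fin n, fderiv ℝ (fun x' => A x' (unitTensor i α)) x
      (EuclideanSpace.single α (1 : ℝ)) = 0) :
    divergence (fun x => transposeApply (A x) (a x)) x = A x (fderiv ℝ a x) := by
  have hd : DifferentiableAt ℝ (fun x => transposeApply (A x) (a x)) x := by
    rw [differentiableAt_piLp]
    intro α
    simp only [transposeApply_apply]
    refine hA.clm_apply ?_
    exact ((ContinuousLinearMap.smulRightL ℝ (EuclideanSpace ℝ (Fin n)) (EuclideanSpace ℝ (Fin m))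
      (EuclideanSpace.proj α)).differentiableAt).comp x ha
  rw [divergence_eq_sum hd]
  -- Product rule. After summation over `α`, the terms that differentiate `A` vanish by the
  -- equilibrium equations, and the others assemble `A` applied to the gradient of `a`.
  have h1 : ∀ α : Fin n, fderiv ℝ (fun x => transposeApply (A x) (a x) α) x
      (EuclideanSpace.single α 1) =
      (∑ i, a x i * fderiv ℝ (fun x' => A x' (unitTensor i α)) x (EuclideanSpace.single α (1 : ℝ))) +
      A x ((EuclideanSpace.proj α : EuclideanSpace ℝ (Fin n) →L[ℝ] ℝ).smulRight
        (fderiv ℝ a x (EuclideanSpace.single α 1))) := by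
    intro α
    simp only [transposeApply_apply]
    have hb : HasFDerivAt (fun x => (EuclideanSpace.proj α : EuclideanSpace ℝ (Fin n) →L[ℝ] ℝ).smulRight
        (a x)) ((ContinuousLinearMap.smulRightL ℝ (EuclideanSpace ℝ (Fin n)) (EuclideanSpace ℝ (Fin m))
      (EuclideanSpace.proj α)).comp (fderiv ℝ a x)) x :=
      (ContinuousLinearMap.smulRightL ℝ (EuclideanSpace ℝ (Fin n)) (EuclideanSpace ℝ (Fin m))
      (EuclideanSpace.proj α)).hasFDerivAt.comp x ha.hasFDerivAt
    rw [(hA.hasFDerivAt.clm_apply hb).fderiv]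
    have h2 : ∀ B, fderiv ℝ (fun x' => A x' B) x (EuclideanSpace.single α (1 : ℝ)) =
        fderiv ℝ A x (EuclideanSpace.single α 1) B := fun B => by
      rw [(hA.hasFDerivAt.clm_apply (hasFDerivAt_const B x)).fderiv]; simp
    simp only [h2]
    simp only [add_apply, ContinuousLinearMap.comp_apply,
      ContinuousLinearMap.flip_apply, ContinuousLinearMap.smulRightL_apply_apply]
    rw [add_comm, smulRight_eq_sum (a x), map_sum]
    simp [unitTensor]
  simp only [h1, Finset.sum_add_distrib]
  rw [Finset.sum_comm]
  simp only [← Finset.mul_sum, hdiv, mul_zero, Finset.sum_const_zero, zero_add]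
  rw [← map_sum]
  congr 1
  ext v j
  have h3 : v = ∑ α, v α • EuclideanSpace.single α (1 : ℝ) := by
    ext j; simp [Finset.sum_apply, Pi.single_apply]
  conv_rhs => rw [h3, map_sum]
  simp [Finset.sum_apply]

end Calculus

/-! ### The dilation field, whose divergence is `n` times the energy density -/

section Equilibrium

variable {n m : ℕ} {W : (EuclideanSpace ℝ (Fin n) →L[ℝ] EuclideanSpace ℝ (Fin m)) → ℝ}
  {U : Set (EuclideanSpace ℝ (Fin n) →L[ℝ] EuclideanSpace ℝ (Fin m))}
  {O : Set (EuclideanSpace ℝ (Fin n))}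
  {y : EuclideanSpace ℝ (Fin n) → EuclideanSpace ℝ (Fin m)}
  {x : EuclideanSpace ℝ (Fin n)}

/-- The Piola stress of a deformation, as a linear form on matrices. -/
def stress (W : (EuclideanSpace ℝ (Fin n) →L[ℝ] EuclideanSpace ℝ (Fin m)) → ℝ)
    (O : Set (EuclideanSpace ℝ (Fin n))) (y : EuclideanSpace ℝ (Fin n) → EuclideanSpace ℝ (Fin m))
    (x : EuclideanSpace ℝ (Fin n)) :
    (EuclideanSpace ℝ (Fin n) →L[ℝ] EuclideanSpace ℝ (Fin m)) →L[ℝ] ℝ :=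
  fderiv ℝ W (bodyGrad O y x)

/-- The vector field `W x - Pᵀ(∇y x - (y - c))`, whose divergence is `n W` in equilibrium. -/
def dilationFlux (W : (EuclideanSpace ℝ (Fin n) →L[ℝ] EuclideanSpace ℝ (Fin m)) → ℝ)
    (O : Set (EuclideanSpace ℝ (Fin n))) (y : EuclideanSpace ℝ (Fin n) → EuclideanSpace ℝ (Fin m))
    (c : EuclideanSpace ℝ (Fin m)) (x : EuclideanSpace ℝ (Fin n)) : EuclideanSpace ℝ (Fin n) :=
  W (bodyGrad O y x) • x - transposeApply (stress W O y x) (bodyGrad O y x x - (y x - c))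

lemma bodyGrad_eq_fderiv (hO : IsOpen O) (hx : x ∈ O) : bodyGrad O y x = fderiv ℝ y x :=
  fderivWithin_of_mem_nhds (mem_of_superset (hO.mem_nhds hx) subset_closure)

lemma contDiffOn_bodyGrad (hu : UniqueDiffOn ℝ (closure O)) (hy : ContDiffOn ℝ 2 y (closure O)) :
    ContDiffOn ℝ 1 (bodyGrad O y) (closure O) :=
  hy.fderivWithin hu (by norm_num)

namespace IsEquilibrium

lemma contDiffOn_energy (h : IsEquilibrium W U O y) (hu : UniqueDiffOn ℝ (closure O))
    (hW : ContDiffOn ℝ 2 W U) : ContDiffOn ℝ 1 (fun x => W (bodyGrad O y x)) (closure O) :=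
  (hW.of_le (by norm_num)).comp (contDiffOn_bodyGrad hu h.contDiffOn) h.grad_mem

lemma contDiffOn_stress (h : IsEquilibrium W U O y) (hu : UniqueDiffOn ℝ (closure O))
    (hU : IsOpen U) (hW : ContDiffOn ℝ 2 W U) : ContDiffOn ℝ 1 (stress W O y) (closure O) :=
  (hW.fderiv_of_isOpen hU (m := 1) (by norm_num)).comp (contDiffOn_bodyGrad hu h.contDiffOn) h.grad_mem

lemma contDiffOn_dilationFlux (h : IsEquilibrium W U O y) (hu : UniqueDiffOn ℝ (closure O))
    (hU : IsOpen U) (hW : ContDiffOn ℝ 2 W U) (c : EuclideanSpace ℝ (Fin m)) :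
    ContDiffOn ℝ 1 (dilationFlux W O y c) (closure O) := by
  refine ((h.contDiffOn_energy hu hW).smul contDiffOn_id).sub
    (contDiffOn_transposeApply (h.contDiffOn_stress hu hU hW) ?_)
  exact ((contDiffOn_bodyGrad hu h.contDiffOn).clm_apply contDiffOn_id).sub
    ((h.contDiffOn.of_le (by norm_num)).sub contDiffOn_const)

lemma differentiableAt {F : Type*} [NormedAddCommGroup F] [NormedSpace ℝ F]
    {f : EuclideanSpace ℝ (Fin n) → F} (hf : ContDiffOn ℝ 1 f (closure O)) (hO : IsOpen O)
    (hx : x ∈ O) : DifferentiableAt ℝ f x :=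
  (hf.contDiffAt (mem_of_superset (hO.mem_nhds hx) subset_closure)).differentiableAt one_ne_zero

/-- The divergence of the work flux `Pᵀ u` is the virtual work density `P : ∇u`. -/
lemma divergence_work (h : IsEquilibrium W U O y) (hO : IsOpen O) (hu : UniqueDiffOn ℝ (closure O))
    (hU : IsOpen U) (hW : ContDiffOn ℝ 2 W U) (hx : x ∈ O)
    {u : EuclideanSpace ℝ (Fin n) → EuclideanSpace ℝ (Fin m)} (hud : DifferentiableAt ℝ u x) :
    divergence (fun x => transposeApply (stress W O y x) (u x)) x =
      stress W O y x (fderiv ℝ u x) :=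
  divergence_transposeApply (differentiableAt (h.contDiffOn_stress hu hU hW) hO hx) hud
    (h.div_eq_zero x hx)

lemma divergence_dilationFlux (h : IsEquilibrium W U O y) (hO : IsOpen O)
    (hu : UniqueDiffOn ℝ (closure O)) (hU : IsOpen U) (hW : ContDiffOn ℝ 2 W U) (hx : x ∈ O)
    (c : EuclideanSpace ℝ (Fin m)) :
    divergence (dilationFlux W O y c) x = n * W (bodyGrad O y x) := by
  have hF := contDiffOn_bodyGrad hu h.contDiffOn
  have hFd : DifferentiableAt ℝ (bodyGrad O y) x := differentiableAt hF hO hx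
  have hWd : DifferentiableAt ℝ (fun x => W (bodyGrad O y x)) x :=
    differentiableAt (h.contDiffOn_energy hu hW) hO hx
  have hSd : DifferentiableAt ℝ (stress W O y) x :=
    differentiableAt (h.contDiffOn_stress hu hU hW) hO hx
  have hy2 : ContDiffAt ℝ 2 y x :=
    h.contDiffOn.contDiffAt (mem_of_superset (hO.mem_nhds hx) subset_closure)
  have hyd : DifferentiableAt ℝ y x := hy2.differentiableAt two_ne_zero
  have hev : bodyGrad O y =ᶠ[𝓝 x] fderiv ℝ y := by
    filter_upwards [hO.mem_nhds hx] with x' hx' using bodyGrad_eq_fderiv hO hx'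
  have hsymm : ∀ v w, fderiv ℝ (bodyGrad O y) x v w = fderiv ℝ (bodyGrad O y) x w v := by
    intro v w
    rw [hev.fderiv_eq]
    exact (hy2.isSymmSndFDerivAt (by simp)).eq v w
  -- The two first order terms cancel, which leaves `v ↦ D²y(v, x)`; symmetry turns this into the
  -- derivative of `∇y` in the direction `x`, the very term produced by differentiating `W(∇y)`.
  have had : HasFDerivAt (fun x => bodyGrad O y x x - (y x - c)) (fderiv ℝ (bodyGrad O y) x x) x := by
    have h1 := (hFd.hasFDerivAt.clm_apply (hasFDerivAt_id x)).sub (hyd.hasFDerivAt.sub_const c)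
    refine h1.congr_fderiv (ContinuousLinearMap.ext fun v => ?_)
    simp [hsymm x v, bodyGrad_eq_fderiv hO hx]
  have hT : DifferentiableAt ℝ (fun x => transposeApply (stress W O y x)
      (bodyGrad O y x x - (y x - c))) x := by
    refine differentiableAt (O := O) (contDiffOn_transposeApply (h.contDiffOn_stress hu hU hW) ?_) hO hx
    exact (hF.clm_apply contDiffOn_id).sub
      ((h.contDiffOn.of_le (by norm_num)).sub contDiffOn_const)
  have hUW : DifferentiableAt ℝ W (bodyGrad O y x) :=
    (hW.contDiffAt (hU.mem_nhds (h.grad_mem x (subset_closure hx)))).differentiableAt two_ne_zero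
  have hWchain : fderiv ℝ (fun x => W (bodyGrad O y x)) x x =
      stress W O y x (fderiv ℝ (bodyGrad O y) x x) := by
    have h1 : HasFDerivAt (fun x => W (bodyGrad O y x)) _ x := hUW.hasFDerivAt.comp x hFd.hasFDerivAt
    rw [h1.fderiv]; rfl
  unfold dilationFlux
  rw [divergence_sub (V := fun x => W (bodyGrad O y x) • x) (hWd.smul differentiableAt_id) hT,
    divergence_smul (V := fun x => x) hWd differentiableAt_id, divergence_id,
    h.divergence_work hO hu hU hW hx had.differentiableAt, had.fderiv, hWchain]
  ring

end IsEquilibrium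

end Equilibrium

/-! ### Void flux and work of the tractions as cut-off boundary fluxes -/

section EnergyIdentity

variable {n m : ℕ} {W : (EuclideanSpace ℝ (Fin n) →L[ℝ] EuclideanSpace ℝ (Fin m)) → ℝ}
  {U : Set (EuclideanSpace ℝ (Fin n) →L[ℝ] EuclideanSpace ℝ (Fin m))}
  {O Ω ω : Set (EuclideanSpace ℝ (Fin n))} {ε : ℝ}
  {t y yε : EuclideanSpace ℝ (Fin n) → EuclideanSpace ℝ (Fin m)}
  {χ : EuclideanSpace ℝ (Fin n) → ℝ}

/-- Off the support of `χ` the product vanishes locally, so `V` has to be regular only where `s'` is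
a neighbourhood within `s`. This moves fields from the voided body to the exterior of the void or to
`Ω`. -/
lemma contDiffOn_smul_of_tsupport {E F : Type*} [NormedAddCommGroup E] [NormedSpace ℝ E]
    [NormedAddCommGroup F] [NormedSpace ℝ F] {χ : E → ℝ} {V : E → F} {s s' : Set E}
    (hχ : ContDiff ℝ 1 χ) (hV : ContDiffOn ℝ 1 V s')
    (h : ∀ x ∈ s, x ∈ tsupport χ → x ∈ s' ∧ s' ∈ 𝓝[s] x) :
    ContDiffOn ℝ 1 (fun x => χ x • V x) s := by
  intro x hx
  by_cases hxs : x ∈ tsupport χ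
  · obtain ⟨h1, h2⟩ := h x hx hxs
    exact hχ.contDiffAt.contDiffWithinAt.smul ((hV x h1).mono_of_mem_nhdsWithin h2)
  · have h0 : (fun x => χ x • V x) =ᶠ[𝓝 x] fun _ => 0 := by
      filter_upwards [notMem_tsupport_iff_eventuallyEq.1 hxs] with x' hx'
      rw [hx']; simp
    exact (contDiffAt_const.congr_of_eventuallyEq h0).contDiffWithinAt

lemma fderiv_eq_zero_of_notMem_tsupport {E F : Type*} [NormedAddCommGroup E] [NormedSpace ℝ E]
    [NormedAddCommGroup F] [NormedSpace ℝ F] {χ : E → F} {x : E} (hx : x ∉ tsupport χ) :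
    fderiv ℝ χ x = 0 :=
  fderiv_eq_zero_of_eqOn_compl (isClosed_tsupport χ)
    (fun _ h => image_eq_zero_of_notMem_tsupport h) hx

lemma divergence_eq_zero_of_notMem_tsupport {χ : EuclideanSpace ℝ (Fin n) → ℝ}
    {V : EuclideanSpace ℝ (Fin n) → EuclideanSpace ℝ (Fin n)} {x : EuclideanSpace ℝ (Fin n)}
    (hx : x ∉ tsupport χ) : divergence (fun x => χ x • V x) x = 0 := by
  have : fderiv ℝ (fun x => χ x • V x) x = 0 :=
    fderiv_eq_zero_of_notMem_tsupport fun h => hx (tsupport_smul_subset_left χ V h)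
  simp [divergence, this]

lemma integrableOn_of_continuousOn_closure {F : Type*} [NormedAddCommGroup F]
    {f : EuclideanSpace ℝ (Fin n) → F} (hO : Bornology.IsBounded O)
    (hf : ContinuousOn f (closure O)) : IntegrableOn f O :=
  (hf.integrableOn_compact hO.isCompact_closure).mono_set subset_closure

/-- Splitting of the energy of an equilibrium by means of a cutoff function. -/
lemma IsEquilibrium.integral_energy_eq (h : IsEquilibrium W U O y) (hO : IsOpen O)
    (hu : UniqueDiffOn ℝ (closure O)) (hb : Bornology.IsBounded O) (hU : IsOpen U)
    (hW : ContDiffOn ℝ 2 W U) (c : EuclideanSpace ℝ (Fin m)) (hχ : ContDiff ℝ 1 χ) :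
    n * ∫ x in O, W (bodyGrad O y x) =
      (∫ x in O, (n * (χ x * W (bodyGrad O y x)) + fderiv ℝ χ x (dilationFlux W O y c x))) +
      ∫ x in O, divergence (fun x => (1 - χ x) • dilationFlux W O y c x) x := by
  have hWc := (h.contDiffOn_energy hu hW).continuousOn
  have hVc := h.contDiffOn_dilationFlux hu hU hW c
  have hDχ : Continuous (fderiv ℝ χ) := hχ.continuous_fderiv one_ne_zero
  have h1 : IntegrableOn (fun x => n * (χ x * W (bodyGrad O y x)) +
      fderiv ℝ χ x (dilationFlux W O y c x)) O :=
    integrableOn_of_continuousOn_closure hb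
      ((continuousOn_const.mul (hχ.continuous.continuousOn.mul hWc)).add
        (hDχ.continuousOn.clm_apply hVc.continuousOn))
  have h2 : IntegrableOn (fun x => n * W (bodyGrad O y x)) O :=
    integrableOn_of_continuousOn_closure hb (continuousOn_const.mul hWc)
  have h3 : ∫ x in O, divergence (fun x => (1 - χ x) • dilationFlux W O y c x) x =
      ∫ x in O, (n * W (bodyGrad O y x) - (n * (χ x * W (bodyGrad O y x)) +
        fderiv ℝ χ x (dilationFlux W O y c x))) := by
    refine setIntegral_congr_fun hO.measurableSet fun x hx => ?_
    have hχd : DifferentiableAt ℝ χ x := hχ.differentiable one_ne_zero x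
    change divergence (fun x => (1 - χ x) • dilationFlux W O y c x) x = _
    rw [divergence_smul (hχd.const_sub 1) (differentiableAt hVc hO hx),
      h.divergence_dilationFlux hO hu hU hW hx, fderiv_const_sub]
    simp
    ring
  rw [h3, integral_sub h2 h1, integral_const_mul]
  ring

/-- A field of the form `Pᵀ u` has normal component `t · u` on the boundary. -/
lemma inner_stress (ν x : EuclideanSpace ℝ (Fin n)) (a : EuclideanSpace ℝ (Fin m)) :
    inner ℝ (transposeApply (stress W O y x) a) ν = inner ℝ (traction W (bodyGrad O y x) ν) a :=
  (inner_traction a W _ ν).symm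

lemma uniqueDiffOn_closure_voided (hΩ : IsC1Domain Ω) (hω : IsC1Domain ω) (hε : 0 < ε)
    (hsub : closure (ε • ω) ⊆ Ω) : UniqueDiffOn ℝ (closure (voided Ω ω ε)) :=
  uniqueDiffOn_closure (isOpen_voided hΩ.isOpen)
    (exists_isOutwardNormal_voided hΩ.isOpen hΩ.boundary hω.isOpen hω.boundary hε hsub)

/-- The divergence theorem on a bounded open set with `C¹` boundary. -/
lemma integral_divergence_of_isBounded (hO : IsOpen O)
    (hb : ∀ x ∈ frontier O, ∃ ν, IsOutwardNormal O x ν) (hbd : Bornology.IsBounded O)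
    {V : EuclideanSpace ℝ (Fin n) → EuclideanSpace ℝ (Fin n)} (hV : ContDiffOn ℝ 1 V (closure O)) :
    ∫ x in O, divergence V x =
      ∫ x in frontier O, inner ℝ (V x) (outwardNormal O x) ∂surfaceMeasure n := by
  have h1 := integral_divergence hO hb hbd.isCompact_closure
    (V := (closure O).indicator V) (fun x hx => indicator_of_notMem hx V)
    (hV.congr fun x hx => indicator_of_mem hx V)
  rw [setIntegral_congr_fun (g := fun x => inner ℝ (V x) (outwardNormal O x))
    isClosed_frontier.measurableSet
    (fun x hx => by simp only [indicator_of_mem (frontier_subset_closure hx)])] at h1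
  rw [← h1]
  refine setIntegral_congr_fun hO.measurableSet fun x hx => ?_
  have : (closure O).indicator V =ᶠ[𝓝 x] V := by
    filter_upwards [hO.mem_nhds hx] with x' hx' using indicator_of_mem (subset_closure hx') V
  simp only [divergence, this.fderiv_eq]

/-- For the intact body, the cut-off dilation flux has no inner boundary to cross. -/
lemma integral_divergence_smul_eq_zero (hO : IsOpen O)
    (hb : ∀ x ∈ frontier O, ∃ ν, IsOutwardNormal O x ν) (hbd : Bornology.IsBounded O)
    {V : EuclideanSpace ℝ (Fin n) → EuclideanSpace ℝ (Fin n)} (hV : ContDiffOn ℝ 1 V (closure O))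
    {ψ : EuclideanSpace ℝ (Fin n) → ℝ} (hψ : ContDiff ℝ 1 ψ) (hs : tsupport ψ ⊆ O) :
    ∫ x in O, divergence (fun x => ψ x • V x) x = 0 := by
  rw [integral_divergence_of_isBounded (V := fun x => ψ x • V x) hO hb hbd (hψ.contDiffOn.smul hV)]
  refine setIntegral_eq_zero_of_forall_eq_zero fun x hx => ?_
  rw [image_eq_zero_of_notMem_tsupport fun h => hx.2 (hO.interior_eq.symm ▸ hs h)]
  simp

lemma setIntegral_surfaceMeasure_smul (hε : 0 < ε) (s : Set (EuclideanSpace ℝ (Fin n)))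
    (g : EuclideanSpace ℝ (Fin n) → ℝ) :
    ∫ x in ε • s, g x ∂surfaceMeasure n =
      ε ^ (n - 1) * ∫ z in s, g (ε • z) ∂surfaceMeasure n := by
  have hemb : MeasurableEmbedding (fun x : EuclideanSpace ℝ (Fin n) => ε⁻¹ • x) :=
    (Homeomorph.smulOfNeZero ε⁻¹ (inv_ne_zero hε.ne')).measurableEmbedding
  have hmap : (surfaceMeasure n).map (fun x => ε⁻¹ • x) =
      ENNReal.ofReal (ε ^ (n - 1)) • surfaceMeasure n := by
    ext t ht
    rw [hemb.map_apply, preimage_smul_inv₀ hε.ne', surfaceMeasure,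
      Measure.euclideanHausdorffMeasure_smul₀ _ hε.ne', Measure.smul_apply,
      ENNReal.ofReal_pow hε.le]
    simp only [ENNReal.smul_def, smul_eq_mul, ENNReal.coe_pow]
    congr 2
    rw [← enorm_eq_nnnorm, Real.enorm_of_nonneg hε.le]
  have h1 := hemb.setIntegral_map (μ := surfaceMeasure n) (fun z => g (ε • z)) s
  rw [hmap, Measure.restrict_smul, integral_smul_measure, preimage_smul_inv₀ hε.ne'] at h1
  rw [ENNReal.toReal_ofReal (by positivity)] at h1
  simp only [smul_inv_smul₀ hε.ne'] at h1
  exact h1.symm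

/-- The flux of the dilation field out of the void. -/
lemma integral_divergence_dilationFlux_void (hU : IsOpen U) (hW : ContDiffOn ℝ 2 W U)
    (hΩ : IsC1Domain Ω) (hω : IsC1Domain ω) (hn : 0 < n) (hε : 0 < ε)
    (hsub : closure (ε • ω) ⊆ Ω) (h : SolvesVoided W U Ω ω ε t yε) (c : EuclideanSpace ℝ (Fin m))
    (hχ : ContDiff ℝ 1 χ) (hχ0 : ∀ x ∈ closure (ε • ω), χ x = 0)
    (hχ1 : tsupport (fun x => 1 - χ x) ⊆ Ω) :
    ∫ x in voided Ω ω ε,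
        divergence (fun x => (1 - χ x) • dilationFlux W (voided Ω ω ε) yε c x) x =
      -(ε ^ n * ∫ z in frontier ω, W (bodyGrad (voided Ω ω ε) yε (ε • z)) *
        inner ℝ (outwardNormal ω z) z ∂surfaceMeasure n) := by
  have hu := uniqueDiffOn_closure_voided hΩ hω hε hsub
  have hoε : IsOpen (ε • ω) := hω.isOpen.smul₀ hε.ne'
  have hbε := exists_isOutwardNormal_smul hω.boundary hε
  set V := dilationFlux W (voided Ω ω ε) yε c with hVdef
  have hV : ContDiffOn ℝ 1 V (closure (voided Ω ω ε)) :=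
    h.equilibrium.contDiffOn_dilationFlux hu hU hW c
  have hψ : ContDiff ℝ 1 (fun x => 1 - χ x) := contDiff_const.sub hχ
  have hK : IsCompact (tsupport fun x => 1 - χ x) :=
    Metric.isCompact_of_isClosed_isBounded (isClosed_tsupport _) (hΩ.isBounded.subset hχ1)
  have hVψ : ContDiffOn ℝ 1 (fun x => (1 - χ x) • V x) (closure (exterior (ε • ω))) := by
    refine contDiffOn_smul_of_tsupport hψ hV fun x hx hxt => ?_
    rw [closure_exterior_smul hω.isOpen hω.boundary hε] at hx ⊢
    have he := closure_voided_eventuallyEq_of_mem hΩ.isOpen hω.isOpen hω.boundary hε (hχ1 hxt)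
    refine ⟨(mem_closure_voided hΩ.isOpen hω.isOpen hω.boundary hε hsub).2
      ⟨subset_closure (hχ1 hxt), hx⟩, ?_⟩
    filter_upwards [nhdsWithin_le_nhds he, self_mem_nhdsWithin] with x' h1 h2
    exact (eq_iff_iff.1 h1).2 h2
  -- The field is supported inside `Ω`, so the theorem can be applied on the exterior of the void,
  -- where `∂Ω` does not appear and the outward normal is `-n`.
  have h1 := integral_divergence (isOpen_exterior (ε • ω))
    (exists_isOutwardNormal_exterior hoε hbε) hK
    (fun x hx => by rw [image_eq_zero_of_notMem_tsupport (f := fun x => 1 - χ x) hx, zero_smul]) hVψ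
  have h2 : ∫ x in exterior (ε • ω), divergence (fun x => (1 - χ x) • V x) x =
      ∫ x in voided Ω ω ε, divergence (fun x => (1 - χ x) • V x) x := by
    refine setIntegral_eq_of_subset_of_forall_sdiff_eq_zero (isOpen_exterior _).measurableSet
      (fun x hx => hx.2) fun x hx => ?_
    exact divergence_eq_zero_of_notMem_tsupport (χ := fun x => 1 - χ x)
      fun hxt => hx.2 ⟨hχ1 hxt, hx.1⟩
  -- Surface measure scales by `ε ^ (n - 1)` and the position vector by `ε`; together they give `ε ^
  -- n` because `n > 0`.
  rw [← h2, h1, frontier_exterior hoε hbε, frontier_smul_set ω hε,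
    setIntegral_surfaceMeasure_smul hε, ← mul_neg_one, mul_assoc, ← integral_mul_const,
    ← pow_sub_one_mul hn.ne' ε, mul_assoc, ← integral_const_mul ε]
  refine congrArg (ε ^ (n - 1) * ·)
    (setIntegral_congr_fun isClosed_frontier.measurableSet fun z hz => ?_)
  have hxf : ε • z ∈ frontier (ε • ω) := by
    rw [frontier_smul_set ω hε]; exact smul_mem_smul_set hz
  have hfree := h.free _ hxf
  simp only [hχ0 _ hxf.1, outwardNormal_exterior hoε hbε hxf,
    outwardNormal_smul hω.isOpen hω.boundary hz hε, sub_zero, one_smul, hVdef, dilationFlux,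
    inner_neg_right, inner_sub_left, inner_stress]
  rw [outwardNormal_smul hω.isOpen hω.boundary hz hε] at hfree
  rw [hfree, inner_zero_left, smul_smul, real_inner_smul_left, real_inner_comm]
  ring

/-- The work of the tractions on the displacement `yε - y`. -/
lemma integral_traction_work (hU : IsOpen U) (hW : ContDiffOn ℝ 2 W U)
    (hΩ : IsC1Domain Ω) (hω : IsC1Domain ω) (hε : 0 < ε)
    (hsub : closure (ε • ω) ⊆ Ω) (h : SolvesVoided W U Ω ω ε t yε)
    (hy : ContDiffOn ℝ 2 y (closure Ω)) (hχ : ContDiff ℝ 1 χ)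
    (hχ0 : Disjoint (tsupport χ) (closure (ε • ω))) (hχ1 : tsupport (fun x => 1 - χ x) ⊆ Ω) :
    ∫ x in frontier Ω, inner ℝ (t x) (yε x - y x) ∂surfaceMeasure n =
      ∫ x in voided Ω ω ε, (fderiv ℝ χ x
        (transposeApply (stress W (voided Ω ω ε) yε x) (yε x - y x)) +
        χ x * stress W (voided Ω ω ε) yε x
          (bodyGrad (voided Ω ω ε) yε x - bodyGrad Ω y x)) := by
  have hu := uniqueDiffOn_closure_voided hΩ hω hε hsub
  have hmem : ∀ x ∈ closure Ω, x ∈ tsupport χ →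
      x ∈ closure (voided Ω ω ε) ∧ closure (voided Ω ω ε) ∈ 𝓝[closure Ω] x := by
    intro x hx hxt
    have hxn : x ∉ closure (ε • ω) := fun hc => disjoint_left.1 hχ0 hxt hc
    have he := (voided_eventuallyEq_of_notMem (Ω := Ω) hxn).closure_set
    refine ⟨(mem_closure_voided hΩ.isOpen hω.isOpen hω.boundary hε hsub).2
      ⟨hx, fun hc => hxn (subset_closure hc)⟩, ?_⟩
    filter_upwards [nhdsWithin_le_nhds he, self_mem_nhdsWithin] with x' h1 h2
    exact (eq_iff_iff.1 h1).2 h2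
  set V : EuclideanSpace ℝ (Fin n) → EuclideanSpace ℝ (Fin n) := fun x =>
    transposeApply (stress W (voided Ω ω ε) yε x) (yε x - y x) with hVdef
  have hsubset : closure (voided Ω ω ε) ⊆ closure Ω := closure_mono sdiff_subset
  have hud : ContDiffOn ℝ 1 (fun x => yε x - y x) (closure (voided Ω ω ε)) :=
    (h.equilibrium.contDiffOn.of_le (by norm_num)).sub ((hy.of_le (by norm_num)).mono hsubset)
  have hV : ContDiffOn ℝ 1 V (closure (voided Ω ω ε)) :=
    contDiffOn_transposeApply (h.equilibrium.contDiffOn_stress hu hU hW) hud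
  -- As `χ` vanishes near the void, the product extends by zero to all of `Ω`, and only `∂Ω`
  -- contributes. There `χ = 1` and `Pε n = t`.
  have h1 := integral_divergence_of_isBounded hΩ.isOpen hΩ.boundary hΩ.isBounded
    (contDiffOn_smul_of_tsupport hχ hV hmem)
  have h2 : ∫ x in Ω, divergence (fun x => χ x • V x) x =
      ∫ x in voided Ω ω ε, divergence (fun x => χ x • V x) x := by
    refine setIntegral_eq_of_subset_of_forall_sdiff_eq_zero hΩ.isOpen.measurableSet
      sdiff_subset fun x hx => divergence_eq_zero_of_notMem_tsupport fun hxt =>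
        disjoint_left.1 hχ0 hxt ?_
    by_contra hc
    exact hx.2 ⟨hx.1, hc⟩
  have hopen : IsOpen (voided Ω ω ε) := isOpen_voided hΩ.isOpen
  have h3 : ∫ x in frontier Ω, inner ℝ (t x) (yε x - y x) ∂surfaceMeasure n =
      ∫ x in frontier Ω, inner ℝ (χ x • V x) (outwardNormal Ω x) ∂surfaceMeasure n := by
    refine setIntegral_congr_fun isClosed_frontier.measurableSet fun x hx => ?_
    have hx1 : 1 - χ x = 0 := image_eq_zero_of_notMem_tsupport (f := fun x => 1 - χ x)
      fun hc => hx.2 (hΩ.isOpen.interior_eq.symm ▸ hχ1 hc)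
    have hx2 : χ x = 1 := by linarith
    simp only [hx2, one_smul, hVdef, inner_stress, h.loaded x hx]
  rw [h3, ← h1, h2]
  refine setIntegral_congr_fun hopen.measurableSet fun x hx => ?_
  have hyd : DifferentiableAt ℝ y x :=
    IsEquilibrium.differentiableAt (hy.of_le (by norm_num)) hΩ.isOpen hx.1
  have hyεd : DifferentiableAt ℝ yε x :=
    IsEquilibrium.differentiableAt (h.equilibrium.contDiffOn.of_le (by norm_num)) hopen hx
  have hVd : DifferentiableAt ℝ V x := IsEquilibrium.differentiableAt hV hopen hx
  have hdV : divergence V x = stress W (voided Ω ω ε) yε x (fderiv ℝ (fun x => yε x - y x) x) :=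
    h.equilibrium.divergence_work hopen hu hU hW hx (hyεd.sub hyd)
  change divergence (fun x => χ x • V x) x = _
  rw [divergence_smul (hχ.differentiable one_ne_zero x) hVd, hdV, fderiv_fun_sub hyεd hyd,
    bodyGrad_eq_fderiv hopen hx, bodyGrad_eq_fderiv hΩ.isOpen hx.1]

end EnergyIdentity

/-! ### The exact localized identity for the energy difference -/

section EnergyDifference

variable {n m : ℕ} {W : (EuclideanSpace ℝ (Fin n) →L[ℝ] EuclideanSpace ℝ (Fin m)) → ℝ}
  {U : Set (EuclideanSpace ℝ (Fin n) →L[ℝ] EuclideanSpace ℝ (Fin m))}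
  {O Ω ω : Set (EuclideanSpace ℝ (Fin n))} {ε : ℝ}
  {t y yε : EuclideanSpace ℝ (Fin n) → EuclideanSpace ℝ (Fin m)}
  {χ : EuclideanSpace ℝ (Fin n) → ℝ}

lemma continuousOn_transposeApply {s : Set (EuclideanSpace ℝ (Fin n))}
    {A : EuclideanSpace ℝ (Fin n) → (EuclideanSpace ℝ (Fin n) →L[ℝ] EuclideanSpace ℝ (Fin m)) →L[ℝ] ℝ}
    {a : EuclideanSpace ℝ (Fin n) → EuclideanSpace ℝ (Fin m)} (hA : ContinuousOn A s)
    (ha : ContinuousOn a s) : ContinuousOn (fun x => transposeApply (A x) (a x)) s :=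
  contDiffOn_zero.1 (contDiffOn_transposeApply (contDiffOn_zero.2 hA) (contDiffOn_zero.2 ha))

/-- No regularity of `t` is assumed, but on `∂Ω` it equals the traction of the intact solution and
is thus continuous. -/
lemma SolvesIntact.integrableOn_traction_work (h : SolvesIntact W U Ω t y) (hU : IsOpen U)
    (hW : ContDiffOn ℝ 2 W U) (hΩ : IsC1Domain Ω)
    {v : EuclideanSpace ℝ (Fin n) → EuclideanSpace ℝ (Fin m)} (hv : ContinuousOn v (frontier Ω)) :
    IntegrableOn (fun x => inner ℝ (t x) (v x)) (frontier Ω) (surfaceMeasure n) := by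
  have hu := uniqueDiffOn_closure hΩ.isOpen hΩ.boundary
  refine integrableOn_frontier_of_compact hΩ.isBounded.isCompact_closure
    (surfaceMeasure_frontier_inter_lt_top hΩ.isOpen hΩ.boundary hΩ.isBounded.isCompact_closure) ?_
    fun x hx hxc => absurd hx.1 hxc
  have h1 : ContinuousOn (fun x => inner ℝ (transposeApply (stress W Ω y x) (v x))
      (outwardNormal Ω x)) (frontier Ω) :=
    (continuousOn_transposeApply ((h.equilibrium.contDiffOn_stress hu hU hW).continuousOn.mono
      frontier_subset_closure) hv).inner (continuousOn_outwardNormal hΩ.isOpen hΩ.boundary)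
  refine h1.congr fun x hx => ?_
  simp only [inner_stress, h.loaded x hx]

lemma frontier_subset_closure_voided (hΩ : IsC1Domain Ω) (hω : IsC1Domain ω) (hε : 0 < ε)
    (hsub : closure (ε • ω) ⊆ Ω) : frontier Ω ⊆ closure (voided Ω ω ε) := fun _ hx =>
  (mem_closure_voided hΩ.isOpen hω.isOpen hω.boundary hε hsub).2
    ⟨hx.1, fun hc => hx.2 (hΩ.isOpen.interior_eq.symm ▸ hsub (subset_closure hc))⟩

/-- The energy difference as the flux out of the void plus a volume integral of terms of second
order, localized away from the void by the cutoff `χ`. -/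
lemma energy_difference (hU : IsOpen U) (hW : ContDiffOn ℝ 2 W U)
    (hΩ : IsC1Domain Ω) (hω : IsC1Domain ω) (hn : 0 < n) (hε : 0 < ε)
    (hsub : closure (ε • ω) ⊆ Ω) (hy : SolvesIntact W U Ω t y)
    (h : SolvesVoided W U Ω ω ε t yε) (c : EuclideanSpace ℝ (Fin m)) (hχ : ContDiff ℝ 1 χ)
    (hχ0 : Disjoint (tsupport χ) (closure (ε • ω))) (hχ1 : tsupport (fun x => 1 - χ x) ⊆ Ω) :
    n * (potentialEnergy W (voided Ω ω ε) (frontier Ω) t yε -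
        potentialEnergy W Ω (frontier Ω) t y) +
      ε ^ n * ∫ z in frontier ω, W (bodyGrad (voided Ω ω ε) yε (ε • z)) *
        inner ℝ (outwardNormal ω z) z ∂surfaceMeasure n =
    ∫ x in voided Ω ω ε,
      (n * (χ x * (W (bodyGrad (voided Ω ω ε) yε x) - W (bodyGrad Ω y x) -
          stress W (voided Ω ω ε) yε x (bodyGrad (voided Ω ω ε) yε x - bodyGrad Ω y x))) +
        fderiv ℝ χ x (dilationFlux W (voided Ω ω ε) yε c x - dilationFlux W Ω y c x -
          (n : ℝ) • transposeApply (stress W (voided Ω ω ε) yε x) (yε x - y x))) := by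
  have hu := uniqueDiffOn_closure_voided hΩ hω hε hsub
  have huΩ := uniqueDiffOn_closure hΩ.isOpen hΩ.boundary
  have hopen : IsOpen (voided Ω ω ε) := isOpen_voided hΩ.isOpen
  have hbd : Bornology.IsBounded (voided Ω ω ε) := hΩ.isBounded.subset sdiff_subset
  have hsubset : closure (voided Ω ω ε) ⊆ closure Ω := closure_mono sdiff_subset
  have hfs := frontier_subset_closure_voided hΩ hω hε hsub
  have hDχ : Continuous (fderiv ℝ χ) := hχ.continuous_fderiv one_ne_zero
  have hFε := (contDiffOn_bodyGrad hu h.equilibrium.contDiffOn).continuousOn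
  have hF := (contDiffOn_bodyGrad huΩ hy.equilibrium.contDiffOn).continuousOn.mono hsubset
  have hWε := (h.equilibrium.contDiffOn_energy hu hW).continuousOn
  have hWF := (hy.equilibrium.contDiffOn_energy huΩ hW).continuousOn.mono hsubset
  have hVε := (h.equilibrium.contDiffOn_dilationFlux hu hU hW c).continuousOn
  have hV := (hy.equilibrium.contDiffOn_dilationFlux huΩ hU hW c).continuousOn.mono hsubset
  have hS := (h.equilibrium.contDiffOn_stress hu hU hW).continuousOn
  have hyc := hy.equilibrium.contDiffOn.continuousOn
  have hyεc := h.equilibrium.contDiffOn.continuousOn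
  have hχc : ContinuousOn χ (closure (voided Ω ω ε)) := hχ.continuous.continuousOn
  have e1 := h.equilibrium.integral_energy_eq hopen hu hbd hU hW c hχ
  have e2 := hy.equilibrium.integral_energy_eq hΩ.isOpen huΩ hΩ.isBounded hU hW c hχ
  rw [integral_divergence_dilationFlux_void hU hW hΩ hω hn hε hsub h c hχ
    (fun x hx => image_eq_zero_of_notMem_tsupport fun hc => disjoint_left.1 hχ0 hc hx) hχ1] at e1
  rw [integral_divergence_smul_eq_zero (ψ := fun x => 1 - χ x) hΩ.isOpen hΩ.boundary hΩ.isBounded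
    (hy.equilibrium.contDiffOn_dilationFlux huΩ hU hW c) (contDiff_const.sub hχ) hχ1] at e2
  have e3 := integral_traction_work hU hW hΩ hω hε hsub h hy.equilibrium.contDiffOn hχ hχ0 hχ1
  have e4 : ∫ x in frontier Ω, inner ℝ (t x) (yε x - y x) ∂surfaceMeasure n =
      (∫ x in frontier Ω, inner ℝ (t x) (yε x) ∂surfaceMeasure n) -
        ∫ x in frontier Ω, inner ℝ (t x) (y x) ∂surfaceMeasure n := by
    simp only [inner_sub_right]
    exact integral_sub (hy.integrableOn_traction_work hU hW hΩ (hyεc.mono hfs))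
      (hy.integrableOn_traction_work hU hW hΩ (hyc.mono frontier_subset_closure))
  have e5 : ∫ x in Ω, (n * (χ x * W (bodyGrad Ω y x)) + fderiv ℝ χ x (dilationFlux W Ω y c x)) =
      ∫ x in voided Ω ω ε,
        (n * (χ x * W (bodyGrad Ω y x)) + fderiv ℝ χ x (dilationFlux W Ω y c x)) := by
    refine setIntegral_eq_of_subset_of_forall_sdiff_eq_zero hΩ.isOpen.measurableSet
      sdiff_subset fun x hx => ?_
    have hxt : x ∉ tsupport χ := by
      intro hxt
      refine disjoint_left.1 hχ0 hxt ?_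
      by_contra hc
      exact hx.2 ⟨hx.1, hc⟩
    rw [image_eq_zero_of_notMem_tsupport hxt, fderiv_eq_zero_of_notMem_tsupport hxt]
    simp
  have i1 : IntegrableOn (fun x => n * (χ x * W (bodyGrad (voided Ω ω ε) yε x)) +
      fderiv ℝ χ x (dilationFlux W (voided Ω ω ε) yε c x)) (voided Ω ω ε) :=
    integrableOn_of_continuousOn_closure hbd ((continuousOn_const.mul (hχc.mul hWε)).add
      (hDχ.continuousOn.clm_apply hVε))
  have i2 : IntegrableOn (fun x => n * (χ x * W (bodyGrad Ω y x)) +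
      fderiv ℝ χ x (dilationFlux W Ω y c x)) (voided Ω ω ε) :=
    integrableOn_of_continuousOn_closure hbd ((continuousOn_const.mul (hχc.mul hWF)).add
      (hDχ.continuousOn.clm_apply hV))
  have i3 : IntegrableOn (fun x => fderiv ℝ χ x
        (transposeApply (stress W (voided Ω ω ε) yε x) (yε x - y x)) +
        χ x * stress W (voided Ω ω ε) yε x
          (bodyGrad (voided Ω ω ε) yε x - bodyGrad Ω y x)) (voided Ω ω ε) :=
    integrableOn_of_continuousOn_closure hbd
      ((hDχ.continuousOn.clm_apply (continuousOn_transposeApply hS (hyεc.sub (hyc.mono hsubset)))).add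
        (hχc.mul (hS.clm_apply (hFε.sub hF))))
  -- The work terms are distributed: `Pε:(Fε - F)` completes the Taylor remainder of `W`, and
  -- `Pεᵀ(yε - y)` joins the fluxes multiplied by `∇χ`.
  have e6 : ∫ x in voided Ω ω ε,
      (n * (χ x * (W (bodyGrad (voided Ω ω ε) yε x) - W (bodyGrad Ω y x) -
          stress W (voided Ω ω ε) yε x (bodyGrad (voided Ω ω ε) yε x - bodyGrad Ω y x))) +
        fderiv ℝ χ x (dilationFlux W (voided Ω ω ε) yε c x - dilationFlux W Ω y c x -
          (n : ℝ) • transposeApply (stress W (voided Ω ω ε) yε x) (yε x - y x))) =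
      ∫ x in voided Ω ω ε, ((n * (χ x * W (bodyGrad (voided Ω ω ε) yε x)) +
        fderiv ℝ χ x (dilationFlux W (voided Ω ω ε) yε c x)) -
        (n * (χ x * W (bodyGrad Ω y x)) + fderiv ℝ χ x (dilationFlux W Ω y c x)) -
        n * (fderiv ℝ χ x (transposeApply (stress W (voided Ω ω ε) yε x) (yε x - y x)) +
        χ x * stress W (voided Ω ω ε) yε x
          (bodyGrad (voided Ω ω ε) yε x - bodyGrad Ω y x))) := by
    refine integral_congr_ae (Eventually.of_forall fun x => ?_)
    simp only [map_sub, map_smul, smul_eq_mul]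
    ring
  have e7 : ∀ {f g k : EuclideanSpace ℝ (Fin n) → ℝ}, IntegrableOn f (voided Ω ω ε) →
      IntegrableOn g (voided Ω ω ε) → IntegrableOn k (voided Ω ω ε) →
      ∫ x in voided Ω ω ε, (f x - g x - n * k x) = (∫ x in voided Ω ω ε, f x) -
        (∫ x in voided Ω ω ε, g x) - n * ∫ x in voided Ω ω ε, k x := by
    intro f g k hf hg hk
    have h1 : Integrable (fun x => f x - g x) (volume.restrict (voided Ω ω ε)) := hf.sub hg
    rw [integral_sub h1 (hk.const_mul _), integral_sub hf hg, integral_const_mul]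
  rw [e6, e7 i1 i2 i3, ← e3, e4, ← e5, potentialEnergy, potentialEnergy]
  linear_combination e1 - e2

end EnergyDifference

/-! ### Radial cutoffs and the exact cancellation of the leading flux -/

section Cutoff

variable {n m : ℕ} {l : ℝ}

/-- A smooth step from `0` on `(-∞, l²]` to `1` on `[4 l², ∞)`. -/
def cutoffProfile (l r : ℝ) : ℝ := Real.smoothTransition ((r / l ^ 2 - 1) / 3)

/-- A radial cutoff, `0` on the ball of radius `l` and `1` off the ball of radius `2 l`. -/
def cutoff (l : ℝ) (x : EuclideanSpace ℝ (Fin n)) : ℝ := cutoffProfile l (‖x‖ ^ 2)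

/-- The radial factor of the gradient of `cutoff`. -/
def cutoffSlope (l : ℝ) (x : EuclideanSpace ℝ (Fin n)) : ℝ := 2 * deriv (cutoffProfile l) (‖x‖ ^ 2)

lemma contDiff_cutoffProfile {k : ℕ∞} (l : ℝ) : ContDiff ℝ k (cutoffProfile l) := by
  unfold cutoffProfile
  exact Real.smoothTransition.contDiff.comp (by fun_prop)

lemma contDiff_cutoff (l : ℝ) : ContDiff ℝ 1 (cutoff l : EuclideanSpace ℝ (Fin n) → ℝ) :=
  (contDiff_cutoffProfile (k := 1) l).comp (contDiff_norm_sq ℝ)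

lemma contDiff_deriv_cutoffProfile (l : ℝ) : ContDiff ℝ 1 (deriv (cutoffProfile l)) := by
  have h : ContDiff ℝ (1 + 1) (cutoffProfile l) := by
    have := contDiff_cutoffProfile (k := 2) l
    exact this.of_le (by norm_num)
  exact (contDiff_succ_iff_deriv.1 h).2.2

lemma contDiff_cutoffSlope (l : ℝ) :
    ContDiff ℝ 1 (cutoffSlope l : EuclideanSpace ℝ (Fin n) → ℝ) :=
  contDiff_const.mul ((contDiff_deriv_cutoffProfile l).comp (contDiff_norm_sq ℝ))

lemma hasFDerivAt_radial {g : ℝ → ℝ} (x : EuclideanSpace ℝ (Fin n))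
    (hg : DifferentiableAt ℝ g (‖x‖ ^ 2)) :
    HasFDerivAt (fun x : EuclideanSpace ℝ (Fin n) => g (‖x‖ ^ 2))
      ((2 * deriv g (‖x‖ ^ 2)) • innerSL ℝ x) x := by
  have h1 := hg.hasDerivAt.comp_hasFDerivAt x (hasStrictFDerivAt_norm_sq x).hasFDerivAt
  refine h1.congr_fderiv (ContinuousLinearMap.ext fun v => ?_)
  simp
  ring

lemma fderiv_cutoff (l : ℝ) (x v : EuclideanSpace ℝ (Fin n)) :
    fderiv ℝ (cutoff l) x v = cutoffSlope l x * inner ℝ x v := by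
  have h : HasFDerivAt (cutoff l) _ x := hasFDerivAt_radial x
    (((contDiff_cutoffProfile (k := 1) l).differentiable one_ne_zero) _)
  rw [h.fderiv]
  simp [cutoffSlope]

lemma cutoff_nonneg (l : ℝ) (x : EuclideanSpace ℝ (Fin n)) : 0 ≤ cutoff l x :=
  Real.smoothTransition.nonneg _

lemma cutoff_le_one (l : ℝ) (x : EuclideanSpace ℝ (Fin n)) : cutoff l x ≤ 1 :=
  Real.smoothTransition.le_one _

lemma cutoffProfile_eq_zero (hl : 0 < l) {r : ℝ} (hr : r ≤ l ^ 2) : cutoffProfile l r = 0 := by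
  refine Real.smoothTransition.zero_of_nonpos ?_
  have : r / l ^ 2 ≤ 1 := by rw [div_le_one (by positivity)]; exact hr
  linarith

lemma cutoffProfile_eq_one (hl : 0 < l) {r : ℝ} (hr : (2 * l) ^ 2 ≤ r) : cutoffProfile l r = 1 := by
  refine Real.smoothTransition.one_of_one_le ?_
  have : 4 ≤ r / l ^ 2 := by rw [le_div_iff₀ (by positivity)]; linarith
  linarith

lemma tsupport_cutoff_subset (hl : 0 < l) :
    tsupport (cutoff l : EuclideanSpace ℝ (Fin n) → ℝ) ⊆ {x | l ≤ ‖x‖} := by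
  refine closure_minimal (fun x hx => ?_) (isClosed_le continuous_const continuous_norm)
  by_contra hc
  exact hx (cutoffProfile_eq_zero hl (by gcongr; exact (not_le.1 hc).le))

lemma tsupport_one_sub_cutoff_subset (hl : 0 < l) :
    tsupport (fun x : EuclideanSpace ℝ (Fin n) => 1 - cutoff l x) ⊆ {x | ‖x‖ ≤ 2 * l} := by
  refine closure_minimal (fun x hx => ?_) (isClosed_le continuous_norm continuous_const)
  by_contra hc
  have h : cutoff l x = 1 := cutoffProfile_eq_one hl (by gcongr; exact (not_le.1 hc).le)
  exact hx (by simp only [h, sub_self])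

lemma tsupport_cutoffSlope_subset (hl : 0 < l) :
    tsupport (cutoffSlope l : EuclideanSpace ℝ (Fin n) → ℝ) ⊆ {x | l ≤ ‖x‖ ∧ ‖x‖ ≤ 2 * l} := by
  refine closure_minimal (fun x hx => ?_)
    ((isClosed_le continuous_const continuous_norm).inter
      (isClosed_le continuous_norm continuous_const))
  by_contra hc
  rw [mem_ofPred_eq, not_and_or, not_le, not_le] at hc
  apply hx
  suffices deriv (cutoffProfile l) (‖x‖ ^ 2) = 0 by simp [cutoffSlope, this]
  rcases hc with hc | hc
  · have : cutoffProfile l =ᶠ[𝓝 (‖x‖ ^ 2)] fun _ => 0 := by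
      filter_upwards [Iio_mem_nhds (show ‖x‖ ^ 2 < l ^ 2 by gcongr)] with r hr
      exact cutoffProfile_eq_zero hl (le_of_lt hr)
    rw [this.deriv_eq]; simp
  · have : cutoffProfile l =ᶠ[𝓝 (‖x‖ ^ 2)] fun _ => 1 := by
      filter_upwards [Ioi_mem_nhds (show (2 * l) ^ 2 < ‖x‖ ^ 2 by gcongr)] with r hr
      exact cutoffProfile_eq_one hl (le_of_lt hr)
    rw [this.deriv_eq]; simp

/-- The profile is one fixed step in the variable `‖x‖² / l²`, so a single constant serves all `l`.
-/
lemma exists_cutoffSlope_bound :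
    ∃ C : ℝ, 0 < C ∧ ∀ l : ℝ, 0 < l → ∀ x : EuclideanSpace ℝ (Fin n),
      |cutoffSlope l x| ≤ C / l ^ 2 := by
  have hd : ContDiff ℝ 1 Real.smoothTransition := Real.smoothTransition.contDiff
  have hc : Continuous (deriv Real.smoothTransition) := hd.continuous_deriv le_rfl
  obtain ⟨M, hM⟩ := (isCompact_Icc (a := (0 : ℝ)) (b := 1)).exists_bound_of_continuousOn
    hc.continuousOn
  have hM' : ∀ s, |deriv Real.smoothTransition s| ≤ |M| := by
    intro s
    by_cases hs : s ∈ Icc (0 : ℝ) 1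
    · exact (hM s hs).trans (le_abs_self M)
    · rw [mem_Icc, not_and_or, not_le, not_le] at hs
      have : deriv Real.smoothTransition s = 0 := by
        rcases hs with hs | hs
        · have : Real.smoothTransition =ᶠ[𝓝 s] fun _ => 0 := by
            filter_upwards [Iio_mem_nhds hs] with r hr
            exact Real.smoothTransition.zero_of_nonpos (le_of_lt hr)
          rw [this.deriv_eq]; simp
        · have : Real.smoothTransition =ᶠ[𝓝 s] fun _ => 1 := by
            filter_upwards [Ioi_mem_nhds hs] with r hr
            exact Real.smoothTransition.one_of_one_le (le_of_lt hr)
          rw [this.deriv_eq]; simp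
      rw [this]; simp
  refine ⟨|M| + 1, by positivity, fun l hl x => ?_⟩
  have h1 : HasDerivAt (cutoffProfile l)
      (deriv Real.smoothTransition ((‖x‖ ^ 2 / l ^ 2 - 1) / 3) * (1 / l ^ 2 / 3)) (‖x‖ ^ 2) :=
    HasDerivAt.comp (h₂ := Real.smoothTransition) (‖x‖ ^ 2)
      (hd.differentiable one_ne_zero _).hasDerivAt
      ((((hasDerivAt_id (‖x‖ ^ 2)).div_const (l ^ 2)).sub_const 1).div_const 3)
  rw [cutoffSlope, h1.deriv, abs_mul, abs_mul, abs_two, abs_of_nonneg (by positivity : 0 ≤ 1 / l ^ 2 / 3)]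
  have h2 := hM' ((‖x‖ ^ 2 / l ^ 2 - 1) / 3)
  calc 2 * (|deriv Real.smoothTransition ((‖x‖ ^ 2 / l ^ 2 - 1) / 3)| * (1 / l ^ 2 / 3))
      ≤ 2 * (|M| * (1 / l ^ 2 / 3)) := by gcongr
    _ = (2 / 3 * |M|) / l ^ 2 := by ring
    _ ≤ (|M| + 1) / l ^ 2 := by
      gcongr
      linarith [abs_nonneg M]

/-- The leading part of the flux difference is orthogonal to radial gradients. -/
lemma integral_fderiv_cutoff_eq_zero {O : Set (EuclideanSpace ℝ (Fin n))} (hO : IsOpen O)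
    (hl : 0 < l) (hann : {x : EuclideanSpace ℝ (Fin n) | l ≤ ‖x‖ ∧ ‖x‖ ≤ 2 * l} ⊆ O)
    {u : EuclideanSpace ℝ (Fin n) → EuclideanSpace ℝ (Fin m)} (hu : ContDiffOn ℝ 1 u O)
    (A : (EuclideanSpace ℝ (Fin n) →L[ℝ] EuclideanSpace ℝ (Fin m)) →L[ℝ] ℝ) :
    ∫ x in O, fderiv ℝ (cutoff l) x (A (fderiv ℝ u x) • x -
      transposeApply A (fderiv ℝ u x x + ((n : ℝ) - 1) • u x)) = 0 := by
  set b : EuclideanSpace ℝ (Fin n) → EuclideanSpace ℝ (Fin n) :=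
    fun x => transposeApply A (u x) with hbdef
  -- `R` is `‖x‖²` times the tangential part of `b = Aᵀu`. Being orthogonal to `x`, it is not
  -- affected by derivatives of a radial factor `s`, so `div (s R) = s div R`; and `s div R` is
  -- exactly the integrand. The coefficient of `⟪b, x⟫` in `div R` is `2 - 1 - n = -(n - 1)`.
  set R : EuclideanSpace ℝ (Fin n) → EuclideanSpace ℝ (Fin n) :=
    fun x => ‖x‖ ^ 2 • b x - inner ℝ (b x) x • x with hRdef
  have hb : ContDiffOn ℝ 1 b O := contDiffOn_transposeApply contDiffOn_const hu
  have hR : ContDiffOn ℝ 1 R O :=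
    ((contDiff_norm_sq ℝ).contDiffOn.smul hb).sub ((hb.inner ℝ contDiffOn_id).smul contDiffOn_id)
  have hts := tsupport_cutoffSlope_subset (n := n) hl
  have hcd : ContDiffOn ℝ 1 (fun x => cutoffSlope l x • R x) (closure univ) :=
    contDiffOn_smul_of_tsupport (contDiff_cutoffSlope l) hR fun x _ hx =>
      ⟨hann (hts hx), mem_nhdsWithin_of_mem_nhds (hO.mem_nhds (hann (hts hx)))⟩
  -- The cut-off field has compact support and the whole space has no boundary.
  have h1 := integral_divergence (O := univ) isOpen_univ (by simp)
    (isCompact_closedBall (0 : EuclideanSpace ℝ (Fin n)) (2 * l)) (fun x hx => by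
      have : cutoffSlope l x = 0 := image_eq_zero_of_notMem_tsupport fun hc =>
        hx (by simpa using (hts hc).2)
      simp [this]) hcd
  rw [frontier_univ, Measure.restrict_empty, integral_zero_measure,
    setIntegral_eq_of_subset_of_forall_sdiff_eq_zero MeasurableSet.univ (subset_univ O)
      (fun x hx => divergence_eq_zero_of_notMem_tsupport fun hc => hx.2 (hann (hts hc)))] at h1
  rw [← h1]
  refine setIntegral_congr_fun hO.measurableSet fun x hx => ?_
  have hnx : O ∈ 𝓝 x := hO.mem_nhds hx
  have hud : DifferentiableAt ℝ u x := (hu.contDiffAt hnx).differentiableAt one_ne_zero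
  have hbd : DifferentiableAt ℝ b x := (hb.contDiffAt hnx).differentiableAt one_ne_zero
  have hsd : DifferentiableAt ℝ (cutoffSlope l) x :=
    (contDiff_cutoffSlope l).differentiable one_ne_zero x
  have hRd : DifferentiableAt ℝ R x := (hR.contDiffAt hnx).differentiableAt one_ne_zero
  have hperp : inner ℝ x (R x) = 0 := by
    simp only [hRdef, inner_sub_right, real_inner_smul_right, real_inner_self_eq_norm_sq,
      real_inner_comm x (b x)]
    ring
  have hds : fderiv ℝ (cutoffSlope l) x (R x) = 0 := by
    have h : HasFDerivAt (fun x : EuclideanSpace ℝ (Fin n) => deriv (cutoffProfile l) (‖x‖ ^ 2)) _ x :=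
      hasFDerivAt_radial x ((contDiff_deriv_cutoffProfile l).differentiable one_ne_zero _)
    have h' : HasFDerivAt (cutoffSlope l) _ x := h.const_mul 2
    rw [h'.fderiv]
    simp [hperp]
  have hbv : ∀ v, fderiv ℝ b x v = transposeApply A (fderiv ℝ u x v) := by
    intro v
    have hlin : IsLinearMap ℝ (transposeApply A) :=
      ⟨transposeApply_add_right A, fun c a => transposeApply_smul_right A a c⟩
    have h : HasFDerivAt b _ x :=
      (LinearMap.toContinuousLinearMap hlin.mk').hasFDerivAt.comp x hud.hasFDerivAt
    rw [h.fderiv]; rfl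
  have hdb : divergence b x = A (fderiv ℝ u x) :=
    divergence_transposeApply (A := fun _ => A) (differentiableAt_const A) hud (by simp)
  have hnd : HasFDerivAt (fun x : EuclideanSpace ℝ (Fin n) => ‖x‖ ^ 2) (2 • innerSL ℝ x) x :=
    (hasStrictFDerivAt_norm_sq x).hasFDerivAt
  have hid : HasFDerivAt (fun x => inner ℝ (b x) x) _ x :=
    hbd.hasFDerivAt.inner ℝ (hasFDerivAt_id x)
  have hdR : divergence R x = ‖x‖ ^ 2 * A (fderiv ℝ u x) -
      inner ℝ (transposeApply A (fderiv ℝ u x x)) x - ((n : ℝ) - 1) * inner ℝ (b x) x := by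
    rw [hRdef, divergence_sub (V := fun x => ‖x‖ ^ 2 • b x) (V' := fun x => inner ℝ (b x) x • x)
      (hnd.differentiableAt.smul hbd) (hid.differentiableAt.smul differentiableAt_id),
      divergence_smul hnd.differentiableAt hbd,
      divergence_smul (V := fun x => x) hid.differentiableAt differentiableAt_id, divergence_id,
      hnd.fderiv, hid.fderiv, hdb]
    simp [fderivInnerCLM_apply, hbv, real_inner_comm x (b x)]
    ring
  change _ = divergence (fun x => cutoffSlope l x • R x) x
  rw [divergence_smul hsd hRd, hds, hdR, fderiv_cutoff]
  simp only [inner_sub_right, real_inner_smul_right, real_inner_self_eq_norm_sq,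
    transposeApply_add_right, transposeApply_smul_right, inner_add_right, hbdef,
    real_inner_comm x]
  ring

end Cutoff

/-! ### Taylor estimates and the splitting of the flux difference -/

section Estimates

variable {n m : ℕ} {W : (EuclideanSpace ℝ (Fin n) →L[ℝ] EuclideanSpace ℝ (Fin m)) → ℝ}
  {U : Set (EuclideanSpace ℝ (Fin n) →L[ℝ] EuclideanSpace ℝ (Fin m))}
  {O Ω ω : Set (EuclideanSpace ℝ (Fin n))}
  {t y w yin : EuclideanSpace ℝ (Fin n) → EuclideanSpace ℝ (Fin m)}
  {yε : ℝ → EuclideanSpace ℝ (Fin n) → EuclideanSpace ℝ (Fin m)}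

/-- Uniform first order Taylor expansion, based at the far end point. -/
lemma exists_abs_taylor_le {E X : Type*} [NormedAddCommGroup E] [NormedSpace ℝ E]
    [TopologicalSpace X] {W : E → ℝ} {U : Set E} (hU : IsOpen U) (hW : ContDiffOn ℝ 1 W U)
    {K : Set X} (hK : IsCompact K) {F : X → E} (hF : ContinuousOn F K) (hFU : ∀ x ∈ K, F x ∈ U)
    {δ : ℝ} (hδ : 0 < δ) :
    ∃ ρ : ℝ, 0 < ρ ∧ ∀ x ∈ K, ∀ G, ‖G - F x‖ < ρ →
      |W G - W (F x) - fderiv ℝ W G (G - F x)| ≤ δ * ‖G - F x‖ := by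
  have hKc : IsCompact (F '' K) := hK.image_of_continuousOn hF
  have hKU : F '' K ⊆ U := by rintro _ ⟨x, hx, rfl⟩; exact hFU x hx
  obtain ⟨ρ₁, hρ₁, hsub⟩ := hKc.exists_thickening_subset_open hU hKU
  have hcont : ∀ a ∈ F '' K, ContinuousAt (fderiv ℝ W) a := fun a ha =>
    (hW.continuousOn_fderiv_of_isOpen hU le_rfl).continuousAt (hU.mem_nhds (hKU ha))
  obtain ⟨ρ₂, hρ₂, hu⟩ := Metric.mem_uniformity_dist.1
    (hKc.uniformContinuousAt_of_continuousAt _ hcont (Metric.dist_mem_uniformity (half_pos hδ)))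
  refine ⟨min ρ₁ ρ₂, lt_min hρ₁ hρ₂, fun x hx G hG => ?_⟩
  have hxK : F x ∈ F '' K := mem_image_of_mem F hx
  have hfd : ∀ z ∈ Metric.ball (F x) (min ρ₁ ρ₂), ‖fderiv ℝ W z - fderiv ℝ W (F x)‖ < δ / 2 := by
    intro z hz
    have h1 : dist (F x) z < ρ₂ := by
      rw [dist_comm]; exact (Metric.mem_ball.1 hz).trans_le (min_le_right _ _)
    have h2 := hu h1 hxK
    rwa [mem_ofPred_eq, dist_comm, dist_eq_norm] at h2
  have hGm : G ∈ Metric.ball (F x) (min ρ₁ ρ₂) := by rwa [mem_ball_iff_norm]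
  -- Mean value inequality for `W` minus its derivative at `G`. On the ball that derivative is
  -- within `δ / 2` of the one at the centre, hence any two differ by at most `δ`.
  have h := (convex_ball (F x) (min ρ₁ ρ₂)).norm_image_sub_le_of_norm_hasFDerivWithin_le'
    (f := W) (f' := fderiv ℝ W) (φ := fderiv ℝ W G) (C := δ) (x := F x) (y := G)
    (fun z hz => by
      have hzU : z ∈ U := hsub (Metric.mem_thickening_iff.2
        ⟨F x, hxK, (Metric.mem_ball.1 hz).trans_le (min_le_left _ _)⟩)
      exact ((hW.contDiffAt (hU.mem_nhds hzU)).differentiableAt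
        one_ne_zero).hasFDerivAt.hasFDerivWithinAt)
    (fun z hz => by
      have h1 := hfd z hz
      have h2 := hfd G hGm
      have h3 : fderiv ℝ W z - fderiv ℝ W G =
        (fderiv ℝ W z - fderiv ℝ W (F x)) - (fderiv ℝ W G - fderiv ℝ W (F x)) := by abel
      rw [h3]
      exact (norm_sub_le _ _).trans (by linarith))
    (Metric.mem_ball_self (lt_min hρ₁ hρ₂)) hGm
  exact h

/-- A `C²` function has Lipschitz gradient near a point, with the corresponding Taylor bound. -/
lemma exists_fderiv_lipschitz {E F : Type*} [NormedAddCommGroup E] [NormedSpace ℝ E]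
    [NormedAddCommGroup F] [NormedSpace ℝ F] {f : E → F} {s : Set E} (hs : IsOpen s)
    (hf : ContDiffOn ℝ 2 f s) {a : E} (ha : a ∈ s) :
    ∃ L : ℝ, 0 < L ∧ ∃ r : ℝ, 0 < r ∧ Metric.ball a r ⊆ s ∧
      (∀ p ∈ Metric.ball a r, ∀ q ∈ Metric.ball a r,
        ‖fderiv ℝ f p - fderiv ℝ f q‖ ≤ L * ‖p - q‖) ∧
      ∀ p ∈ Metric.ball a r, ∀ q ∈ Metric.ball a r, ∀ ρ, ‖p - a‖ ≤ ρ → ‖q - a‖ ≤ ρ →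
        ∀ z ∈ Metric.ball a r, ‖z - a‖ ≤ ρ →
        ‖f p - f q - fderiv ℝ f z (p - q)‖ ≤ 2 * L * ρ * ‖p - q‖ := by
  have h1 : ContDiffAt ℝ 1 (fderiv ℝ f) a :=
    (hf.fderiv_of_isOpen hs (m := 1) (by norm_num)).contDiffAt (hs.mem_nhds ha)
  obtain ⟨K, N, hN, hK⟩ := h1.exists_lipschitzOnWith
  obtain ⟨r, hr, hrN⟩ := Metric.mem_nhds_iff.1 (inter_mem hN (hs.mem_nhds ha))
  have hLip : ∀ p ∈ Metric.ball a r, ∀ q ∈ Metric.ball a r,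
      ‖fderiv ℝ f p - fderiv ℝ f q‖ ≤ (K + 1 : ℝ) * ‖p - q‖ := by
    intro p hp q hq
    have h := hK.dist_le_mul p (hrN hp).1 q (hrN hq).1
    rw [dist_eq_norm, dist_eq_norm] at h
    nlinarith [norm_nonneg (p - q)]
  refine ⟨K + 1, by positivity, r, hr, fun p hp => (hrN hp).2, hLip, ?_⟩
  intro p hp q hq ρ hpρ hqρ z hz hzρ
  -- On this convex set all points are within `2ρ` of `z`, which gives the factor `2 L ρ`.
  refine ((convex_ball a r).inter (convex_closedBall a ρ)).norm_image_sub_le_of_norm_hasFDerivWithin_le'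
    (f := f) (f' := fderiv ℝ f) (fun v hv => ?_) (fun v hv => ?_)
    ⟨hq, by rwa [mem_closedBall_iff_norm]⟩ ⟨hp, by rwa [mem_closedBall_iff_norm]⟩
  · exact ((hf.contDiffAt (hs.mem_nhds (hrN hv.1).2)).differentiableAt
      two_ne_zero).hasFDerivAt.hasFDerivWithinAt
  · refine (hLip v hv.1 z hz).trans ?_
    have h2 := hv.2
    rw [mem_closedBall_iff_norm] at h2
    have h3 : ‖v - z‖ ≤ ρ + ρ := by
      have : v - z = (v - a) - (z - a) := by abel
      rw [this]
      exact (norm_sub_le _ _).trans (add_le_add h2 hzρ)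
    calc (K + 1 : ℝ) * ‖v - z‖ ≤ (K + 1) * (ρ + ρ) := by gcongr
      _ = _ := by ring

/-- The algebraic identity behind the estimate of the flux difference. -/
lemma flux_difference_eq {n m : ℕ}
    (A₀ A Aε : (EuclideanSpace ℝ (Fin n) →L[ℝ] EuclideanSpace ℝ (Fin m)) →L[ℝ] ℝ)
    (F Fε : EuclideanSpace ℝ (Fin n) →L[ℝ] EuclideanSpace ℝ (Fin m)) (a b : ℝ)
    (x : EuclideanSpace ℝ (Fin n)) (p q c : EuclideanSpace ℝ (Fin m)) :
    (a • x - transposeApply Aε (Fε x - (p - c))) - (b • x - transposeApply A (F x - (q - c))) -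
        (n : ℝ) • transposeApply Aε (p - q) =
      (A₀ (Fε - F) • x - transposeApply A₀ ((Fε - F) x + ((n : ℝ) - 1) • (p - q))) +
      ((a - b - A₀ (Fε - F)) • x - transposeApply (Aε - A) (F x - (q - c)) -
        transposeApply (Aε - A₀) ((Fε - F) x + ((n : ℝ) - 1) • (p - q))) := by
  -- The part `F x - (q - c)` depends on the intact body only and is of second order in `x` when `c
  -- = y 0`; the rest is linear in the perturbation and merges with the work term, which turns its
  -- coefficient into `n - 1`.
  have h1 : Fε x - (p - c) = (F x - (q - c)) + ((Fε - F) x - (p - q)) := by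
    simp only [sub_apply]; abel
  rw [h1]
  simp only [transposeApply_sub_left, transposeApply_add_right, transposeApply_sub_right,
    transposeApply_smul_right]
  module

end Estimates

/-! ### Singularity of the outer corrector at the origin -/

section OuterCorrector

variable {n m : ℕ} {Ω ω : Set (EuclideanSpace ℝ (Fin n))}
  {y w yin : EuclideanSpace ℝ (Fin n) → EuclideanSpace ℝ (Fin m)}

/-- Matching forces the gradient of the corrector to be `O(|x|⁻ⁿ)` at the origin. -/
lemma Matching.exists_grad_bound (hmatch : Matching Ω ω y w yin) (hΩ : IsOpen Ω)
    (h0 : (0 : EuclideanSpace ℝ (Fin n)) ∈ Ω) (hy : ContDiffOn ℝ 2 y (closure Ω))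
    (hw : ContDiffOn ℝ 2 w (closure Ω \ {0}))
    {F₀ : EuclideanSpace ℝ (Fin n) →L[ℝ] EuclideanSpace ℝ (Fin m)}
    (hfar : Tendsto (bodyGrad (exterior ω) yin)
      (Bornology.cobounded (EuclideanSpace ℝ (Fin n))) (𝓝 F₀)) :
    ∃ C : ℝ, 0 < C ∧ ∃ r : ℝ, 0 < r ∧ Metric.ball 0 r ⊆ Ω ∧
      ∀ x : EuclideanSpace ℝ (Fin n), x ≠ 0 → ‖x‖ < r →
        DifferentiableAt ℝ w x ∧ ‖fderiv ℝ w x‖ ≤ C / ‖x‖ ^ n := by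
  obtain ⟨R, hR, r₁, hr₁, hM⟩ := hmatch 1 one_pos
  have hf : ∀ᶠ z in Bornology.cobounded (EuclideanSpace ℝ (Fin n)),
      ‖bodyGrad (exterior ω) yin z‖ < ‖F₀‖ + 1 :=
    hfar.norm.eventually_lt_const (by linarith)
  obtain ⟨R₁, -, hR₁⟩ := (hasBasis_cobounded_norm.eventually_iff).1 hf
  have hyd : ContDiffAt ℝ 2 y 0 := hy.contDiffAt (mem_of_superset (hΩ.mem_nhds h0) subset_closure)
  have hyc : ContinuousAt (fderiv ℝ y) 0 :=
    (hyd.fderiv_right (m := 0) (by norm_num)).continuousAt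
  have hyb : ∀ᶠ x in 𝓝 (0 : EuclideanSpace ℝ (Fin n)), ‖fderiv ℝ y x‖ < ‖fderiv ℝ y 0‖ + 1 :=
    hyc.norm.eventually_lt_const (by linarith)
  obtain ⟨r₂, hr₂, hball⟩ := Metric.mem_nhds_iff.1 (inter_mem (hΩ.mem_nhds h0) hyb)
  set ρ := max R R₁ with hρ
  have hρ0 : 0 < ρ := lt_max_of_lt_left hR
  refine ⟨(1 + (‖F₀‖ + 1) + (‖fderiv ℝ y 0‖ + 1)) * ρ ^ n, by positivity, min r₁ r₂,
    lt_min hr₁ hr₂, fun x hx => (hball (Metric.ball_subset_ball (min_le_right _ _) hx)).1,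
    fun x hx0 hx => ?_⟩
  have hxb : x ∈ Metric.ball (0 : EuclideanSpace ℝ (Fin n)) r₂ := by
    simpa using hx.trans_le (min_le_right _ _)
  obtain ⟨hxΩ, hxF⟩ := hball hxb
  have hxΩn : closure Ω ∈ 𝓝 x := mem_of_superset (hΩ.mem_nhds hxΩ) subset_closure
  have hwd : DifferentiableAt ℝ w x :=
    (hw.contDiffAt (inter_mem hxΩn (isOpen_compl_singleton.mem_nhds hx0))).differentiableAt
      two_ne_zero
  have hyd' : DifferentiableAt ℝ y x := (hy.contDiffAt hxΩn).differentiableAt two_ne_zero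
  refine ⟨hwd, ?_⟩
  have hxn : 0 < ‖x‖ := norm_pos_iff.2 hx0
  -- Matching holds for every `ε`, so `ε` may depend on `x`: here `x / ε` has the fixed norm `ρ`.
  -- All gradients but `ε ^ n • ∇w` are bounded, hence so is this one, and `ε ^ n` is a multiple of
  -- `‖x‖ ^ n`.
  set ε := ‖x‖ / ρ with hε
  have hε0 : 0 < ε := by positivity
  have hεz : ε • (ε⁻¹ • x) = x := smul_inv_smul₀ hε0.ne' x
  have hz : ‖ε⁻¹ • x‖ = ρ := by
    rw [norm_smul, norm_inv, Real.norm_of_nonneg hε0.le, hε]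
    field_simp
  have h1 := hM ε (ε⁻¹ • x) hε0 (hz ▸ le_max_left _ _) (by
    rw [hz, hε, div_mul_cancel₀ _ hρ0.ne']; exact (hx.trans_le (min_le_left _ _)).le)
  have h2 : ‖bodyGrad (exterior ω) yin (ε⁻¹ • x)‖ < ‖F₀‖ + 1 :=
    hR₁ (by rw [mem_ofPred_eq, hz]; exact le_max_right _ _)
  rw [hεz, bodyGrad_eq_fderiv hΩ hxΩ] at h1
  have h3 : fderiv ℝ (outerSolution y w ε) x = fderiv ℝ y x + ε ^ n • fderiv ℝ w x :=
    (hyd'.hasFDerivAt.add (hwd.hasFDerivAt.const_smul (ε ^ n))).fderiv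
  rw [h3] at h1
  have h4 : ‖ε ^ n • fderiv ℝ w x‖ ≤ 1 + (‖F₀‖ + 1) + (‖fderiv ℝ y 0‖ + 1) := by
    have h5 : ε ^ n • fderiv ℝ w x =
        (fderiv ℝ y x + ε ^ n • fderiv ℝ w x - bodyGrad (exterior ω) yin (ε⁻¹ • x)) +
        bodyGrad (exterior ω) yin (ε⁻¹ • x) - fderiv ℝ y x := by abel
    rw [h5]
    exact (norm_sub_le _ _).trans
      (add_le_add ((norm_add_le _ _).trans (add_le_add h1 h2.le)) (le_of_lt hxF))
  rw [norm_smul, Real.norm_of_nonneg (by positivity)] at h4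
  rw [le_div_iff₀ (by positivity)]
  calc ‖fderiv ℝ w x‖ * ‖x‖ ^ n = (ε ^ n * ‖fderiv ℝ w x‖) * ρ ^ n := by
        rw [hε, div_pow]; field_simp
    _ ≤ _ := by gcongr

/-- A function with gradient `O(|x|⁻ⁿ)` at the origin is itself `o(|x|⁻ⁿ)`. -/
lemma exists_norm_pow_mul_le (hn : 0 < n) {C r : ℝ} (hr : 0 < r) (hC : 0 < C)
    (hw : ∀ x : EuclideanSpace ℝ (Fin n), x ≠ 0 → ‖x‖ < r →
        DifferentiableAt ℝ w x ∧ ‖fderiv ℝ w x‖ ≤ C / ‖x‖ ^ n) {η : ℝ} (hη : 0 < η) :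
    ∃ a : ℝ, 0 < a ∧ ∀ x : EuclideanSpace ℝ (Fin n), x ≠ 0 → ‖x‖ < a → ‖x‖ ^ n * ‖w x‖ ≤ η := by
  -- Integrate the gradient bound radially from the sphere of radius `s`: `‖w x‖ ≤ |M| + C s / ‖x‖ ^
  -- n`. Small `s` makes the singular part at most half of `η`; afterwards small `‖x‖` absorbs `M`,
  -- which depends on `s`.
  set s := min (r / 2) (η / (2 * C)) with hs
  have hs0 : 0 < s := by positivity
  have hsr : s < r := (min_le_left _ _).trans_lt (by linarith)
  have hsC : C * s ≤ η / 2 := by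
    calc C * s ≤ C * (η / (2 * C)) := by gcongr; exact min_le_right _ _
      _ = η / 2 := by field_simp
  have hwc : ContinuousOn w (Metric.sphere 0 s) := fun x hx =>
    ((hw x (by rintro rfl; simp [hs0.ne] at hx) (by
      rw [mem_sphere_zero_iff_norm] at hx; linarith)).1.continuousAt).continuousWithinAt
  obtain ⟨M, hM⟩ := (isCompact_sphere (0 : EuclideanSpace ℝ (Fin n)) s).exists_bound_of_continuousOn hwc
  have hlim : Tendsto (fun a : ℝ => a ^ n * |M|) (𝓝[>] 0) (𝓝 0) := by
    have : Tendsto (fun a : ℝ => a ^ n * |M|) (𝓝 0) (𝓝 (0 ^ n * |M|)) :=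
      (Continuous.tendsto (by fun_prop) 0)
    rw [zero_pow hn.ne', zero_mul] at this
    exact this.mono_left nhdsWithin_le_nhds
  obtain ⟨a, ha1, ha2⟩ := ((hlim.eventually_le_const (half_pos hη)).and
    (Ioo_mem_nhdsGT hs0)).exists
  refine ⟨a, ha2.1, fun x hx0 hxa => ?_⟩
  have hxn : 0 < ‖x‖ := norm_pos_iff.2 hx0
  have hxs : ‖x‖ < s := hxa.trans ha2.2
  set p := (s / ‖x‖) • x with hp
  have hpn : ‖p‖ = s := by
    rw [hp, norm_smul, Real.norm_of_nonneg (by positivity), div_mul_cancel₀ _ hxn.ne']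
  have hseg : ∀ z ∈ segment ℝ p x, ‖x‖ ≤ ‖z‖ ∧ ‖z‖ ≤ s := by
    rintro z ⟨b, c, hb, hc, hbc, rfl⟩
    have h1 : b • p + c • x = (b * (s / ‖x‖) + c) • x := by rw [hp, smul_smul, add_smul]
    have h2 : ‖b • p + c • x‖ = b * s + c * ‖x‖ := by
      rw [h1, norm_smul, Real.norm_of_nonneg (by positivity)]
      field_simp
    rw [h2]
    constructor <;> nlinarith
  have hmv := (convex_segment p x).norm_image_sub_le_of_norm_hasFDerivWithin_le
    (f := w) (f' := fderiv ℝ w) (C := C / ‖x‖ ^ n)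
    (fun z hz => by
      have hz' := hseg z hz
      exact (hw z (norm_pos_iff.1 (hxn.trans_le hz'.1))
        (hz'.2.trans_lt hsr)).1.hasFDerivAt.hasFDerivWithinAt)
    (fun z hz => by
      have hz' := hseg z hz
      refine (hw z (norm_pos_iff.1 (hxn.trans_le hz'.1)) (hz'.2.trans_lt hsr)).2.trans ?_
      gcongr
      exact hz'.1)
    (left_mem_segment ℝ p x) (right_mem_segment ℝ p x)
  have hxp : ‖x - p‖ ≤ s := by
    have : x - p = (1 - s / ‖x‖) • x := by rw [hp, sub_smul, one_smul]
    have h1 : 1 ≤ s / ‖x‖ := by rw [le_div_iff₀ hxn]; linarith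
    rw [this, norm_smul, Real.norm_of_nonpos (by linarith)]
    have : s / ‖x‖ * ‖x‖ = s := div_mul_cancel₀ _ hxn.ne'
    nlinarith
  have hwp : ‖w p‖ ≤ |M| := (hM p (by simpa using hpn)).trans (le_abs_self M)
  have hwx : ‖w x‖ ≤ |M| + C / ‖x‖ ^ n * s := by
    calc ‖w x‖ = ‖w p + (w x - w p)‖ := by congr 1; abel
      _ ≤ ‖w p‖ + ‖w x - w p‖ := norm_add_le _ _
      _ ≤ |M| + C / ‖x‖ ^ n * ‖x - p‖ := add_le_add hwp hmv
      _ ≤ |M| + C / ‖x‖ ^ n * s := by gcongr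
  calc ‖x‖ ^ n * ‖w x‖ ≤ ‖x‖ ^ n * (|M| + C / ‖x‖ ^ n * s) := by gcongr
    _ = ‖x‖ ^ n * |M| + C * s := by field_simp
    _ ≤ a ^ n * |M| + C * s := by gcongr
    _ ≤ η := by linarith

end OuterCorrector

/-! ### Estimate of the energy difference at a fixed cutoff radius -/

section Remainder

variable {n m : ℕ} {W : (EuclideanSpace ℝ (Fin n) →L[ℝ] EuclideanSpace ℝ (Fin m)) → ℝ}
  {U : Set (EuclideanSpace ℝ (Fin n) →L[ℝ] EuclideanSpace ℝ (Fin m))}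
  {Ω ω : Set (EuclideanSpace ℝ (Fin n))}
  {t y w : EuclideanSpace ℝ (Fin n) → EuclideanSpace ℝ (Fin m)}

/-- The part of the flux difference that is of higher order near the void. -/
def fluxRemainder (W : (EuclideanSpace ℝ (Fin n) →L[ℝ] EuclideanSpace ℝ (Fin m)) → ℝ)
    (A₀ : (EuclideanSpace ℝ (Fin n) →L[ℝ] EuclideanSpace ℝ (Fin m)) →L[ℝ] ℝ)
    (F G : EuclideanSpace ℝ (Fin n) →L[ℝ] EuclideanSpace ℝ (Fin m))
    (x : EuclideanSpace ℝ (Fin n)) (v u : EuclideanSpace ℝ (Fin m)) : EuclideanSpace ℝ (Fin n) :=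
  (W G - W F - A₀ (G - F)) • x - transposeApply (fderiv ℝ W G - fderiv ℝ W F) v -
    transposeApply (fderiv ℝ W G - A₀) ((G - F) x + ((n : ℝ) - 1) • u)

/-- On the annulus `|x| ~ l` both `F` and `G` are within `O(l)` of `∇y(0)`, while `∇y x - (y x - y
0) = O(l²)` by Taylor expansion. Each term of the remainder thus gains one factor `l` over the
leading part. -/
lemma exists_fluxRemainder_le (hn : 0 < n) (hU : IsOpen U) (hW : ContDiffOn ℝ 2 W U)
    (hΩ : IsOpen Ω) (h0 : (0 : EuclideanSpace ℝ (Fin n)) ∈ Ω) (hy : ContDiffOn ℝ 2 y (closure Ω))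
    (hF₀ : bodyGrad Ω y 0 ∈ U) :
    ∃ C : ℝ, 0 < C ∧ ∃ r : ℝ, 0 < r ∧ ∀ l, 0 < l → l < r →
      ∀ x : EuclideanSpace ℝ (Fin n), l ≤ ‖x‖ → ‖x‖ ≤ 2 * l →
      ∀ (G : EuclideanSpace ℝ (Fin n) →L[ℝ] EuclideanSpace ℝ (Fin m))
        (u : EuclideanSpace ℝ (Fin m)), ‖G - bodyGrad Ω y x‖ ≤ l →
      ‖fluxRemainder W (fderiv ℝ W (bodyGrad Ω y 0)) (bodyGrad Ω y x) G x
        (bodyGrad Ω y x x - (y x - y 0)) u‖ ≤ C * (l ^ 2 * ‖G - bodyGrad Ω y x‖ + l * ‖u‖) := by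
  obtain ⟨L, hL, r₁, hr₁, hsub₁, hlip₁, htay₁⟩ :=
    exists_fderiv_lipschitz hΩ (hy.mono subset_closure) h0
  obtain ⟨L', hL', r₂, hr₂, hsub₂, hlip₂, htay₂⟩ := exists_fderiv_lipschitz hU hW hF₀
  -- The `6` is `4 + 2`, from the energy and the stress at the perturbed gradient; `8 L` comes from
  -- the Taylor bound of `y`, and `n` dominates `n - 1`. The radius keeps `x` in the ball for `y`
  -- and both gradients in the ball for `W`.
  refine ⟨L' * ((1 + 2 * L) * (6 + n) + 8 * L), by positivity,
    min (r₁ / 2) (r₂ / (1 + 2 * L)), by positivity, fun l hl hlr x hlx hxl G u hG => ?_⟩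
  have h2l : 2 * l < r₁ := by linarith [hlr.trans_le (min_le_left _ _)]
  have hl2 : (1 + 2 * L) * l < r₂ := by
    have := hlr.trans_le (min_le_right _ _)
    rwa [lt_div_iff₀ (by positivity), mul_comm] at this
  have h0b : (0 : EuclideanSpace ℝ (Fin n)) ∈ Metric.ball 0 r₁ := Metric.mem_ball_self hr₁
  have hxb : x ∈ Metric.ball (0 : EuclideanSpace ℝ (Fin n)) r₁ := by simpa using hxl.trans_lt h2l
  have hFx : bodyGrad Ω y x = fderiv ℝ y x := bodyGrad_eq_fderiv hΩ (hsub₁ hxb)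
  have hF0 : bodyGrad Ω y 0 = fderiv ℝ y 0 := bodyGrad_eq_fderiv hΩ h0
  set F := bodyGrad Ω y x with hFdef
  set F₀ := bodyGrad Ω y 0 with hF₀def
  set d := ‖G - F‖ with hd
  have hFF₀ : ‖F - F₀‖ ≤ 2 * L * l := by
    have := hlip₁ x hxb 0 h0b
    rw [hFx, hF0]
    refine this.trans ?_
    rw [sub_zero]
    nlinarith
  have hv : ‖F x - (y x - y 0)‖ ≤ 8 * L * l ^ 2 := by
    have := htay₁ x hxb 0 h0b ‖x‖ (by simp) (by simp) x hxb (by simp)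
    rw [sub_zero, ← hFx, norm_sub_rev] at this
    refine this.trans ?_
    calc 2 * L * ‖x‖ * ‖x‖ ≤ 2 * L * (2 * l) * (2 * l) := by gcongr
      _ = 8 * L * l ^ 2 := by ring
  have hGF₀ : ‖G - F₀‖ ≤ (1 + 2 * L) * l := by
    calc ‖G - F₀‖ = ‖(G - F) + (F - F₀)‖ := by congr 1; abel
      _ ≤ l + 2 * L * l := (norm_add_le _ _).trans (add_le_add hG hFF₀)
      _ = _ := by ring
  have hFF₀' : ‖F - F₀‖ ≤ (1 + 2 * L) * l := hFF₀.trans (by nlinarith)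
  have hFb : F ∈ Metric.ball F₀ r₂ := by rw [mem_ball_iff_norm]; exact hFF₀'.trans_lt hl2
  have hGb : G ∈ Metric.ball F₀ r₂ := by rw [mem_ball_iff_norm]; exact hGF₀.trans_lt hl2
  have hF₀b : F₀ ∈ Metric.ball F₀ r₂ := Metric.mem_ball_self hr₂
  have e1 : ‖W G - W F - fderiv ℝ W F₀ (G - F)‖ ≤ 2 * L' * ((1 + 2 * L) * l) * d :=
    htay₂ G hGb F hFb _ hGF₀ hFF₀' F₀ hF₀b (by rw [sub_self, norm_zero]; positivity)
  have e2 : ‖fderiv ℝ W G - fderiv ℝ W F‖ ≤ L' * d := hlip₂ G hGb F hFb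
  have e3 : ‖fderiv ℝ W G - fderiv ℝ W F₀‖ ≤ L' * ((1 + 2 * L) * l) :=
    (hlip₂ G hGb F₀ hF₀b).trans (by gcongr)
  have hn1 : |(n : ℝ) - 1| ≤ n := by
    have : (1 : ℝ) ≤ n := by exact_mod_cast hn
    rw [abs_of_nonneg (by linarith)]; linarith
  have e4 : ‖(G - F) x + ((n : ℝ) - 1) • u‖ ≤ d * (2 * l) + n * ‖u‖ := by
    refine (norm_add_le _ _).trans (add_le_add ?_ ?_)
    · exact ((G - F).le_opNorm x).trans (by gcongr)
    · rw [norm_smul, Real.norm_eq_abs]; gcongr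
  have hd0 : 0 ≤ d := norm_nonneg _
  have hu0 : 0 ≤ ‖u‖ := norm_nonneg _
  calc ‖fluxRemainder W (fderiv ℝ W F₀) F G x (F x - (y x - y 0)) u‖
      ≤ 2 * L' * ((1 + 2 * L) * l) * d * (2 * l) + L' * d * (8 * L * l ^ 2) +
        L' * ((1 + 2 * L) * l) * (d * (2 * l) + n * ‖u‖) := by
        refine (norm_sub_le _ _).trans (add_le_add ((norm_sub_le _ _).trans (add_le_add ?_ ?_)) ?_)
        · rw [norm_smul]; gcongr
        · exact (norm_transposeApply_le _ _).trans (by gcongr)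
        · exact (norm_transposeApply_le _ _).trans (by gcongr)
    _ = L' * ((1 + 2 * L) * 6 + 8 * L) * (l ^ 2 * d) + L' * ((1 + 2 * L) * n) * (l * ‖u‖) := by ring
    _ ≤ L' * ((1 + 2 * L) * (6 + n) + 8 * L) * (l ^ 2 * d) +
        L' * ((1 + 2 * L) * (6 + n) + 8 * L) * (l * ‖u‖) := by
        gcongr
        · linarith [(Nat.cast_nonneg n : (0 : ℝ) ≤ n)]
        · nlinarith
    _ = _ := by ring

lemma abs_fderiv_cutoff_le {l C b : ℝ} (hl : 0 < l) {x v : EuclideanSpace ℝ (Fin n)}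
    (hC : |cutoffSlope l x| ≤ C / l ^ 2) (hb0 : 0 ≤ b)
    (hv : l ≤ ‖x‖ → ‖x‖ ≤ 2 * l → ‖v‖ ≤ b) : |fderiv ℝ (cutoff l) x v| ≤ 2 * C / l * b := by
  have hC0 : 0 ≤ C / l ^ 2 := (abs_nonneg _).trans hC
  rw [fderiv_cutoff, abs_mul]
  by_cases hx : l ≤ ‖x‖ ∧ ‖x‖ ≤ 2 * l
  · calc |cutoffSlope l x| * |inner ℝ x v| ≤ C / l ^ 2 * (2 * l * b) := by
          gcongr
          exact (abs_real_inner_le_norm x v).trans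
            (mul_le_mul hx.2 (hv hx.1 hx.2) (norm_nonneg _) (by positivity))
      _ = 2 * C / l * b := by field_simp
  · rw [image_eq_zero_of_notMem_tsupport fun h => hx (tsupport_cutoffSlope_subset hl h), abs_zero,
      zero_mul]
    have : 2 * C / l * b = C / l ^ 2 * (2 * l * b) := by field_simp
    rw [this]; positivity

/-- The integrand is split into a bulk Taylor remainder, a leading flux with integral zero, and a
remaining flux carried by the annulus. Only the last sees the small volume of the ball of radius
`2l`. -/
lemma abs_energy_difference_le {ε l C a b : ℝ} {yε : EuclideanSpace ℝ (Fin n) → EuclideanSpace ℝ (Fin m)}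
    (hU : IsOpen U) (hW : ContDiffOn ℝ 2 W U) (hΩ : IsC1Domain Ω) (hω : IsC1Domain ω) (hn : 0 < n)
    (hε : 0 < ε) (hl : 0 < l) (hsub : closure (ε • ω) ⊆ Metric.ball 0 l)
    (hball : Metric.closedBall 0 (2 * l) ⊆ Ω) (hy : SolvesIntact W U Ω t y)
    (h : SolvesVoided W U Ω ω ε t yε)
    (A₀ : (EuclideanSpace ℝ (Fin n) →L[ℝ] EuclideanSpace ℝ (Fin m)) →L[ℝ] ℝ)
    (c : EuclideanSpace ℝ (Fin m)) (ha0 : 0 ≤ a) (hb0 : 0 ≤ b)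
    (hC : ∀ x : EuclideanSpace ℝ (Fin n), |cutoffSlope l x| ≤ C / l ^ 2)
    (ha : ∀ x ∈ closure Ω, l ≤ ‖x‖ →
      |W (bodyGrad (voided Ω ω ε) yε x) - W (bodyGrad Ω y x) -
        stress W (voided Ω ω ε) yε x (bodyGrad (voided Ω ω ε) yε x - bodyGrad Ω y x)| ≤ a)
    (hb : ∀ x : EuclideanSpace ℝ (Fin n), l ≤ ‖x‖ → ‖x‖ ≤ 2 * l →
      ‖fluxRemainder W A₀ (bodyGrad Ω y x) (bodyGrad (voided Ω ω ε) yε x) x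
        (bodyGrad Ω y x x - (y x - c)) (yε x - y x)‖ ≤ b) :
    |n * (potentialEnergy W (voided Ω ω ε) (frontier Ω) t yε -
        potentialEnergy W Ω (frontier Ω) t y) +
      ε ^ n * ∫ z in frontier ω, W (bodyGrad (voided Ω ω ε) yε (ε • z)) *
        inner ℝ (outwardNormal ω z) z ∂surfaceMeasure n| ≤
      n * a * volume.real Ω +
        2 * C / l * b * volume.real (Metric.closedBall (0 : EuclideanSpace ℝ (Fin n)) (2 * l)) := by
  have hsubΩ : closure (ε • ω) ⊆ Ω := hsub.trans ((Metric.ball_subset_closedBall.trans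
    (Metric.closedBall_subset_closedBall (by linarith))).trans hball)
  have hdisj : Disjoint (tsupport (cutoff l : EuclideanSpace ℝ (Fin n) → ℝ)) (closure (ε • ω)) := by
    refine disjoint_left.2 fun x hx hxc => ?_
    have h1 : l ≤ ‖x‖ := tsupport_cutoff_subset hl hx
    have h2 : ‖x‖ < l := by simpa using hsub hxc
    linarith
  have hts1 : tsupport (fun x : EuclideanSpace ℝ (Fin n) => 1 - cutoff l x) ⊆ Ω := fun x hx =>
    hball (by simpa using tsupport_one_sub_cutoff_subset hl hx)
  rw [energy_difference hU hW hΩ hω hn hε hsubΩ hy h c (contDiff_cutoff l) hdisj hts1]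
  have hu := uniqueDiffOn_closure_voided hΩ hω hε hsubΩ
  have huΩ := uniqueDiffOn_closure hΩ.isOpen hΩ.boundary
  have hopen : IsOpen (voided Ω ω ε) := isOpen_voided hΩ.isOpen
  have hbd : Bornology.IsBounded (voided Ω ω ε) := hΩ.isBounded.subset sdiff_subset
  have hsubset : closure (voided Ω ω ε) ⊆ closure Ω := closure_mono sdiff_subset
  have hDχ : Continuous (fderiv ℝ (cutoff l : EuclideanSpace ℝ (Fin n) → ℝ)) :=
    (contDiff_cutoff l).continuous_fderiv one_ne_zero
  have hFε := (contDiffOn_bodyGrad hu h.equilibrium.contDiffOn).continuousOn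
  have hF := (contDiffOn_bodyGrad huΩ hy.equilibrium.contDiffOn).continuousOn.mono hsubset
  have hWε := (h.equilibrium.contDiffOn_energy hu hW).continuousOn
  have hWF := (hy.equilibrium.contDiffOn_energy huΩ hW).continuousOn.mono hsubset
  have hSε := (h.equilibrium.contDiffOn_stress hu hU hW).continuousOn
  have hS := (hy.equilibrium.contDiffOn_stress huΩ hU hW).continuousOn.mono hsubset
  have hyc := hy.equilibrium.contDiffOn.continuousOn.mono hsubset
  have hyεc := h.equilibrium.contDiffOn.continuousOn
  have hχc : ContinuousOn (cutoff l) (closure (voided Ω ω ε)) :=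
    (contDiff_cutoff l).continuous.continuousOn
  have hΔ : ContinuousOn (fun x => bodyGrad (voided Ω ω ε) yε x - bodyGrad Ω y x)
      (closure (voided Ω ω ε)) := hFε.sub hF
  have huc : ContinuousOn (fun x => yε x - y x) (closure (voided Ω ω ε)) := hyεc.sub hyc
  have hnu : ContinuousOn (fun x => ((n : ℝ) - 1) • (yε x - y x)) (closure (voided Ω ω ε)) :=
    huc.const_smul ((n : ℝ) - 1)
  have hid : ContinuousOn (fun x : EuclideanSpace ℝ (Fin n) => x) (closure (voided Ω ω ε)) :=
    continuousOn_id
  have hSS : ContinuousOn (fun x => stress W (voided Ω ω ε) yε x - stress W Ω y x)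
      (closure (voided Ω ω ε)) :=
    (contDiffOn_zero (𝕜 := ℝ)).1 ((contDiffOn_zero.2 hSε).sub (contDiffOn_zero.2 hS))
  have hSA : ContinuousOn (fun x => stress W (voided Ω ω ε) yε x - A₀)
      (closure (voided Ω ω ε)) :=
    (contDiffOn_zero (𝕜 := ℝ)).1 ((contDiffOn_zero.2 hSε).sub contDiffOn_const)
  set q : EuclideanSpace ℝ (Fin n) → ℝ := fun x => n * (cutoff l x *
    (W (bodyGrad (voided Ω ω ε) yε x) - W (bodyGrad Ω y x) -
      stress W (voided Ω ω ε) yε x (bodyGrad (voided Ω ω ε) yε x - bodyGrad Ω y x))) with hq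
  set lead : EuclideanSpace ℝ (Fin n) → ℝ := fun x => fderiv ℝ (cutoff l) x
    (A₀ (bodyGrad (voided Ω ω ε) yε x - bodyGrad Ω y x) • x -
      transposeApply A₀ ((bodyGrad (voided Ω ω ε) yε x - bodyGrad Ω y x) x +
        ((n : ℝ) - 1) • (yε x - y x))) with hlead
  set rest : EuclideanSpace ℝ (Fin n) → ℝ := fun x => fderiv ℝ (cutoff l) x
    (fluxRemainder W A₀ (bodyGrad Ω y x) (bodyGrad (voided Ω ω ε) yε x) x
        (bodyGrad Ω y x x - (y x - c)) (yε x - y x)) with hrest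
  have hu' : ContinuousOn (fun x => (bodyGrad (voided Ω ω ε) yε x - bodyGrad Ω y x) x +
        ((n : ℝ) - 1) • (yε x - y x)) (closure (voided Ω ω ε)) :=
    (hΔ.clm_apply hid).add hnu
  have hA₀Δ : ContinuousOn (fun x => A₀ (bodyGrad (voided Ω ω ε) yε x - bodyGrad Ω y x))
      (closure (voided Ω ω ε)) := A₀.continuous.comp_continuousOn hΔ
  have iq : IntegrableOn q (voided Ω ω ε) := integrableOn_of_continuousOn_closure hbd
    (continuousOn_const.mul (hχc.mul ((hWε.sub hWF).sub (hSε.clm_apply hΔ))))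
  have il : IntegrableOn lead (voided Ω ω ε) := integrableOn_of_continuousOn_closure hbd
    (hDχ.continuousOn.clm_apply ((hA₀Δ.smul hid).sub
      (continuousOn_transposeApply continuousOn_const hu')))
  have ir : IntegrableOn rest (voided Ω ω ε) := by
    refine integrableOn_of_continuousOn_closure hbd (hDχ.continuousOn.clm_apply
      ((((((hWε.sub hWF).sub hA₀Δ).smul hid).sub (continuousOn_transposeApply hSS
        ((hF.clm_apply hid).sub (hyc.sub continuousOn_const)))).sub
        (continuousOn_transposeApply hSA hu'))))
  have ilr : IntegrableOn (fun x => lead x + rest x) (voided Ω ω ε) := il.add ir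
  have e1 : ∫ x in voided Ω ω ε, lead x = 0 := by
    have hc : ContDiffOn ℝ 1 (fun x => yε x - y x) (voided Ω ω ε) :=
      ((h.equilibrium.contDiffOn.mono subset_closure).of_le (by norm_num)).sub
        ((hy.equilibrium.contDiffOn.mono (subset_closure.trans hsubset)).of_le (by norm_num))
    rw [← integral_fderiv_cutoff_eq_zero hopen hl (fun x hx => ⟨hball (by simpa using hx.2),
      fun hxc => by
        have h2 : ‖x‖ < l := by simpa using hsub hxc
        exact absurd hx.1 (not_le.2 h2)⟩) hc A₀]
    refine setIntegral_congr_fun hopen.measurableSet fun x hx => ?_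
    have hyd : DifferentiableAt ℝ y x :=
      IsEquilibrium.differentiableAt (hy.equilibrium.contDiffOn.of_le (by norm_num)) hΩ.isOpen hx.1
    have hyεd : DifferentiableAt ℝ yε x :=
      IsEquilibrium.differentiableAt (h.equilibrium.contDiffOn.of_le (by norm_num)) hopen hx
    simp only [hlead, fderiv_fun_sub hyεd hyd, bodyGrad_eq_fderiv hopen hx,
      bodyGrad_eq_fderiv hΩ.isOpen hx.1]
  have e2 : ∫ x in voided Ω ω ε, (q x + fderiv ℝ (cutoff l) x
      (dilationFlux W (voided Ω ω ε) yε c x - dilationFlux W Ω y c x -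
          (n : ℝ) • transposeApply (stress W (voided Ω ω ε) yε x) (yε x - y x))) =
      (∫ x in voided Ω ω ε, q x) + ∫ x in voided Ω ω ε, rest x := by
    rw [← zero_add (∫ x in voided Ω ω ε, rest x), ← e1, ← integral_add il ir,
      ← integral_add iq ilr]
    refine integral_congr_ae (Eventually.of_forall fun x => ?_)
    simp only [dilationFlux, hlead, hrest, fluxRemainder, ← map_add]
    rw [flux_difference_eq A₀]
    rfl
  have hr2 : ∫ x in voided Ω ω ε, rest x =
      ∫ x in voided Ω ω ε ∩ Metric.closedBall 0 (2 * l), rest x := by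
    refine setIntegral_eq_of_subset_of_forall_sdiff_eq_zero hopen.measurableSet inter_subset_left
      fun x hx => ?_
    have hxs : cutoffSlope l x = 0 := image_eq_zero_of_notMem_tsupport fun hxt =>
      hx.2 ⟨hx.1, by simpa using (tsupport_cutoffSlope_subset hl hxt).2⟩
    simp only [hrest, fderiv_cutoff, hxs, zero_mul]
  have hC0 : 0 ≤ 2 * C / l * b := by
    have h1 : 0 ≤ C / l ^ 2 := (abs_nonneg _).trans (hC 0)
    have h2 : 2 * C / l * b = C / l ^ 2 * (2 * l * b) := by field_simp
    rw [h2]; positivity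
  have hΩfin : volume Ω < ⊤ := hΩ.isBounded.measure_lt_top
  have b1 : |∫ x in voided Ω ω ε, q x| ≤ n * a * volume.real Ω := by
    rw [← Real.norm_eq_abs]
    refine (norm_setIntegral_le_of_norm_le_const (μ := volume) (C := n * a)
      hbd.measure_lt_top fun x hx => ?_).trans ?_
    · rw [hq, Real.norm_eq_abs, abs_mul, abs_mul, Nat.abs_cast, abs_of_nonneg (cutoff_nonneg l x)]
      gcongr
      by_cases hx0 : l ≤ ‖x‖
      · calc _ ≤ 1 * a := by
              gcongr
              · exact cutoff_le_one l x
              · exact ha x (subset_closure hx.1) hx0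
          _ = a := one_mul a
      · rw [image_eq_zero_of_notMem_tsupport (f := cutoff l)
          fun hc => hx0 (tsupport_cutoff_subset hl hc), zero_mul]
        exact ha0
    · gcongr
      · exact hΩfin.ne
      · exact sdiff_subset
  have b2 : |∫ x in voided Ω ω ε, rest x| ≤
      2 * C / l * b * volume.real (Metric.closedBall (0 : EuclideanSpace ℝ (Fin n)) (2 * l)) := by
    rw [hr2, ← Real.norm_eq_abs]
    refine (norm_setIntegral_le_of_norm_le_const (μ := volume) (C := 2 * C / l * b)
      ((measure_mono inter_subset_right).trans_lt measure_closedBall_lt_top) fun x hx => ?_).trans ?_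
    · exact abs_fderiv_cutoff_le hl (hC x) hb0 (hb x)
    · gcongr
      · exact measure_closedBall_lt_top.ne
      · exact inter_subset_right
  rw [e2]
  exact (abs_add_le _ _).trans (add_le_add b1 b2)

end Remainder

/-! ### Passage to the limit: first the cutoff radius, then `ε` -/

section Limits

variable {n m : ℕ} {W : (EuclideanSpace ℝ (Fin n) →L[ℝ] EuclideanSpace ℝ (Fin m)) → ℝ}
  {U : Set (EuclideanSpace ℝ (Fin n) →L[ℝ] EuclideanSpace ℝ (Fin m))}
  {Ω ω : Set (EuclideanSpace ℝ (Fin n))}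
  {t y w yin : EuclideanSpace ℝ (Fin n) → EuclideanSpace ℝ (Fin m)}
  {yε : ℝ → EuclideanSpace ℝ (Fin n) → EuclideanSpace ℝ (Fin m)}

/-- `w` is regular only off the origin; removing that point does not change derivatives within
`closure Ω` elsewhere. -/
lemma continuousOn_bodyGrad_of_sdiff_zero (hu : UniqueDiffOn ℝ (closure Ω))
    (hw : ContDiffOn ℝ 2 w (closure Ω \ {0})) : ContinuousOn (bodyGrad Ω w) (closure Ω \ {0}) := by
  rw [sdiff_eq] at hw ⊢
  have hu' : UniqueDiffOn ℝ (closure Ω ∩ {0}ᶜ) := hu.inter isOpen_compl_singleton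
  refine (hw.continuousOn_fderivWithin hu' (by norm_num)).congr fun x hx => ?_
  exact (fderivWithin_inter (isOpen_compl_singleton.mem_nhds hx.2)).symm

lemma norm_le_of_dist_inv_smul_lt {E : Type*} [NormedAddCommGroup E] [NormedSpace ℝ E] {a b : E}
    {e τ : ℝ} (he : 0 < e) (h : dist a (e⁻¹ • b) < τ) : ‖b‖ ≤ e * (‖a‖ + τ) := by
  have h1 : ‖e⁻¹ • b‖ ≤ ‖a‖ + τ := by
    have h2 : e⁻¹ • b = a - (a - e⁻¹ • b) := by abel
    rw [h2]
    rw [dist_eq_norm] at h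
    exact (norm_sub_le _ _).trans (by linarith)
  calc ‖b‖ = e * ‖e⁻¹ • b‖ := by
        rw [norm_smul, norm_inv, Real.norm_of_nonneg he.le, mul_inv_cancel_left₀ he.ne']
    _ ≤ _ := by gcongr

/-- Up to `o(εⁿ)`, the energy difference is the flux out of the void. -/
lemma eventually_abs_energy_difference_le (hn : 0 < n) (hU : IsOpen U) (hW : ContDiffOn ℝ 2 W U)
    (hΩ : IsC1Domain Ω) (hω : IsC1Domain ω) (h0 : (0 : EuclideanSpace ℝ (Fin n)) ∈ Ω)
    (hy : SolvesIntact W U Ω t y)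
    (hyε : ∀ᶠ ε : ℝ in 𝓝[>] 0, SolvesVoided W U Ω ω ε t (yε ε))
    (hout : OuterExpansion Ω ω yε y w) (hyin : SolvesExterior W U ω (bodyGrad Ω y 0) yin)
    (hmatch : Matching Ω ω y w yin) {η : ℝ} (hη : 0 < η) :
    ∀ᶠ ε : ℝ in 𝓝[>] 0,
      |n * (potentialEnergy W (voided Ω ω ε) (frontier Ω) t (yε ε) -
        potentialEnergy W Ω (frontier Ω) t y) +
      ε ^ n * ∫ z in frontier ω, W (bodyGrad (voided Ω ω ε) (yε ε) (ε • z)) *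
        inner ℝ (outwardNormal ω z) z ∂surfaceMeasure n| ≤ η * ε ^ n := by
  have huΩ := uniqueDiffOn_closure hΩ.isOpen hΩ.boundary
  obtain ⟨Cθ, hCθ, hθ⟩ := exists_cutoffSlope_bound (n := n)
  obtain ⟨C, hC, r, hr, hflux⟩ := exists_fluxRemainder_le hn hU hW hΩ.isOpen h0
    hy.equilibrium.contDiffOn (hy.equilibrium.grad_mem 0 (subset_closure h0))
  obtain ⟨C₁, hC₁, r₁, hr₁, hball, hDw⟩ := hmatch.exists_grad_bound hΩ.isOpen h0
    hy.equilibrium.contDiffOn hout.contDiffOn hyin.far_field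
  set κ := volume.real (Metric.closedBall (0 : EuclideanSpace ℝ (Fin n)) 1) with hκ
  have hκ0 : 0 ≤ κ := measureReal_nonneg
  -- Chosen so that the annulus term below is at most half of `η`; the factor `6` is `2 · 3`, as
  -- three portions of `η'` occur.
  set η' := η / (2 * (6 * Cθ * C * 2 ^ n * κ + 1)) with hη'
  have hη'0 : 0 < η' := by positivity
  obtain ⟨r₃, hr₃, hws⟩ := exists_norm_pow_mul_le (w := w) hn hr₁ hC₁ hDw hη'0
  -- From here on `l` is fixed. The constants `D` and `δ` and the smallness of `ε` may depend on it.
  obtain ⟨l, hl, hlr, hlr₁, hlr₃, hlη⟩ : ∃ l : ℝ, 0 < l ∧ l < r ∧ 2 * l < r₁ ∧ 2 * l < r₃ ∧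
      l * (C₁ + 1) ≤ η' := by
    refine ⟨min (min (r / 2) (r₁ / 4)) (min (r₃ / 4) (η' / (C₁ + 1))), by positivity, ?_, ?_, ?_, ?_⟩
    · linarith [min_le_left (min (r / 2) (r₁ / 4)) (min (r₃ / 4) (η' / (C₁ + 1))),
        min_le_left (r / 2) (r₁ / 4)]
    · linarith [min_le_left (min (r / 2) (r₁ / 4)) (min (r₃ / 4) (η' / (C₁ + 1))),
        min_le_right (r / 2) (r₁ / 4)]
    · linarith [min_le_right (min (r / 2) (r₁ / 4)) (min (r₃ / 4) (η' / (C₁ + 1))),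
        min_le_left (r₃ / 4) (η' / (C₁ + 1))]
    · rw [← le_div_iff₀ (by positivity)]
      exact (min_le_right _ _).trans (min_le_right _ _)
  have hcb : Metric.closedBall (0 : EuclideanSpace ℝ (Fin n)) (2 * l) ⊆ Ω :=
    (Metric.closedBall_subset_ball hlr₁).trans hball
  set K : Set (EuclideanSpace ℝ (Fin n)) := closure Ω \ Metric.ball 0 l with hKdef
  have hK : IsCompact K := by
    rw [hKdef, sdiff_eq]
    exact hΩ.isBounded.isCompact_closure.inter_right Metric.isOpen_ball.isClosed_compl
  have hK0 : K ⊆ closure Ω \ {0} := fun x hx => ⟨hx.1, by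
    rintro rfl; exact hx.2 (Metric.mem_ball_self hl)⟩
  have hmemK : ∀ x ∈ closure Ω, l ≤ ‖x‖ → x ∈ K := fun x hx hlx => ⟨hx, by simpa using hlx⟩
  obtain ⟨M, hM⟩ := hK.exists_bound_of_continuousOn
    ((continuousOn_bodyGrad_of_sdiff_zero huΩ hout.contDiffOn).mono hK0)
  have hM' : ∀ x ∈ K, ‖bodyGrad Ω w x‖ ≤ |M| := fun x hx => (hM x hx).trans (le_abs_self M)
  -- Off the ball of radius `l`, `εⁿ D` bounds the gradient perturbation for small `ε`: the bound
  -- for `∇w` plus the tolerance in the uniform convergence.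
  set D := |M| + 1 / l ^ n with hD
  have hD0 : 0 < D := by positivity
  set δ := η / (2 * (n * D * volume.real Ω + 1)) with hδ
  have hvΩ : 0 ≤ volume.real Ω := measureReal_nonneg
  have hδ0 : 0 < δ := by positivity
  obtain ⟨ρ, hρ, htay⟩ := exists_abs_taylor_le hU (hW.of_le (by norm_num)) hK
    ((contDiffOn_bodyGrad huΩ hy.equilibrium.contDiffOn).continuousOn.mono fun x hx => hx.1)
    (fun x hx => hy.equilibrium.grad_mem x hx.1) hδ0
  have hsmall : ∀ᶠ ε : ℝ in 𝓝[>] 0, ε ^ n * D < min l ρ := by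
    have h1 : Tendsto (fun ε : ℝ => ε ^ n * D) (𝓝 0) (𝓝 (0 ^ n * D)) :=
      Continuous.tendsto (by fun_prop) 0
    rw [zero_pow hn.ne', zero_mul] at h1
    exact (h1.mono_left nhdsWithin_le_nhds).eventually_lt_const (lt_min hl hρ)
  have hln : 0 < l ^ n := by positivity
  filter_upwards [self_mem_nhdsWithin, eventually_closure_smul_subset_ball hω.isBounded hl, hyε,
    Metric.tendstoUniformlyOn_iff.1 (hout.tendsto K hK hK0) (η' / l ^ n) (by positivity),
    Metric.tendstoUniformlyOn_iff.1 (hout.tendsto_grad K hK hK0) (1 / l ^ n) (by positivity),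
    hsmall] with ε hε hsub hsolve hwε hDwε hεD
  have hε0 : (0 : ℝ) < ε := hε
  have hεn : 0 < ε ^ n := by positivity
  have hΔ : ∀ x ∈ K, ‖bodyGrad (voided Ω ω ε) (yε ε) x - bodyGrad Ω y x‖ ≤
      ε ^ n * (‖bodyGrad Ω w x‖ + 1 / l ^ n) := fun x hx =>
    norm_le_of_dist_inv_smul_lt hεn (hDwε x hx)
  have hΔD : ∀ x ∈ K, ‖bodyGrad (voided Ω ω ε) (yε ε) x - bodyGrad Ω y x‖ ≤ ε ^ n * D :=
    fun x hx => (hΔ x hx).trans (by rw [hD]; gcongr; exact hM' x hx)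
  have hua : ∀ x : EuclideanSpace ℝ (Fin n), l ≤ ‖x‖ → ‖x‖ ≤ 2 * l →
      ‖yε ε x - y x‖ ≤ ε ^ n * (2 * η' / l ^ n) := by
    intro x hlx hxl
    have hxΩ : x ∈ Ω := hcb (by simpa using hxl)
    have hx0 : x ≠ 0 := norm_pos_iff.1 (hl.trans_le hlx)
    refine (norm_le_of_dist_inv_smul_lt hεn (hwε x (hmemK x (subset_closure hxΩ) hlx))).trans ?_
    have h1 : ‖w x‖ ≤ η' / l ^ n := by
      rw [le_div_iff₀ hln, mul_comm]
      refine le_trans ?_ (hws x hx0 (hxl.trans_lt hlr₃))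
      gcongr
    gcongr
    calc ‖w x‖ + η' / l ^ n ≤ η' / l ^ n + η' / l ^ n := by gcongr
      _ = 2 * η' / l ^ n := by ring
  have hΔa : ∀ x : EuclideanSpace ℝ (Fin n), l ≤ ‖x‖ → ‖x‖ ≤ 2 * l →
      ‖bodyGrad (voided Ω ω ε) (yε ε) x - bodyGrad Ω y x‖ ≤ ε ^ n * ((C₁ + 1) / l ^ n) := by
    intro x hlx hxl
    have hxΩ : x ∈ Ω := hcb (by simpa using hxl)
    have hx0 : x ≠ 0 := norm_pos_iff.1 (hl.trans_le hlx)
    refine (hΔ x (hmemK x (subset_closure hxΩ) hlx)).trans ?_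
    have h1 : ‖bodyGrad Ω w x‖ ≤ C₁ / l ^ n := by
      rw [bodyGrad_eq_fderiv hΩ.isOpen hxΩ]
      refine (hDw x hx0 (hxl.trans_lt hlr₁)).2.trans ?_
      gcongr
    gcongr
    calc ‖bodyGrad Ω w x‖ + 1 / l ^ n ≤ C₁ / l ^ n + 1 / l ^ n := by gcongr
      _ = (C₁ + 1) / l ^ n := by ring
  set b := C * (l ^ 2 * (ε ^ n * ((C₁ + 1) / l ^ n)) + l * (ε ^ n * (2 * η' / l ^ n))) with hb
  have hvol : volume.real (Metric.closedBall (0 : EuclideanSpace ℝ (Fin n)) (2 * l)) =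
      (2 * l) ^ n * κ := by
    rw [hκ, Measure.addHaar_real_closedBall' volume _ (by positivity), finrank_euclideanSpace_fin]
  refine (abs_energy_difference_le (a := δ * (ε ^ n * D)) (b := b) hU hW hΩ hω hn hε0 hl hsub hcb hy
    hsolve (fderiv ℝ W (bodyGrad Ω y 0)) (y 0) (by positivity) (by positivity) (hθ l hl)
    (fun x hx hlx => ?_) fun x hlx hxl => ?_).trans ?_
  · have hxK := hmemK x hx hlx
    refine (htay x hxK _ ((hΔD x hxK).trans_lt (hεD.trans_le (min_le_right _ _)))).trans ?_
    gcongr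
    exact hΔD x hxK
  · have hxK := hmemK x (subset_closure (hcb (by simpa using hxl))) hlx
    refine (hflux l hl hlr x hlx hxl _ _
      ((hΔD x hxK).trans (hεD.trans_le (min_le_left _ _)).le)).trans ?_
    rw [hb]
    gcongr
    · exact hΔa x hlx hxl
    · exact hua x hlx hxl
  · rw [hvol]
    have e1 : n * (δ * (ε ^ n * D)) * volume.real Ω ≤ η / 2 * ε ^ n := by
      have h1 : δ * (n * D * volume.real Ω) ≤ η / 2 := by
        calc δ * (n * D * volume.real Ω) ≤ δ * (n * D * volume.real Ω + 1) := by
              gcongr; linarith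
          _ = η / 2 := by rw [hδ]; field_simp
      calc n * (δ * (ε ^ n * D)) * volume.real Ω = δ * (n * D * volume.real Ω) * ε ^ n := by ring
        _ ≤ _ := by gcongr
    -- Scale count: the volume `(2l)ⁿ` cancels `l⁻ⁿ` from the corrector, and the `1 / l` of `∇χ`
    -- cancels one `l` of the remainder. What is left is `l (C₁ + 1) + 2η' ≤ 3η'`.
    have e2 : 2 * Cθ / l * b * ((2 * l) ^ n * κ) ≤ η / 2 * ε ^ n := by
      have h1 : 2 * Cθ / l * b * ((2 * l) ^ n * κ) =
          2 * Cθ * C * 2 ^ n * κ * (l * (C₁ + 1) + 2 * η') * ε ^ n := by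
        rw [hb, mul_pow]; field_simp
      have h2 : 2 * Cθ * C * 2 ^ n * κ * (l * (C₁ + 1) + 2 * η') ≤ η / 2 := by
        calc 2 * Cθ * C * 2 ^ n * κ * (l * (C₁ + 1) + 2 * η')
            ≤ 2 * Cθ * C * 2 ^ n * κ * (η' + 2 * η') := by gcongr
          _ = η' * (6 * Cθ * C * 2 ^ n * κ) := by ring
          _ ≤ η' * (6 * Cθ * C * 2 ^ n * κ + 1) := by gcongr; linarith
          _ = η / 2 := by rw [hη']; field_simp
      rw [h1]
      gcongr
    calc _ ≤ η / 2 * ε ^ n + η / 2 * ε ^ n := add_le_add e1 e2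
      _ = η * ε ^ n := by ring

/-- Convergence of the rescaled flux out of the void. -/
lemma tendsto_integral_void_flux (hU : IsOpen U) (hW : ContDiffOn ℝ 2 W U)
    (hΩ : IsC1Domain Ω) (hω : IsC1Domain ω) (h0 : (0 : EuclideanSpace ℝ (Fin n)) ∈ Ω)
    (hyε : ∀ᶠ ε : ℝ in 𝓝[>] 0, SolvesVoided W U Ω ω ε t (yε ε))
    {F₀ : EuclideanSpace ℝ (Fin n) →L[ℝ] EuclideanSpace ℝ (Fin m)}
    (hyin : SolvesExterior W U ω F₀ yin) (hin : InnerExpansion Ω ω yε yin) :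
    Tendsto (fun ε : ℝ => ∫ z in frontier ω, W (bodyGrad (voided Ω ω ε) (yε ε) (ε • z)) *
        inner ℝ (outwardNormal ω z) z ∂surfaceMeasure n) (𝓝[>] 0)
      (𝓝 (∫ z in frontier ω, W (bodyGrad (exterior ω) yin z) *
        inner ℝ (outwardNormal ω z) z ∂surfaceMeasure n)) := by
  have hue := uniqueDiffOn_closure (isOpen_exterior ω)
    (exists_isOutwardNormal_exterior hω.isOpen hω.boundary)
  have hfc : frontier ω ⊆ ωᶜ := fun z hz hzω => hz.2 (hω.isOpen.interior_eq.symm ▸ hzω)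
  have hK : IsCompact (frontier ω) :=
    hω.isBounded.isCompact_closure.of_isClosed_subset isClosed_frontier frontier_subset_closure
  have hfce : frontier ω ⊆ closure (exterior ω) := by
    rw [closure_exterior hω.isOpen hω.boundary]; exact hfc
  have hν : ContinuousOn (fun z => inner ℝ (outwardNormal ω z) z) (frontier ω) :=
    (continuousOn_outwardNormal hω.isOpen hω.boundary).inner continuousOn_id
  have hint : ∀ f : EuclideanSpace ℝ (Fin n) → ℝ, ContinuousOn f (frontier ω) →
      IntegrableOn f (frontier ω) (surfaceMeasure n) := fun f hf =>
    integrableOn_frontier_of_compact hω.isBounded.isCompact_closure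
      (surfaceMeasure_frontier_inter_lt_top hω.isOpen hω.boundary hω.isBounded.isCompact_closure)
      hf fun x hx hxc => absurd hx.1 hxc
  have hG := (contDiffOn_bodyGrad hue hyin.equilibrium.contDiffOn).continuousOn.mono hfce
  have hgi : IntegrableOn (fun z => W (bodyGrad (exterior ω) yin z) *
      inner ℝ (outwardNormal ω z) z) (frontier ω) (surfaceMeasure n) := hint _ (((hyin.equilibrium.contDiffOn_energy hue hW).continuousOn.mono hfce).mul hν)
  have hνi := hint _ hν.norm
  set J := ∫ z in frontier ω, ‖inner ℝ (outwardNormal ω z) z‖ ∂surfaceMeasure n with hJ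
  have hJ0 : 0 ≤ J := integral_nonneg fun z => norm_nonneg _
  rw [Metric.tendsto_nhds]
  intro η hη
  have hδ : 0 < η / (J + 1) := by positivity
  have hcW : ∀ a ∈ bodyGrad (exterior ω) yin '' frontier ω, ContinuousAt W a := by
    rintro _ ⟨z, hz, rfl⟩
    exact hW.continuousOn.continuousAt (hU.mem_nhds (hyin.equilibrium.grad_mem z (hfce hz)))
  -- `W` is uniformly continuous near the compact set of inner gradients on `∂ω`, so uniform
  -- convergence of the gradients passes to the energies.
  obtain ⟨ρ, hρ, huc⟩ := Metric.mem_uniformity_dist.1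
    ((hK.image_of_continuousOn hG).uniformContinuousAt_of_continuousAt _ hcW
      (Metric.dist_mem_uniformity hδ))
  obtain ⟨a, ha, hball⟩ := Metric.isOpen_iff.1 hΩ.isOpen 0 h0
  filter_upwards [self_mem_nhdsWithin, eventually_closure_smul_subset_ball hω.isBounded ha, hyε,
    Metric.tendstoUniformlyOn_iff.1 (hin _ hK hfc) ρ hρ] with ε hε hsub' hsolve hclose
  have hε0 : (0 : ℝ) < ε := hε
  have hsub := hsub'.trans hball
  have hu := uniqueDiffOn_closure_voided hΩ hω hε0 hsub
  have hmaps : MapsTo (fun z : EuclideanSpace ℝ (Fin n) => ε • z) (frontier ω)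
      (closure (voided Ω ω ε)) := by
    intro z hz
    have h1 : ε • z ∈ frontier (ε • ω) := by
      rw [frontier_smul_set ω hε0]; exact smul_mem_smul_set hz
    refine (mem_closure_voided hΩ.isOpen hω.isOpen hω.boundary hε0 hsub).2
      ⟨subset_closure (hsub h1.1), fun hc => h1.2 ?_⟩
    rwa [(hω.isOpen.smul₀ hε0.ne').interior_eq]
  have hfi : IntegrableOn (fun z => W (bodyGrad (voided Ω ω ε) (yε ε) (ε • z)) *
      inner ℝ (outwardNormal ω z) z) (frontier ω) (surfaceMeasure n) := hint _ (((hsolve.equilibrium.contDiffOn_energy hu hW).continuousOn.comp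
    (continuous_const_smul ε).continuousOn hmaps).mul hν)
  rw [dist_eq_norm, ← integral_sub hfi hgi]
  have hle : ‖∫ z in frontier ω, (W (bodyGrad (voided Ω ω ε) (yε ε) (ε • z)) *
        inner ℝ (outwardNormal ω z) z - W (bodyGrad (exterior ω) yin z) *
        inner ℝ (outwardNormal ω z) z) ∂surfaceMeasure n‖ ≤
      ∫ z in frontier ω, η / (J + 1) * ‖inner ℝ (outwardNormal ω z) z‖ ∂surfaceMeasure n := by
    refine norm_integral_le_of_norm_le (hνi.const_mul _) ?_
    refine (ae_restrict_iff' isClosed_frontier.measurableSet).2 (Eventually.of_forall fun z hz => ?_)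
    rw [← sub_mul, norm_mul]
    gcongr
    have h2 := huc (hclose z hz) (mem_image_of_mem _ hz)
    rw [mem_ofPred_eq, dist_comm, dist_eq_norm] at h2
    exact h2.le
  rw [integral_const_mul] at hle
  refine hle.trans_lt ?_
  rw [← hJ, div_mul_eq_mul_div, div_lt_iff₀ (by positivity)]
  nlinarith

end Limits

end VoidNucleation

end

/-! ### The limit of the rescaled energy difference -/

theorem mainTheorem7 {n m : ℕ}
    (W : (EuclideanSpace ℝ (Fin n) →L[ℝ] EuclideanSpace ℝ (Fin m)) → ℝ)
    (U : Set (EuclideanSpace ℝ (Fin n) →L[ℝ] EuclideanSpace ℝ (Fin m)))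
    (hU : IsOpen U) (hW : ContDiffOn ℝ 2 W U)
    (Ω ω : Set (EuclideanSpace ℝ (Fin n)))
    (hΩ : VoidNucleation.IsC1Domain Ω) (hω : VoidNucleation.IsC1Domain ω)
    (h0Ω : (0 : EuclideanSpace ℝ (Fin n)) ∈ Ω) (h0ω : (0 : EuclideanSpace ℝ (Fin n)) ∈ ω)
    (hconn : ∀ᶠ ε : ℝ in 𝓝[>] 0, IsConnected (VoidNucleation.voided Ω ω ε))
    (t y w yin : EuclideanSpace ℝ (Fin n) → EuclideanSpace ℝ (Fin m))
    (yε : ℝ → EuclideanSpace ℝ (Fin n) → EuclideanSpace ℝ (Fin m))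
    (hy : VoidNucleation.SolvesIntact W U Ω t y)
    (hyε : ∀ᶠ ε : ℝ in 𝓝[>] 0, VoidNucleation.SolvesVoided W U Ω ω ε t (yε ε))
    (hout : VoidNucleation.OuterExpansion Ω ω yε y w)
    (hyin : VoidNucleation.SolvesExterior W U ω (VoidNucleation.bodyGrad Ω y 0) yin)
    (hin : VoidNucleation.InnerExpansion Ω ω yε yin)
    (hfar : VoidNucleation.FarFieldAsymptotics (VoidNucleation.bodyGrad Ω y 0) yin)
    (hmatch : VoidNucleation.Matching Ω ω y w yin) :
    Tendsto
      (fun ε : ℝ =>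
        (VoidNucleation.potentialEnergy W (VoidNucleation.voided Ω ω ε) (frontier Ω) t (yε ε) -
            VoidNucleation.potentialEnergy W Ω (frontier Ω) t y) / ε ^ n)
      (𝓝[>] 0)
      (𝓝 (-(1 / (n : ℝ)) *
        ∫ z in frontier ω,
          W (VoidNucleation.bodyGrad (VoidNucleation.exterior ω) yin z) *
            inner ℝ (VoidNucleation.outwardNormal ω z) z
          ∂(VoidNucleation.surfaceMeasure n))) := by
  -- In dimension `0` the void would be the whole space and the voided body empty, against its
  -- connectedness.
  have hn : 0 < n := by
    rw [pos_iff_ne_zero]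
    rintro rfl
    obtain ⟨ε, x, hx⟩ := hconn.exists.imp fun ε h => h.nonempty
    exact hx.2 (subset_closure ⟨0, h0ω, Subsingleton.elim _ _⟩)
  have hn0 : (n : ℝ) ≠ 0 := by exact_mod_cast hn.ne'
  set I : ℝ → ℝ := fun ε => ∫ z in frontier ω,
    W (VoidNucleation.bodyGrad (VoidNucleation.voided Ω ω ε) (yε ε) (ε • z)) *
      inner ℝ (VoidNucleation.outwardNormal ω z) z ∂VoidNucleation.surfaceMeasure n with hI
  set ΔE : ℝ → ℝ := fun ε =>
    VoidNucleation.potentialEnergy W (VoidNucleation.voided Ω ω ε) (frontier Ω) t (yε ε) -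
      VoidNucleation.potentialEnergy W Ω (frontier Ω) t y with hΔE
  have h1 : Tendsto (fun ε => (n * ΔE ε + ε ^ n * I ε) / ε ^ n) (𝓝[>] 0) (𝓝 0) := by
    rw [Metric.tendsto_nhds]
    intro η hη
    filter_upwards [self_mem_nhdsWithin, VoidNucleation.eventually_abs_energy_difference_le hn hU hW
      hΩ hω h0Ω hy hyε hout hyin hmatch (half_pos hη)] with ε hε hle
    have hεn : (0 : ℝ) < ε ^ n := pow_pos hε n
    rw [dist_zero_right, Real.norm_eq_abs, abs_div, abs_of_pos hεn, div_lt_iff₀ hεn]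
    exact hle.trans_lt (by gcongr; linarith)
  have h2 := VoidNucleation.tendsto_integral_void_flux hU hW hΩ hω h0Ω hyε hyin hin
  -- Since `h1` says that `n ΔE / εⁿ + I → 0`, subtracting the limit of `I` and dividing by `n`
  -- gives the claim.
  have h3 := (h1.sub h2).const_mul (1 / (n : ℝ))
  rw [zero_sub, mul_neg, ← neg_mul] at h3
  refine h3.congr' ?_
  filter_upwards [self_mem_nhdsWithin] with ε hε
  have hεn : (0 : ℝ) < ε ^ n := pow_pos hε n
  change 1 / (n : ℝ) * ((n * ΔE ε + ε ^ n * I ε) / ε ^ n - I ε) = ΔE ε / ε ^ n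
  field_simp
  ring
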